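/- **Model.** Let $L\ge 1$, $t>0$. Consider an $L\times L$ Lieb lattice: one $d$ orbital on each vertex $\mathbf R=(i,j)$, $1\le i,j\le L$, and one $p$ orbital on each bond of each row and each column. With open boundary conditions (OBC) dangling bonds are kept, so every row and column has $L+1$ bonds; with periodic boundary conditions (PBC) it has $L$ bonds. Spin-$\frac12$ electrons live on these orbitals; no orbital is doubly occupied ($U=\infty$) and every $d$ orbital is singly occupied. On these states the Hamiltonian is the projection onto states without double occupancy of $$T=-t\sum_{\mathbf R}\sum_{\delta=x,y}\sum_{\sigma,\sigma'=\uparrow,\downarrow}\Big(d^\dagger_{\mathbf R,\sigma}\,p^\dagger_{\mathbf R+\hat\delta/2,\sigma'}\,d_{\mathbf R,\sigma'}\,p_{\mathbf R-\hat\delta/2,\sigma}+\mathrm{H.c.}\Big).$$ The number $X(y)$ of $p$-electrons on the bonds of row $y$, the number $Y(x)$ on the bonds of column $x$, and the total spin are conserved. Write $N_p=\sum_yX(y)+\sum_xY(x)$ and $N=L^2+N_p$ for the numbers of $p$-electrons and of all electrons. The $2L$ rows and columns are called wires. If all spins are up, the wires are decoupled free-fermion chains with dispersion $E_k=-2t\cos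 k$ (after the sign change $p_k\to(-1)^kp_k$ along each wire). The $m$ lowest single-particle states of a wire that carries $m$ electrons have momenta $k_j$, $1\le j\le m$, with $k_j=\frac{\pi j}{L+2}$ (OBC) and $k_j=\frac{\pi(2j-m-1)}{L}$ (PBC, $L+m$ odd); put $\mathcal E(m)=\sum_{j=1}^m(-2t\cos k_j)$. For charges $Q=(X(y),Y(x))$ let $|\mathrm{FS}(Q)\rangle$ be the Fermi sea in which every $d$ electron has spin up and, on each wire $w$, the $Q_w$ lowest single-particle states are filled with spin-up electrons. **Theorem (unique half-metallic ground state).** Let $Q=(X(y),Y(x))$ satisfy $0<X(y)<L$ and $0<Y(x)<L$ for all $y$ and $x$ (under OBC: every row and column holds at least one $p$-electron and at least two vacancies). Under PBC assume also that $L+X(y)$ and $L+Y(x)$ are odd for all $y$ and $x$. 1. *Each sector.* For every $s=0,1,\dots,N$, in the sector with row and column charges $Q$ and $S^z_{\rm tot}=\frac N2-s$ the ground-state energy is $\sum_w\mathcal E(Q_w)$, and the ground state is unique up to a scalar; it is $(S^-_{\rm tot})^s|\mathrm{FS}(Q)\rangle$ and is fully spin-polarized, i.e. $\mathbf S_{\rm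 tot}^2=\frac N2(\frac N2+1)$. 2. *Fixed number of electrons.* Put $c=1$ for OBC and $c=2$ for PBC. One can write $N_p=2Ld+cr$ with integers $d\ge0$, $0\le r<2L$, where under PBC $L+d$ is odd. Consider all $N$-electron states of the model, with arbitrary spin and arbitrary row and column charges (under PBC: with charges such that the number of electrons on every row and every column, including the $d$ electrons, is odd). On this space the ground-state energy is $(2L-r)\,\mathcal E(d)+r\,\mathcal E(d+c)$. The space of ground states consists of fully spin-polarized states and has dimension $$(N+1)\binom{2L}{r}.$$ It is spanned by the states $(S^-_{\rm tot})^s|\mathrm{FS}(Q_A)\rangle$, where $0\le s\le N$, $A$ is a set of $r$ wires, and $Q_A$ puts $d+c$ electrons on each wire in $A$ and $d$ electrons on every other wire. -/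

import Mathlib

noncomputable section

namespace LiebLattice

/-! ## Fermionic Fock space over an ordered set of modes -/

/-- Fock space of fermions with modes `α`: amplitudes in the occupation-number basis, whose elements
are the finite sets `S` of occupied modes (the Slater determinant `c†_{a₁} ⋯ c†_{aₙ} |∅⟩` with
`S = {a₁ < ⋯ < aₙ}`). -/
abbrev Fock (α : Type) : Type := Finset α → ℂ

/-- The sign picked up when an operator of mode `a` is moved past the occupied modes below `a`. -/
def jwSign {α : Type} [LinearOrder α] (a : α) (S : Finset α) : ℂ :=
  (-1) ^ (S.filter (fun b => b < a)).card

/-- The creation operator `c†_a`. -/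
def create {α : Type} [LinearOrder α] (a : α) : Module.End ℂ (Fock α) where
  toFun f := fun S => if a ∈ S then jwSign a S * f (S.erase a) else 0
  map_add' f g := by
    funext S
    by_cases h : a ∈ S <;> simp [h, mul_add]
  map_smul' z f := by
    funext S
    by_cases h : a ∈ S <;> simp [h, mul_left_comm]

/-- The annihilation operator `c_a`, the adjoint of `c†_a`. -/
def annihilate {α : Type} [LinearOrder α] (a : α) : Module.End ℂ (Fock α) where
  toFun f := fun S => if a ∈ S then 0 else jwSign a S * f (insert a S)
  map_add' f g := by
    funext S
    by_cases h : a ∈ S <;> simp [h, mul_add]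
  map_smul' z f := by
    funext S
    by_cases h : a ∈ S <;> simp [h, mul_left_comm]

/-- The state without electrons. -/
def vacuum {α : Type} : Fock α :=
  open scoped Classical in fun S => if S = ∅ then 1 else 0

/-- The states supported on the basis configurations with property `p`. -/
def supported {α : Type} (p : Finset α → Prop) : Submodule ℂ (Fock α) where
  carrier := {f | ∀ S, f S ≠ 0 → p S}
  zero_mem' := by
    intro S h
    simp at h
  add_mem' := by
    intro f g hf hg S h
    by_cases h0 : f S = 0
    · exact hg S (by simpa [h0] using h)
    · exact hf S h0
  smul_mem' := by
    intro z f hf S h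
    exact hf S (fun h0 => h (by simp [h0]))

/-- The projection onto the states supported on the configurations with property `p`. -/
def project {α : Type} (p : Finset α → Prop) : Module.End ℂ (Fock α) where
  toFun f := open scoped Classical in fun S => if p S then f S else 0
  map_add' f g := by
    funext S
    by_cases h : p S <;> simp [h]
  map_smul' z f := by
    funext S
    by_cases h : p S <;> simp [h]

/-- The (real) energies of eigenstates of `H` in `V`. For a Hermitian `H` that leaves `V` invariant
this is the spectrum of `H` on `V`, and its least element is the ground-state energy on `V`. -/
def energies {α : Type} (H : Module.End ℂ (Fock α)) (V : Submodule ℂ (Fock α)) : Set ℝ :=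
  {E | ∃ ψ ∈ V, ψ ≠ 0 ∧ H ψ = (E : ℂ) • ψ}

/-- `E` is the ground-state energy of `H` on `V`, and `G` is the space of all ground states of `H`
on `V`. -/
def HasGroundSpace {α : Type} (H : Module.End ℂ (Fock α)) (V : Submodule ℂ (Fock α)) (E : ℝ)
    (G : Submodule ℂ (Fock α)) : Prop :=
  IsLeast (energies H V) E ∧ V ⊓ Module.End.eigenspace H (E : ℂ) = G

/-! ## The `L × L` Lieb lattice -/

/-- The open boundary condition with dangling bonds, and the periodic boundary condition. -/
inductive Boundary where
  | obc
  | pbc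

/-- The number of bonds on each row and each column. -/
def Boundary.bonds : Boundary → ℕ → ℕ
  | .obc, L => L + 1
  | .pbc, L => L

/-- The bond just before (to the left of, or below) the `k`-th vertex of a row or column. -/
def Boundary.before : (b : Boundary) → {L : ℕ} → Fin L → Fin (b.bonds L)
  | .obc, _, k => k.castSucc
  | .pbc, _, k => k

/-- The bond just after (to the right of, or above) the `k`-th vertex of a row or column; with the
periodic boundary condition the bond after the last vertex is the one before the first vertex. -/
def Boundary.after : (b : Boundary) → {L : ℕ} → Fin L → Fin (b.bonds L)
  | .obc, _, k => k.succ
  | .pbc, L, k => finRotate L k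

/-- The two bond directions. A line in direction `x` is a row, one in direction `y` a column. -/
inductive Dir where
  | x
  | y
  deriving DecidableEq

instance : Fintype Dir where
  elems := {.x, .y}
  complete := by rintro (_ | _) <;> simp

/-- The two spin states. -/
inductive Spin where
  | up
  | down
  deriving DecidableEq

instance : Fintype Spin where
  elems := {.up, .down}
  complete := by rintro (_ | _) <;> simp

/-- The row (for `δ = x`) or column (for `δ = y`) through the vertex with coordinates `(i, j)`. -/
def Dir.line {L : ℕ} : Dir → Fin L → Fin L → Fin L
  | .x, _, j => j
  | .y, i, _ => i

/-- The position of the vertex `(i, j)` along its line of direction `δ`. -/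
def Dir.coord {L : ℕ} : Dir → Fin L → Fin L → Fin L
  | .x, i, _ => i
  | .y, _, j => j

/-- Orbitals: `bond δ ℓ k` is the `p` orbital on the `k`-th bond of line `ℓ` of direction `δ`,
`vertex i j` is the `d` orbital on the vertex `(i, j)`. -/
inductive Site (b : Boundary) (L : ℕ) where
  | bond (δ : Dir) (ℓ : Fin L) (k : Fin (b.bonds L))
  | vertex (i j : Fin L)
  deriving DecidableEq

/-- Single-electron modes: an orbital with a spin. -/
structure Mode (b : Boundary) (L : ℕ) where
  site : Site b L
  spin : Spin

/-- The position of a mode in the order that fixes the signs of the basis states: row bonds line by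
line, then column bonds line by line, then vertices. -/
def Mode.key {b : Boundary} {L : ℕ} : Mode b L → ℕ ×ₗ ℕ ×ₗ ℕ ×ₗ ℕ
  | ⟨.bond .x ℓ k, .up⟩ => toLex (0, toLex (ℓ.val, toLex (k.val, 0)))
  | ⟨.bond .x ℓ k, .down⟩ => toLex (0, toLex (ℓ.val, toLex (k.val, 1)))
  | ⟨.bond .y ℓ k, .up⟩ => toLex (1, toLex (ℓ.val, toLex (k.val, 0)))
  | ⟨.bond .y ℓ k, .down⟩ => toLex (1, toLex (ℓ.val, toLex (k.val, 1)))
  | ⟨.vertex i j, .up⟩ => toLex (2, toLex (i.val, toLex (j.val, 0)))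
  | ⟨.vertex i j, .down⟩ => toLex (2, toLex (i.val, toLex (j.val, 1)))

theorem Mode.key_injective {b : Boundary} {L : ℕ} :
    Function.Injective (Mode.key : Mode b L → ℕ ×ₗ ℕ ×ₗ ℕ ×ₗ ℕ) := by
  rintro ⟨s, σ⟩ ⟨s', σ'⟩ h
  rcases s with ⟨δ, ℓ, k⟩ | ⟨i, j⟩ <;> rcases s' with ⟨δ', ℓ', k'⟩ | ⟨i', j'⟩ <;>
    rcases σ <;> rcases σ' <;> (try rcases δ) <;> (try rcases δ') <;>
    simp_all [Mode.key, Prod.ext_iff, Fin.ext_iff]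

instance {b : Boundary} {L : ℕ} : LinearOrder (Mode b L) :=
  LinearOrder.lift' Mode.key Mode.key_injective

/-! ## Occupation numbers and charges -/

/-- The number of electrons on the orbital `s`. -/
def occupation {b : Boundary} {L : ℕ} (S : Finset (Mode b L)) (s : Site b L) : ℕ :=
  (S.filter (fun a => a.site = s)).card

/-- The constraint `U = ∞`. -/
def NoDoubleOccupancy {b : Boundary} {L : ℕ} (S : Finset (Mode b L)) : Prop :=
  ∀ s, occupation S s ≤ 1

/-- The configurations of the model: no double occupancy, and every `d` orbital singly occupied. -/
def Physical {b : Boundary} {L : ℕ} (S : Finset (Mode b L)) : Prop :=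
  NoDoubleOccupancy S ∧ ∀ i j, occupation S (.vertex i j) = 1

/-- Numbers of `p`-electrons on all rows and columns: `Q .x j` on row `j`, `Q .y i` on column `i`. -/
abbrev Charges (L : ℕ) : Type := Dir → Fin L → ℕ

/-- The row and column charges of a configuration. -/
def lineCharges {b : Boundary} {L : ℕ} (S : Finset (Mode b L)) : Charges L :=
  fun δ ℓ => ∑ k, occupation S (.bond δ ℓ k)

/-- The `z`-component of the total spin of a configuration. -/
def spinZ {b : Boundary} {L : ℕ} (S : Finset (Mode b L)) : ℚ :=
  (((S.filter (fun a => a.spin = .up)).card : ℚ) - (S.filter (fun a => a.spin = .down)).card) / 2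

/-- The total number `N_p` of `p`-electrons. -/
def Charges.total {L : ℕ} (Q : Charges L) : ℕ := ∑ δ, ∑ ℓ, Q δ ℓ

/-- The total number `N = N_d + N_p` of electrons. -/
def Charges.electrons {L : ℕ} (Q : Charges L) : ℕ := L * L + Q.total

/-- The fermion-parity condition: with the periodic boundary condition the number of electrons on
every row and every column (`L` of them on vertices) is odd. No condition for open boundaries. -/
def Boundary.ParityOK : Boundary → {L : ℕ} → Charges L → Prop
  | .obc, _, _ => True
  | .pbc, L, Q => ∀ δ ℓ, Odd (L + Q δ ℓ)

/-- The conditions on the charges under which uniqueness is claimed. -/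
def Boundary.Admissible (b : Boundary) {L : ℕ} (Q : Charges L) : Prop :=
  b.ParityOK Q ∧ ∀ δ ℓ, 0 < Q δ ℓ ∧ Q δ ℓ < L

/-- The states with given row and column charges and given `S^z_tot`. -/
def sector (b : Boundary) {L : ℕ} (Q : Charges L) (m : ℚ) : Submodule ℂ (Fock (Mode b L)) :=
  supported (fun S => Physical S ∧ lineCharges S = Q ∧ spinZ S = m)

/-- The states with `N` electrons and with arbitrary row and column charges (subject to the parity
condition if the boundary condition is periodic) and arbitrary spin. -/
def fixedNumber (b : Boundary) (L N : ℕ) : Submodule ℂ (Fock (Mode b L)) :=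
  supported (fun S => Physical S ∧ S.card = N ∧ b.ParityOK (lineCharges S))

/-! ## The Hamiltonian and the total spin -/

/-- The correlated hopping through vertex `(i, j)` in direction `δ`:
`d†_{R,σ} p†_{R+δ/2,σ'} d_{R,σ'} p_{R-δ/2,σ}` plus its Hermitian conjugate, summed over spins. -/
def vertexHop (b : Boundary) {L : ℕ} (δ : Dir) (i j : Fin L) : Module.End ℂ (Fock (Mode b L)) :=
  let d : Spin → Mode b L := fun σ => ⟨.vertex i j, σ⟩
  let p : Spin → Mode b L := fun σ => ⟨.bond δ (δ.line i j) (b.before (δ.coord i j)), σ⟩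
  let p' : Spin → Mode b L := fun σ => ⟨.bond δ (δ.line i j) (b.after (δ.coord i j)), σ⟩
  ∑ σ, ∑ σ',
    (create (d σ) * create (p' σ') * annihilate (d σ') * annihilate (p σ)
      + create (p σ) * create (d σ') * annihilate (p' σ') * annihilate (d σ))

/-- The Hamiltonian: the correlated hopping with amplitude `-t`, projected onto the states without
doubly occupied orbitals. -/
def hamiltonian (b : Boundary) (L : ℕ) (t : ℝ) : Module.End ℂ (Fock (Mode b L)) :=
  project NoDoubleOccupancy * ((-t : ℂ) • ∑ i, ∑ j, ∑ δ, vertexHop b δ i j)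
    * project NoDoubleOccupancy

instance {b : Boundary} {L : ℕ} : Fintype (Site b L) :=
  Fintype.ofEquiv ((Dir × Fin L × Fin (b.bonds L)) ⊕ (Fin L × Fin L))
    { toFun := fun s => match s with
        | .inl q => .bond q.1 q.2.1 q.2.2
        | .inr q => .vertex q.1 q.2
      invFun := fun s => match s with
        | .bond δ ℓ k => .inl (δ, ℓ, k)
        | .vertex i j => .inr (i, j)
      left_inv := by rintro (q | q) <;> rfl
      right_inv := by rintro (q | q) <;> rfl }

/-- `S⁺_tot`. -/
def spinRaise (b : Boundary) (L : ℕ) : Module.End ℂ (Fock (Mode b L)) :=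
  ∑ s : Site b L, create ⟨s, .up⟩ * annihilate ⟨s, .down⟩

/-- `S⁻_tot`. -/
def spinLower (b : Boundary) (L : ℕ) : Module.End ℂ (Fock (Mode b L)) :=
  ∑ s : Site b L, create ⟨s, .down⟩ * annihilate ⟨s, .up⟩

/-- `S^z_tot`. -/
def spinZOp (b : Boundary) (L : ℕ) : Module.End ℂ (Fock (Mode b L)) :=
  (1 / 2 : ℂ) • ∑ s : Site b L,
    (create ⟨s, .up⟩ * annihilate ⟨s, .up⟩ - create ⟨s, .down⟩ * annihilate ⟨s, .down⟩)

/-- `S²_tot`. -/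
def spinSq (b : Boundary) (L : ℕ) : Module.End ℂ (Fock (Mode b L)) :=
  (1 / 2 : ℂ) • (spinRaise b L * spinLower b L + spinLower b L * spinRaise b L)
    + spinZOp b L * spinZOp b L

/-- The states of `V` all have the maximal total spin `N / 2`. -/
def FullyPolarized (b : Boundary) (L N : ℕ) (V : Submodule ℂ (Fock (Mode b L))) : Prop :=
  ∀ ψ ∈ V, spinSq b L ψ = ((N : ℂ) / 2 * ((N : ℂ) / 2 + 1)) • ψ

/-! ## Free fermions on the `2 L` wires -/

/-- The momenta, `1 ≤ j ≤ m`, of the `m` lowest single-particle states of a wire that carries `m`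
fermions. An open wire of `L + 1` orbitals has `k = π j / (L + 2)`. On a periodic wire of `L`
orbitals the `m` momenta, spaced by `2 π / L`, are placed symmetrically about zero. -/
def momentum : Boundary → ℕ → ℕ → ℕ → ℝ
  | .obc, L, _, j => Real.pi * j / (L + 2)
  | .pbc, L, m, j => Real.pi * (2 * j - m - 1) / L

/-- The ground-state energy of `m` free fermions with dispersion `E_k = -2 t cos k` on a wire. -/
def wireEnergy (b : Boundary) (L : ℕ) (t : ℝ) (m : ℕ) : ℝ :=
  ∑ j ∈ Finset.Icc 1 m, (-2 * t * Real.cos (momentum b L m j))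

/-- The wave function (not normalized) of the single-particle state with momentum
`momentum b L m j`; the factor `(-1) ^ i` removes the sign of the hopping amplitude. -/
def orbital : (b : Boundary) → (L m j : ℕ) → Fin (b.bonds L) → ℂ
  | .obc, L, m, j, i => (-1) ^ i.val * (Real.sin (momentum .obc L m j * (i.val + 1)) : ℂ)
  | .pbc, L, m, j, i => (-1) ^ i.val * Complex.exp (Complex.I * (momentum .pbc L m j * i.val : ℝ))

/-- Creation of the `m` lowest single-particle states, with spin up, on line `ℓ` of direction `δ`. -/
def fillWire (b : Boundary) {L : ℕ} (δ : Dir) (ℓ : Fin L) (m : ℕ) :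
    Module.End ℂ (Fock (Mode b L)) :=
  ((List.range m).map (fun j => ∑ i, orbital b L m (j + 1) i • create (Mode.mk (.bond δ ℓ i) .up))).prod

/-- The fully polarized Fermi sea: spin up on every vertex, and the `Q δ ℓ` lowest single-particle
states of every wire filled with spin-up electrons. -/
def fermiSea (b : Boundary) {L : ℕ} (Q : Charges L) : Fock (Mode b L) :=
  let rows : Module.End ℂ (Fock (Mode b L)) :=
    ((List.finRange L).map (fun ℓ => fillWire b .x ℓ (Q .x ℓ))).prod
  let columns : Module.End ℂ (Fock (Mode b L)) :=
    ((List.finRange L).map (fun ℓ => fillWire b .y ℓ (Q .y ℓ))).prod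
  let vertices : Module.End ℂ (Fock (Mode b L)) :=
    ((List.finRange L).flatMap
      (fun i => (List.finRange L).map (fun j => create (Mode.mk (.vertex i j) .up)))).prod
  rows (columns (vertices vacuum))

/-- The number of states of equal energy at the Fermi level of a wire: a single momentum for an open
wire, a pair `±k` (filled together, by the parity condition) for a periodic one. -/
def Boundary.shell : Boundary → ℕ
  | .obc => 1
  | .pbc => 2

/-- Each wire filled with `d` electrons, and one more Fermi-level shell filled on the wires in `A`. -/
def uniformCharges (b : Boundary) {L : ℕ} (d : ℕ) (A : Finset (Dir × Fin L)) : Charges L :=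
  fun δ ℓ => if (δ, ℓ) ∈ A then d + b.shell else d

end LiebLattice

end

open LiebLattice

/-!
A configuration without double occupancy is a map `Cfg` from orbitals to "vacant, up or down". On
configurations the Hamiltonian moves an electron from a bond to a vertex and pushes the electron of
that vertex, spin included, to the opposite bond. After multiplication by a product of signs `gauge`
every such move has the amplitude `-t`; for moves around the end of a periodic wire this is where the
parity condition enters (`gauge_mul_hamiltonian`). Hence `-H / t` is the adjacency operator of a graph,
which preserves the charges and the number of down spins, and Perron–Frobenius theory applies once a
positive eigenfunction is known: no eigenvalue exceeds that of the positive eigenfunction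
(`le_of_pos_eigenfunction`), and on a connected graph its eigenspace is one-dimensional
(`eq_const_mul_of_eigenfunction`).

*The positive eigenfunction.* The occupied bonds of each wire move like free fermions, whatever the
spins. The Slater determinant of the lowest orbitals of a wire is an eigenfunction of the motion of its
fermions, being multilinear in its rows (`sum_slaterDet`). It is a Vandermonde determinant in
Chebyshev polynomials (open boundary) or in exponentials (periodic boundary), so up to a constant it is
a product of sines and of differences of cosines, positive at ordered positions
(`exists_slaterDet_sign`). The product `seaAmp` of the moduli over all wires is therefore a positive
eigenfunction with eigenvalue given by the sum of the wire energies (`sum_seaAmp_hop`). With all spins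
up these are, up to a constant, the amplitudes of the Fermi sea (`exists_fermiSea_eq`). As they depend
only on the occupied set, the same amplitudes on the configurations with `s` down spins give the state
obtained by `s` applications of the lowering operator,
which has maximal total spin (`spinLower_pow_symState`, `spinSq_symState`).

*Connectedness.* If every wire has a `p`-electron and two vacancies (open boundary), or a `p`-electron
and a vacancy (periodic boundary), all configurations with the same charges and the same number of down
spins are connected (`reach_of_charges_eq`). When both wires through a vertex can hop over it, the
commutator of the two hops permutes three electrons cyclically and leaves all others in place
(`linked_of_commutator`). As there are only two spin states, one of three electrons repeats the spin of
another, and the exchange of two electrons results. A wire can be prepared for a hop over a given vertex without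
touching this vertex (`exists_carries_active`), so that at a reference pattern any two electrons can be
exchanged (`blockPat_linked`); and every pattern can be moved to the reference pattern
(`exists_carries_packed`).

*Fixed number of electrons.* Adding a shell to a wire with `m` electrons costs an energy proportional
to `-cos (π (m + 1) / M)`, which increases strictly with `m`. The energy of a wire is thus strictly
convex in the number of shells, and the sum over wires with a fixed total is least exactly when the
fillings differ by at most one shell (`uniformCharges_minimal`). The ground states of the resulting
sectors have disjoint supports, which gives the dimension (`finrank_span_seaState`).
-/

noncomputable section

namespace LiebLattice

variable {b : Boundary} {L : ℕ}

/-! ### Configurations as spin assignments -/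

/-- The `k`-th vertex of the line `ℓ` of direction `δ`. -/
def vert (δ : Dir) (ℓ k : Fin L) : Site b L :=
  match δ with
  | .x => .vertex k ℓ
  | .y => .vertex ℓ k

/-- A configuration without double occupancy: the spin on each occupied orbital. -/
abbrev Cfg (b : Boundary) (L : ℕ) : Type := Site b L → Option Spin

instance : Fintype (Mode b L) :=
  Fintype.ofEquiv (Site b L × Spin)
    { toFun := fun q => ⟨q.1, q.2⟩
      invFun := fun a => (a.site, a.spin)
      left_inv := fun _ => rfl
      right_inv := fun _ => rfl }

/-- The set of modes occupied in a configuration. -/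
def modes (c : Cfg b L) : Finset (Mode b L) :=
  Finset.univ.filter (fun a => c a.site = some a.spin)

@[simp] theorem mem_modes {c : Cfg b L} {a : Mode b L} : a ∈ modes c ↔ c a.site = some a.spin := by
  simp [modes]

theorem modes_injective : Function.Injective (modes : Cfg b L → Finset (Mode b L)) := by
  intro c c' h
  funext x
  have key : ∀ σ, c x = some σ ↔ c' x = some σ := fun σ => by
    have := Finset.ext_iff.1 h ⟨x, σ⟩
    simpa using this
  rcases h1 : c x with _ | σ
  · rcases h2 : c' x with _ | σ
    · rfl
    · simpa [h1] using (key σ).2 h2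
  · exact ((key σ).1 h1).symm

theorem occupation_modes (c : Cfg b L) (x : Site b L) :
    occupation (modes c) x = if c x = none then 0 else 1 := by
  unfold occupation
  rcases h : c x with _ | σ
  · simp only [if_true, Finset.card_eq_zero, Finset.filter_eq_empty_iff, mem_modes]
    rintro ⟨y, τ⟩ hy rfl
    simp_all
  · simp only [reduceCtorEq, if_false]
    rw [Finset.card_eq_one]
    refine ⟨⟨x, σ⟩, ?_⟩
    ext ⟨y, τ⟩
    simp only [Finset.mem_filter, mem_modes, Finset.mem_singleton, Mode.mk.injEq]
    constructor
    · rintro ⟨h1, rfl⟩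
      simp_all
    · rintro ⟨rfl, rfl⟩
      exact ⟨h, rfl⟩

theorem noDoubleOccupancy_modes (c : Cfg b L) : NoDoubleOccupancy (modes c) := by
  intro x
  rw [occupation_modes]
  split_ifs <;> simp

theorem exists_modes_eq {S : Finset (Mode b L)} (hS : NoDoubleOccupancy S) :
    ∃ c : Cfg b L, modes c = S := by
  classical
  refine ⟨fun x => if h : ∃ σ, (⟨x, σ⟩ : Mode b L) ∈ S then some h.choose else none, ?_⟩
  ext ⟨x, σ⟩
  rw [mem_modes]
  constructor
  · intro h
    dsimp only at h
    split_ifs at h with h1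
    have := h1.choose_spec
    simp only [Option.some.injEq] at h
    rwa [h] at this
  · intro h
    have h1 : ∃ σ, (⟨x, σ⟩ : Mode b L) ∈ S := ⟨σ, h⟩
    dsimp only
    rw [dif_pos h1]
    have h2 := h1.choose_spec
    congr 1
    have := Finset.card_le_one.1 (hS x) ⟨x, σ⟩ (by simp [h]) ⟨x, h1.choose⟩ (by simp [h2])
    simp only [Mode.mk.injEq, true_and] at this
    exact this.symm

theorem erase_modes {c : Cfg b L} {x : Site b L} {σ : Spin} (h : c x = some σ) :
    (modes c).erase ⟨x, σ⟩ = modes (Function.update c x none) := by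
  ext ⟨y, τ⟩
  by_cases hy : y = x
  · subst hy
    simp [h, eq_comm]
  · simp [hy]

theorem insert_modes {c : Cfg b L} {x : Site b L} (σ : Spin) (h : c x = none) :
    insert ⟨x, σ⟩ (modes c) = modes (Function.update c x (some σ)) := by
  ext ⟨y, τ⟩
  by_cases hy : y = x
  · subst hy
    simp [h, eq_comm]
  · simp [hy]

/-! ### Jordan–Wigner signs -/

/-- The number of occupied orbitals before `x`. -/
def below (c : Cfg b L) (x : Site b L) : ℕ :=
  (Finset.univ.filter (fun y => (⟨y, .up⟩ : Mode b L) < ⟨x, .up⟩ ∧ c y ≠ none)).card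

theorem mode_lt_iff_key {a a' : Mode b L} : a < a' ↔ a.key < a'.key := Iff.rfl

/-- The order of the modes of different orbitals does not depend on the spins. -/
theorem mode_lt_iff {x y : Site b L} (h : x ≠ y) (σ τ : Spin) :
    (⟨x, σ⟩ : Mode b L) < ⟨y, τ⟩ ↔ (⟨x, .up⟩ : Mode b L) < ⟨y, .up⟩ := by
  rw [mode_lt_iff_key, mode_lt_iff_key]
  rcases x with ⟨δ, ℓ, k⟩ | ⟨i, j⟩ <;> rcases y with ⟨δ', ℓ', k'⟩ | ⟨i', j'⟩ <;>
    rcases σ <;> rcases τ <;> (try rcases δ) <;> (try rcases δ') <;>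
    simp_all [Mode.key, Prod.Lex.toLex_lt_toLex, Fin.ext_iff] <;> omega

/-- On configurations the sign of an operator depends on the occupied set only. -/
theorem jwSign_modes {c : Cfg b L} {x : Site b L} {σ : Spin} (h : c x = none ∨ c x = some σ) :
    jwSign ⟨x, σ⟩ (modes c) = (-1) ^ below c x := by
  unfold jwSign below
  congr 1
  refine Finset.card_bij (fun a _ => a.site) ?_ ?_ ?_
  · rintro ⟨y, τ⟩ hy
    simp only [Finset.mem_filter, mem_modes, Finset.mem_univ, true_and] at hy ⊢
    have hne : y ≠ x := by
      rintro rfl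
      rcases h with h | h
      · simp [h] at hy
      · rw [h] at hy
        simp only [Option.some.injEq] at hy
        rw [hy.1] at hy
        exact lt_irrefl _ hy.2
    exact ⟨(mode_lt_iff hne τ σ).1 hy.2, by simp [hy.1]⟩
  · rintro ⟨y, τ⟩ hy ⟨y', τ'⟩ hy' (rfl : y = y')
    simp only [Finset.mem_filter, mem_modes] at hy hy'
    have := hy.1.symm.trans hy'.1
    simp only [Option.some.injEq] at this
    rw [this]
  · intro y hy
    simp only [Finset.mem_filter, Finset.mem_univ, true_and] at hy
    obtain ⟨τ, hτ⟩ := Option.ne_none_iff_exists'.1 hy.2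
    have hne : y ≠ x := by
      rintro rfl
      exact lt_irrefl _ hy.1
    exact ⟨⟨y, τ⟩, by simp [hτ, (mode_lt_iff hne τ σ).2 hy.1], rfl⟩

theorem create_modes (c : Cfg b L) (x : Site b L) (σ : Spin) (f : Fock (Mode b L)) :
    create ⟨x, σ⟩ f (modes c) =
      if c x = some σ then (-1) ^ below c x * f (modes (Function.update c x none)) else 0 := by
  simp only [create, LinearMap.coe_mk, AddHom.coe_mk, mem_modes]
  split_ifs with h
  · rw [jwSign_modes (Or.inr h), erase_modes h]
  · rfl

theorem annihilate_modes_of_eq_none {c : Cfg b L} {x : Site b L} (h : c x = none) (σ : Spin)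
    (f : Fock (Mode b L)) :
    annihilate ⟨x, σ⟩ f (modes c) =
      (-1) ^ below c x * f (modes (Function.update c x (some σ))) := by
  simp only [annihilate, LinearMap.coe_mk, AddHom.coe_mk, mem_modes]
  rw [if_neg (by simp [h]), jwSign_modes (Or.inl h), insert_modes σ h]

/-- The states without doubly occupied orbitals. -/
def VanishesOnDouble (f : Fock (Mode b L)) : Prop := ∀ S, ¬ NoDoubleOccupancy S → f S = 0

theorem not_noDoubleOccupancy_insert {c : Cfg b L} {x : Site b L} {σ τ : Spin}
    (h : c x = some τ) (hne : τ ≠ σ) : ¬ NoDoubleOccupancy (insert ⟨x, σ⟩ (modes c)) := by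
  intro hS
  have := Finset.card_le_one.1 (hS x) ⟨x, σ⟩ (by simp) ⟨x, τ⟩ (by simp [h])
  simp only [Mode.mk.injEq, true_and] at this
  exact hne this.symm

theorem annihilate_modes {f : Fock (Mode b L)} (hf : VanishesOnDouble f) (c : Cfg b L)
    (x : Site b L) (σ : Spin) :
    annihilate ⟨x, σ⟩ f (modes c) =
      if c x = none then (-1) ^ below c x * f (modes (Function.update c x (some σ))) else 0 := by
  split_ifs with h
  · exact annihilate_modes_of_eq_none h σ f
  · obtain ⟨τ, hτ⟩ := Option.ne_none_iff_exists'.1 h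
    simp only [annihilate, LinearMap.coe_mk, AddHom.coe_mk, mem_modes, hτ, Option.some.injEq]
    split_ifs with h1
    · rfl
    · rw [hf _ (not_noDoubleOccupancy_insert hτ h1), mul_zero]

theorem fock_ext {f g : Fock (Mode b L)} (hf : VanishesOnDouble f) (hg : VanishesOnDouble g)
    (h : ∀ c, f (modes c) = g (modes c)) : f = g := by
  funext S
  by_cases hS : NoDoubleOccupancy S
  · obtain ⟨c, rfl⟩ := exists_modes_eq hS
    exact h c
  · rw [hf S hS, hg S hS]

/-! ### The Hamiltonian on configurations -/

/-- The permutation of orbitals by which the electron on `p` pushes the electron on `v` to `p'`: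
the configuration after the hop is `c ∘ hopPerm v p p'`. -/
def hopPerm (v p p' : Site b L) : Equiv.Perm (Site b L) := Equiv.swap v p' * Equiv.swap v p

theorem hopPerm_inv (v p p' : Site b L) : (hopPerm v p p')⁻¹ = hopPerm v p' p := by
  simp [hopPerm, mul_inv_rev]

section
variable {v p p' : Site b L}

theorem hopPerm_apply_v (hp : v ≠ p) (hpp : p ≠ p') : hopPerm v p p' v = p := by
  simp [hopPerm, Equiv.swap_apply_of_ne_of_ne hp.symm hpp]

theorem hopPerm_apply_src : hopPerm v p p' p = p' := by
  simp [hopPerm]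

theorem hopPerm_apply_dst (hp' : v ≠ p') (hpp : p ≠ p') : hopPerm v p p' p' = v := by
  simp [hopPerm, Equiv.swap_apply_of_ne_of_ne hp'.symm hpp.symm]

theorem hopPerm_apply_of_ne {x : Site b L} (h : x ≠ v) (h1 : x ≠ p) (h2 : x ≠ p') :
    hopPerm v p p' x = x := by
  simp [hopPerm, Equiv.swap_apply_of_ne_of_ne h h1, Equiv.swap_apply_of_ne_of_ne h h2]

end

/-- The sign from the operators on the two bonds in the hop of an electron from `p` to `p'`. -/
def hopSign (c : Cfg b L) (p p' : Site b L) : ℂ :=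
  (-1) ^ (below c p + below (Function.update c p none) p')

/-- The contribution of the hop from `p` over `v` to `p'`. -/
def hopTerm (f : Fock (Mode b L)) (c : Cfg b L) (v p p' : Site b L) : ℂ :=
  if c v ≠ none ∧ c p ≠ none ∧ c p' = none then
    hopSign c p p' * f (modes (c ∘ hopPerm v p p')) else 0

theorem below_congr {c c' : Cfg b L} {x : Site b L}
    (h : ∀ y, (⟨y, .up⟩ : Mode b L) < ⟨x, .up⟩ → (c y = none ↔ c' y = none)) :
    below c x = below c' x := by
  unfold below
  congr 1
  ext y
  simp only [Finset.mem_filter, Finset.mem_univ, true_and]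
  constructor
  · rintro ⟨h1, h2⟩
    exact ⟨h1, fun h3 => h2 ((h y h1).2 h3)⟩
  · rintro ⟨h1, h2⟩
    exact ⟨h1, fun h3 => h2 ((h y h1).1 h3)⟩

theorem below_update_none {c : Cfg b L} {x p : Site b L}
    (h : (⟨p, .up⟩ : Mode b L) < ⟨x, .up⟩) (hp : c p ≠ none) :
    below (Function.update c p none) x + 1 = below c x := by
  unfold below
  rw [← Finset.card_erase_add_one (s := Finset.univ.filter
    (fun y => (⟨y, .up⟩ : Mode b L) < ⟨x, .up⟩ ∧ c y ≠ none)) (a := p) (by simp [h, hp])]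
  congr 2
  ext y
  by_cases hy : y = p
  · subst hy
    simp
  · simp [hy]

theorem bond_lt_vertex (δ : Dir) (ℓ : Fin L) (k : Fin (b.bonds L)) (i j : Fin L) :
    (⟨.bond δ ℓ k, .up⟩ : Mode b L) < ⟨.vertex i j, .up⟩ := by
  rw [mode_lt_iff_key]
  rcases δ <;> simp [Mode.key, Prod.Lex.toLex_lt_toLex]

/-- The first term of the correlated hopping, evaluated on a configuration: the electrons come from `p'`
in the configuration considered, as an operator acts on amplitudes by its transpose. All bonds precede
the vertices in the order of the modes, so that the operators on `v` contribute the factor `-1`. -/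
theorem hop_forward_apply {f : Fock (Mode b L)} (hf : VanishesOnDouble f) (c : Cfg b L)
    {v p p' : Site b L} (hpp : p ≠ p') (hp : (⟨p, .up⟩ : Mode b L) < ⟨v, .up⟩)
    (hp' : (⟨p', .up⟩ : Mode b L) < ⟨v, .up⟩) :
    ∑ σ, ∑ σ', (create (Mode.mk v σ) * create (Mode.mk p' σ') * annihilate (Mode.mk v σ') *
        annihilate (Mode.mk p σ)) f (modes c)
      = - hopTerm f c v p' p := by
  have hvp : v ≠ p := fun h => by subst h; exact lt_irrefl _ hp
  have hvp' : v ≠ p' := fun h => by subst h; exact lt_irrefl _ hp'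
  have hone : ∀ σ σ', (create (Mode.mk v σ) * create (Mode.mk p' σ') * annihilate (Mode.mk v σ') *
        annihilate (Mode.mk p σ)) f
      (modes c) = if c v = some σ ∧ c p' = some σ' then - hopTerm f c v p' p else 0 := by
    intro σ σ'
    simp only [Module.End.mul_apply]
    rw [create_modes]
    by_cases h1 : c v = some σ
    swap
    · simp [h1]
    rw [if_pos h1, create_modes]
    by_cases h2 : c p' = some σ'
    swap
    · simp [h2, Function.update_of_ne hvp'.symm]
    rw [if_pos (by simp [h2, Function.update_of_ne hvp'.symm]),
      annihilate_modes_of_eq_none (by simp [Function.update_of_ne hvp']), annihilate_modes hf]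
    simp only [h1, h2, and_self, if_true, hopTerm]
    by_cases h3 : c p = none
    swap
    · simp [h3, Function.update_of_ne hvp.symm, Function.update_of_ne hpp]
    rw [if_pos (by simp [h3, Function.update_of_ne hvp.symm, Function.update_of_ne hpp]),
      if_pos (by simp [h3])]
    have e1 : below (Function.update c v none) p' = below c p' := below_congr fun y hy => by
      rw [Function.update_of_ne]
      rintro rfl
      exact lt_asymm hp' hy
    have e2 : below (Function.update (Function.update c v none) p' none) v + 1 = below c v := by
      rw [Function.update_comm hvp', ← below_update_none (c := c) hp' (by simp [h2])]
      congr 1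
      refine below_congr fun y hy => ?_
      rw [Function.update_of_ne]
      rintro rfl
      exact lt_irrefl _ hy
    have e3 : below (Function.update (Function.update (Function.update c v none) p' none) v (some σ')) p
        = below (Function.update c p' none) p := below_congr fun y hy => by
      have hyv : y ≠ v := by
        rintro rfl
        exact lt_asymm hp hy
      rw [Function.update_of_ne hyv, Function.update_comm hvp', Function.update_of_ne hyv]
    have e4 : Function.update (Function.update (Function.update (Function.update c v none) p' none) v
        (some σ')) p (some σ) = c ∘ hopPerm v p' p := by
      funext y
      by_cases hy1 : y = p
      · subst hy1
        rw [Function.update_self, Function.comp, hopPerm_apply_dst hvp hpp.symm, h1]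
      rw [Function.update_of_ne hy1]
      by_cases hy2 : y = v
      · subst hy2
        rw [Function.update_self, Function.comp, hopPerm_apply_v hvp' hpp.symm, h2]
      rw [Function.update_of_ne hy2]
      by_cases hy3 : y = p'
      · subst hy3
        rw [Function.update_self, Function.comp, hopPerm_apply_src, h3]
      rw [Function.update_of_ne hy3, Function.update_of_ne hy2, Function.comp,
        hopPerm_apply_of_ne hy2 hy3 hy1]
    rw [e1, e3, e4, ← e2, hopSign]
    ring_nf
    simp
  simp only [hone]
  by_cases h1 : c v = none
  · simp [h1, hopTerm]
  by_cases h2 : c p' = none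
  · simp [h2, hopTerm]
  obtain ⟨σ, hσ⟩ := Option.ne_none_iff_exists'.1 h1
  obtain ⟨σ', hσ'⟩ := Option.ne_none_iff_exists'.1 h2
  simp [hσ, hσ', ite_and, Finset.sum_ite_eq]

/-- The second term of the correlated hopping. -/
theorem hop_backward_apply {f : Fock (Mode b L)} (hf : VanishesOnDouble f) (c : Cfg b L)
    {v p p' : Site b L} (hpp : p ≠ p') (hp : (⟨p, .up⟩ : Mode b L) < ⟨v, .up⟩)
    (hp' : (⟨p', .up⟩ : Mode b L) < ⟨v, .up⟩) :
    ∑ σ, ∑ σ', (create (Mode.mk p σ) * create (Mode.mk v σ') * annihilate (Mode.mk p' σ') *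
        annihilate (Mode.mk v σ)) f (modes c)
      = - hopTerm f c v p p' := by
  have hvp : v ≠ p := fun h => by subst h; exact lt_irrefl _ hp
  have hvp' : v ≠ p' := fun h => by subst h; exact lt_irrefl _ hp'
  have hone : ∀ σ σ', (create (Mode.mk p σ) * create (Mode.mk v σ') * annihilate (Mode.mk p' σ') *
        annihilate (Mode.mk v σ)) f
      (modes c) = if c p = some σ ∧ c v = some σ' then - hopTerm f c v p p' else 0 := by
    intro σ σ'
    simp only [Module.End.mul_apply]
    rw [create_modes]
    by_cases h1 : c p = some σ
    swap
    · simp [h1]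
    rw [if_pos h1, create_modes]
    by_cases h2 : c v = some σ'
    swap
    · simp [h2, Function.update_of_ne hvp]
    rw [if_pos (by simp [h2, Function.update_of_ne hvp])]
    simp only [h1, h2, and_self, if_true, hopTerm]
    by_cases h3 : c p' = none
    swap
    · have h4 : Function.update (Function.update c p none) v none p' ≠ none := by
        simp [h3, Function.update_of_ne hvp'.symm, Function.update_of_ne hpp.symm]
      obtain ⟨τ, hτ⟩ := Option.ne_none_iff_exists'.1 h4
      simp only [annihilate, LinearMap.coe_mk, AddHom.coe_mk, mem_modes, hτ, Option.some.injEq]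
      by_cases h5 : τ = σ'
      · simp [h3, h5]
      rw [if_neg h5, if_neg, hf, mul_zero]
      · simp [h3]
      · intro hS
        have := Finset.card_le_one.1 (hS p') ⟨p', σ'⟩ (by simp) ⟨p', τ⟩ (by simp [hτ])
        simp only [Mode.mk.injEq, true_and] at this
        exact h5 this.symm
      · simp [hvp']
    rw [annihilate_modes_of_eq_none (by
      simp [h3, Function.update_of_ne hvp'.symm, Function.update_of_ne hpp.symm]),
      annihilate_modes hf, if_pos (by simp [Function.update_of_ne hvp']), if_pos (by simp [h3])]
    have e1 : below (Function.update c p none) v + 1 = below c v :=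
      below_update_none hp (by simp [h1])
    have e2 : below (Function.update (Function.update c p none) v none) p' =
        below (Function.update c p none) p' := below_congr fun y hy => by
      rw [Function.update_of_ne]
      rintro rfl
      exact lt_asymm hp' hy
    have e3 : below (Function.update (Function.update (Function.update c p none) v none) p' (some σ')) v
        = below (Function.update c p none) v + 1 := by
      rw [← below_update_none (c := Function.update (Function.update (Function.update c p none) v none)
        p' (some σ')) hp' (by simp)]
      congr 1
      refine below_congr fun y hy => ?_
      have hyv : y ≠ v := by
        rintro rfl
        exact lt_irrefl _ hy
      by_cases hyp : y = p'
      · subst hyp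
        simp [Function.update_of_ne hpp.symm, h3]
      · rw [Function.update_of_ne hyp, Function.update_of_ne hyp, Function.update_of_ne hyv]
    have e4 : Function.update (Function.update (Function.update (Function.update c p none) v none) p'
        (some σ')) v (some σ) = c ∘ hopPerm v p p' := by
      funext y
      by_cases hy2 : y = v
      · subst hy2
        rw [Function.update_self, Function.comp, hopPerm_apply_v hvp hpp, h1]
      rw [Function.update_of_ne hy2]
      by_cases hy1 : y = p'
      · subst hy1
        rw [Function.update_self, Function.comp, hopPerm_apply_dst hvp' hpp, h2]
      rw [Function.update_of_ne hy1, Function.update_of_ne hy2]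
      by_cases hy3 : y = p
      · subst hy3
        rw [Function.update_self, Function.comp, hopPerm_apply_src, h3]
      rw [Function.update_of_ne hy3, Function.comp, hopPerm_apply_of_ne hy2 hy3 hy1]
    rw [e2, e3, e4, hopSign]
    ring_nf
    simp
  simp only [hone]
  by_cases h1 : c p = none
  · simp [h1, hopTerm]
  by_cases h2 : c v = none
  · simp [h2, hopTerm]
  obtain ⟨σ, hσ⟩ := Option.ne_none_iff_exists'.1 h1
  obtain ⟨σ', hσ'⟩ := Option.ne_none_iff_exists'.1 h2
  simp [hσ, hσ', ite_and, Finset.sum_ite_eq]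

theorem before_val (k : Fin L) : (b.before k).val = k.val := by
  cases b <;> rfl

theorem after_val_of_lt {k : Fin L} (h : k.val + 1 < b.bonds L) : (b.after k).val = k.val + 1 := by
  cases b
  · rfl
  · obtain ⟨n, rfl⟩ : ∃ n, L = n + 1 := ⟨L - 1, by have := k.pos; omega⟩
    exact coe_finRotate_of_ne_last (by simp only [Boundary.bonds] at h; simp [Fin.ext_iff]; omega)

theorem after_val_of_eq {k : Fin L} (h : k.val + 1 = b.bonds L) : (b.after k).val = 0 := by
  cases b
  · simp only [Boundary.bonds] at h
    omega
  · obtain ⟨n, rfl⟩ : ∃ n, L = n + 1 := ⟨L - 1, by have := k.pos; omega⟩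
    have hk : k = Fin.last n := by
      simp only [Boundary.bonds] at h
      simp [Fin.ext_iff]
      omega
    subst hk
    simp [Boundary.after]

theorem le_bonds (b : Boundary) (L : ℕ) : L ≤ b.bonds L := by
  cases b <;> simp [Boundary.bonds]

theorem val_add_one_le_bonds (b : Boundary) (k : Fin L) : k.val + 1 ≤ b.bonds L :=
  le_trans k.isLt (le_bonds b L)

/-- For `L = 1` the periodic line has a single bond. -/
theorem before_ne_after (hL : 2 ≤ L) (k : Fin L) : b.before k ≠ b.after k := by
  intro h
  have h1 := congrArg Fin.val h
  rw [before_val] at h1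
  rcases (val_add_one_le_bonds b k).lt_or_eq with h2 | h2
  · rw [after_val_of_lt h2] at h1
    omega
  · rw [after_val_of_eq h2] at h1
    have := le_bonds b L
    omega

theorem vertexHop_apply (hL : 2 ≤ L) {f : Fock (Mode b L)} (hf : VanishesOnDouble f) (c : Cfg b L)
    (δ : Dir) (i j : Fin L) :
    vertexHop b δ i j f (modes c) =
      - (hopTerm f c (.vertex i j) (.bond δ (δ.line i j) (b.before (δ.coord i j)))
          (.bond δ (δ.line i j) (b.after (δ.coord i j)))
        + hopTerm f c (.vertex i j) (.bond δ (δ.line i j) (b.after (δ.coord i j)))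
          (.bond δ (δ.line i j) (b.before (δ.coord i j)))) := by
  have hne : (Site.bond δ (δ.line i j) (b.before (δ.coord i j)) : Site b L) ≠
      .bond δ (δ.line i j) (b.after (δ.coord i j)) := by
    simpa using before_ne_after hL _
  have h1 := hop_forward_apply hf c hne (bond_lt_vertex _ _ _ i j) (bond_lt_vertex _ _ _ i j)
  have h2 := hop_backward_apply hf c hne (bond_lt_vertex _ _ _ i j) (bond_lt_vertex _ _ _ i j)
  simp only [vertexHop, LinearMap.sum_apply, LinearMap.add_apply, Finset.sum_apply, Pi.add_apply,
    Finset.sum_add_distrib]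
  rw [h1, h2]
  ring

/-- Both hops over the `k`-th vertex of a line. -/
def vertTerm (f : Fock (Mode b L)) (c : Cfg b L) (δ : Dir) (ℓ k : Fin L) : ℂ :=
  hopTerm f c (vert δ ℓ k) (.bond δ ℓ (b.before k)) (.bond δ ℓ (b.after k))
    + hopTerm f c (vert δ ℓ k) (.bond δ ℓ (b.after k)) (.bond δ ℓ (b.before k))

theorem project_eq_self {f : Fock (Mode b L)} (hf : VanishesOnDouble f) :
    project NoDoubleOccupancy f = f := by
  funext S
  simp only [project, LinearMap.coe_mk, AddHom.coe_mk]
  split_ifs with h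
  · rfl
  · exact (hf S h).symm

theorem sum_dir {M : Type*} [AddCommMonoid M] (g : Dir → M) : ∑ δ, g δ = g .x + g .y := by
  rw [show (Finset.univ : Finset Dir) = {.x, .y} from rfl, Finset.sum_pair (by simp)]

theorem hamiltonian_apply_modes (hL : 2 ≤ L) (t : ℝ) {f : Fock (Mode b L)} (hf : VanishesOnDouble f)
    (c : Cfg b L) :
    hamiltonian b L t f (modes c) = t * ∑ δ, ∑ ℓ, ∑ k, vertTerm f c δ ℓ k := by
  simp only [hamiltonian, Module.End.mul_apply, project_eq_self hf, LinearMap.smul_apply,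
    LinearMap.sum_apply]
  simp only [project, LinearMap.coe_mk, AddHom.coe_mk, if_pos (noDoubleOccupancy_modes c),
    Pi.smul_apply, Finset.sum_apply, vertexHop_apply hL hf]
  simp only [sum_dir, Dir.line, Dir.coord, vertTerm, vert, Finset.sum_add_distrib, Finset.sum_neg_distrib, smul_eq_mul]
  rw [Finset.sum_comm (f := fun (i j : Fin L) => hopTerm f c (.vertex i j)
    (.bond .x j (b.before i)) (.bond .x j (b.after i))),
    Finset.sum_comm (f := fun (i j : Fin L) => hopTerm f c (.vertex i j)
    (.bond .x j (b.after i)) (.bond .x j (b.before i)))]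
  ring

theorem hamiltonian_vanishesOnDouble (t : ℝ) (f : Fock (Mode b L)) :
    VanishesOnDouble (hamiltonian b L t f) := by
  intro S hS
  simp [hamiltonian, project, hS]

/-! ### The sign gauge -/

/-- The occupied bonds of a line. -/
def wirePat (c : Cfg b L) (δ : Dir) (ℓ : Fin L) : Finset (Fin (b.bonds L)) :=
  Finset.univ.filter (fun k => c (.bond δ ℓ k) ≠ none)

theorem lineCharges_modes (c : Cfg b L) (δ : Dir) (ℓ : Fin L) :
    lineCharges (modes c) δ ℓ = (wirePat c δ ℓ).card := by
  simp only [lineCharges, occupation_modes, wirePat, Finset.card_filter]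
  refine Finset.sum_congr rfl fun k _ => ?_
  by_cases h : c (.bond δ ℓ k) = none <;> simp [h]

/-- The parity of the position of a bond along its line. -/
def siteSign : Site b L → ℂ
  | .bond _ _ k => (-1) ^ k.val
  | .vertex _ _ => 1

theorem neg_one_pow_sq (n : ℕ) : ((-1 : ℂ) ^ n) ^ 2 = 1 := by
  rw [← pow_mul, mul_comm, pow_mul]
  simp

theorem siteSign_mul_self (x : Site b L) : siteSign x * siteSign x = 1 := by
  rcases x with ⟨δ, ℓ, k⟩ | ⟨i, j⟩
  · rw [← sq]
    exact neg_one_pow_sq _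
  · simp [siteSign]

/-- The gauge sign of a configuration. -/
def gauge (c : Cfg b L) : ℂ := ∏ x, if c x = none then 1 else siteSign x

theorem gauge_mul_self (c : Cfg b L) : gauge c * gauge c = 1 := by
  unfold gauge
  rw [← Finset.prod_mul_distrib]
  refine Finset.prod_eq_one fun x _ => ?_
  split_ifs
  · simp
  · exact siteSign_mul_self x

theorem gauge_ne_zero (c : Cfg b L) : gauge c ≠ 0 := fun h => by
  simpa [h] using gauge_mul_self c

/-- A hop changes the gauge sign by the signs of the two bonds. -/
theorem gauge_mul_gauge_hop {c : Cfg b L} {v p p' : Site b L} (hvp : v ≠ p) (hvp' : v ≠ p')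
    (hpp : p ≠ p') (hv : c v ≠ none) (hp : c p ≠ none) (hp' : c p' = none) :
    gauge c * gauge (c ∘ hopPerm v p p') = siteSign v * siteSign p * siteSign p' * siteSign v := by
  have h1 : gauge (c ∘ hopPerm v p p') =
      ∏ x, if c x = none then 1 else siteSign ((hopPerm v p p')⁻¹ x) := by
    unfold gauge
    rw [← Equiv.prod_comp (hopPerm v p p')
      (fun x => if c x = none then 1 else siteSign ((hopPerm v p p')⁻¹ x))]
    simp
  rw [h1, gauge, ← Finset.prod_mul_distrib, hopPerm_inv]
  rw [Finset.prod_eq_mul p v hvp.symm]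
  · simp only [hp, hv, if_false]
    rw [hopPerm_apply_v hvp' hpp.symm, hopPerm_apply_dst hvp hpp.symm]
    ring
  · rintro x - ⟨hx, hx'⟩
    by_cases h : x = p'
    · subst h
      simp [hp']
    · rw [hopPerm_apply_of_ne hx' h hx]
      split_ifs
      · simp
      · exact siteSign_mul_self x
  · simp
  · simp

/-! ### The sign of a hop -/

theorem bond_lt_bond (δ : Dir) (ℓ : Fin L) (k k' : Fin (b.bonds L)) :
    (⟨.bond δ ℓ k, .up⟩ : Mode b L) < ⟨.bond δ ℓ k', .up⟩ ↔ k < k' := by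
  rw [mode_lt_iff_key]
  rcases δ <;> simp [Mode.key, Prod.Lex.toLex_lt_toLex]

/-- All bonds of a line are on the same side of an orbital outside the bonds of that line. -/
theorem lt_bond_iff {x : Site b L} {δ : Dir} {ℓ : Fin L} (hx : ∀ k, x ≠ .bond δ ℓ k)
    (k k' : Fin (b.bonds L)) :
    (⟨x, .up⟩ : Mode b L) < ⟨.bond δ ℓ k, .up⟩ ↔ (⟨x, .up⟩ : Mode b L) < ⟨.bond δ ℓ k', .up⟩ := by
  rw [mode_lt_iff_key, mode_lt_iff_key]
  rcases x with ⟨δ', ℓ', k''⟩ | ⟨i, j⟩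
  · have hne : ¬ (δ' = δ ∧ ℓ' = ℓ) := by
      rintro ⟨rfl, rfl⟩
      exact hx k'' rfl
    rcases δ <;> rcases δ' <;>
      simp_all [Mode.key, Prod.Lex.toLex_lt_toLex, Fin.ext_iff]
  · rcases δ <;> simp [Mode.key, Prod.Lex.toLex_lt_toLex]

/-- A hop has a positive sign if no orbital lies between its two bonds. -/
theorem hopSign_of_not_between {c : Cfg b L} {p p' : Site b L} (hpp : p ≠ p')
    (hp' : c p' = none)
    (h : ∀ y, y ≠ p → y ≠ p' → ((⟨y, .up⟩ : Mode b L) < ⟨p, .up⟩ ↔ (⟨y, .up⟩ : Mode b L) < ⟨p', .up⟩)) :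
    hopSign c p p' = 1 := by
  have : below c p = below (Function.update c p none) p' := by
    unfold below
    congr 1
    ext y
    simp only [Finset.mem_filter, Finset.mem_univ, true_and]
    by_cases hy : y = p
    · subst hy
      simp
    by_cases hy' : y = p'
    · subst hy'
      simp [hp', Function.update_of_ne hpp.symm]
    rw [Function.update_of_ne hy, h y hy hy']
  rw [hopSign, this, ← two_mul, pow_mul]
  simp

/-- In general the sign counts the electrons between the two bonds. -/
theorem hopSign_eq_neg_one_pow {c : Cfg b L} {p p' : Site b L} (hpp : p ≠ p') (hp : c p ≠ none) (n : ℕ)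
    (h : (Finset.univ.filter (fun y => ((⟨y, .up⟩ : Mode b L) < ⟨p, .up⟩ ↔
      ¬ (⟨y, .up⟩ : Mode b L) < ⟨p', .up⟩) ∧ c y ≠ none ∧ y ≠ p)).card = n) :
    hopSign c p p' = (-1) ^ n := by
  subst h
  have h1 : below c p = ∑ y, if (⟨y, .up⟩ : Mode b L) < ⟨p, .up⟩ ∧ c y ≠ none then 1 else 0 := by
    rw [below, Finset.card_filter]
  have h2 : below (Function.update c p none) p' =
      ∑ y, if (⟨y, .up⟩ : Mode b L) < ⟨p', .up⟩ ∧ Function.update c p none y ≠ none then 1 else 0 := by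
    rw [below, Finset.card_filter]
  rw [hopSign, h1, h2, Finset.card_filter, ← Finset.sum_add_distrib, ← Finset.prod_pow_eq_pow_sum,
    ← Finset.prod_pow_eq_pow_sum]
  refine Finset.prod_congr rfl fun y _ => ?_
  by_cases hy : y = p
  · subst hy
    simp
  · by_cases h3 : (⟨y, .up⟩ : Mode b L) < ⟨p, .up⟩ <;>
    by_cases h4 : (⟨y, .up⟩ : Mode b L) < ⟨p', .up⟩ <;>
    by_cases h5 : c y = none <;> simp [h3, h4, h5, hy]

/-- With the gauge signs included, every hop has the sign `-1`. For a hop between the ends of a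
periodic line this uses the parity condition. -/
theorem hopSign_mul_gauge {c : Cfg b L} (hc : b.ParityOK (lineCharges (modes c)))
    {δ : Dir} {ℓ k : Fin L} {p p' : Site b L}
    (hpp : (p = .bond δ ℓ (b.before k) ∧ p' = .bond δ ℓ (b.after k)) ∨
      (p = .bond δ ℓ (b.after k) ∧ p' = .bond δ ℓ (b.before k)))
    (hv : c (vert δ ℓ k) ≠ none) (hp : c p ≠ none) (hp' : c p' = none) :
    gauge c * gauge (c ∘ hopPerm (vert δ ℓ k) p p') * hopSign c p p' = -1 := by
  have hne : p ≠ p' := fun h => by rw [h] at hp; exact hp hp'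
  have hvb : ∀ m, (vert δ ℓ k : Site b L) ≠ .bond δ ℓ m := by
    intro m
    cases δ <;> simp [vert]
  have hvp : vert δ ℓ k ≠ p := by rcases hpp with h | h <;> rw [h.1] <;> exact hvb _
  have hvp' : vert δ ℓ k ≠ p' := by rcases hpp with h | h <;> rw [h.2] <;> exact hvb _
  rw [gauge_mul_gauge_hop hvp hvp' hne hv hp hp']
  have hsv : siteSign (vert δ ℓ k : Site b L) = 1 := by cases δ <;> rfl
  have hss : siteSign p * siteSign p' = (-1) ^ (k.val + (b.after k).val) := by
    rcases hpp with h | h <;> rw [h.1, h.2] <;> simp only [siteSign, before_val] <;> ring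
  rw [hsv, one_mul, mul_one, hss]
  rcases (val_add_one_le_bonds b k).lt_or_eq with h2 | h2
  · rw [hopSign_of_not_between hne hp', after_val_of_lt h2]
    · rw [show k.val + (k.val + 1) = 2 * k.val + 1 by ring, pow_succ, pow_mul]
      simp
    · intro y hy hy'
      have h3 : y ≠ .bond δ ℓ (b.before k) ∧ y ≠ .bond δ ℓ (b.after k) := by
        rcases hpp with h | h
        · exact ⟨h.1 ▸ hy, h.2 ▸ hy'⟩
        · exact ⟨h.2 ▸ hy', h.1 ▸ hy⟩
      have h4 : (⟨y, .up⟩ : Mode b L) < ⟨.bond δ ℓ (b.before k), .up⟩ ↔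
          (⟨y, .up⟩ : Mode b L) < ⟨.bond δ ℓ (b.after k), .up⟩ := by
        by_cases hx : ∀ m, y ≠ .bond δ ℓ m
        · exact lt_bond_iff hx _ _
        · push Not at hx
          obtain ⟨m, rfl⟩ := hx
          rw [bond_lt_bond, bond_lt_bond, Fin.lt_def, Fin.lt_def, before_val, after_val_of_lt h2]
          simp only [ne_eq, Site.bond.injEq, true_and, Fin.ext_iff, before_val,
            after_val_of_lt h2] at h3
          omega
      rcases hpp with h | h <;> rw [h.1, h.2]
      · exact h4
      · exact h4.symm
  · cases b with
    | obc =>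
      simp only [Boundary.bonds] at h2
      omega
    | pbc =>
    have hpar : Odd (L + (wirePat c δ ℓ).card) := by
      rw [← lineCharges_modes]
      exact hc δ ℓ
    have h0 := after_val_of_eq h2
    obtain ⟨m0, hm0⟩ : ∃ m0, p = .bond δ ℓ m0 := by rcases hpp with h | h <;> exact ⟨_, h.1⟩
    have hmem : m0 ∈ wirePat c δ ℓ := by
      rw [hm0] at hp
      simpa [wirePat] using hp
    -- the hop passes all other electrons of the periodic line
    rw [hopSign_eq_neg_one_pow hne hp ((wirePat c δ ℓ).card - 1), h0, add_zero, ← pow_add]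
    · apply Odd.neg_one_pow
      have hpos := Finset.card_pos.2 ⟨m0, hmem⟩
      simp only [Boundary.bonds] at h2
      rw [Nat.odd_iff] at hpar ⊢
      omega
    · rw [← Finset.card_erase_of_mem hmem]
      symm
      refine Finset.card_bij (fun m _ => .bond δ ℓ m) ?_ ?_ ?_
      · intro m hm
        simp only [Finset.mem_erase, wirePat, Finset.mem_filter, Finset.mem_univ, true_and] at hm ⊢
        refine ⟨?_, hm.2, by rw [hm0]; simpa using hm.1⟩
        have hm' : (.bond δ ℓ m : Site .pbc L) ≠ p' := by
          intro h
          rw [h] at hm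
          exact hm.2 hp'
        have hm'' : (.bond δ ℓ m : Site .pbc L) ≠ p := by
          rw [hm0]
          simpa using hm.1
        have h3 := m.isLt
        rcases hpp with h | h <;> rw [h.1, h.2, bond_lt_bond, bond_lt_bond] <;>
          rw [h.1] at hm'' <;> rw [h.2] at hm' <;>
          simp only [ne_eq, Site.bond.injEq, true_and, Fin.ext_iff, before_val, h0, Fin.lt_def] at *
          <;> omega
      · intro m _ m' _ h
        simpa using h
      · intro y hy
        simp only [Finset.mem_filter, Finset.mem_univ, true_and] at hy
        have hx : ∃ m, y = .bond δ ℓ m := by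
          by_contra hx
          push Not at hx
          have h5 := lt_bond_iff hx (Boundary.pbc.before k) (Boundary.pbc.after k)
          rcases hpp with h | h <;> rw [h.1, h.2] at hy <;> have := hy.1 <;> tauto
        obtain ⟨m, rfl⟩ := hx
        refine ⟨m, ?_, rfl⟩
        simp only [Finset.mem_erase, wirePat, Finset.mem_filter, Finset.mem_univ, true_and]
        refine ⟨fun h => hy.2.2 (by rw [hm0, h]), hy.2.1⟩

/-! ### Ground states of hopping operators with a positive eigenfunction -/

section PerronFrobenius

variable {ι C : Type*} [Fintype ι] [Finite C] {act : ι → C → Prop} [∀ i c, Decidable (act i c)]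
  {nxt : ι → C → C} {Ω : Set C} {a₀ : C → ℝ} {lam : ℝ}

/-- No eigenvalue of a hopping operator exceeds that of a positive eigenfunction: compare the two
sides of the eigenvalue equation at a point where `‖a‖ / a₀` is maximal. -/
theorem le_of_pos_eigenfunction (hpos : ∀ c ∈ Ω, 0 < a₀ c)
    (hcl : ∀ c ∈ Ω, ∀ i, act i c → nxt i c ∈ Ω)
    (h0 : ∀ c ∈ Ω, (∑ i, if act i c then a₀ (nxt i c) else 0) = lam * a₀ c)
    {a : C → ℂ} {μ : ℝ} (h : ∀ c ∈ Ω, (∑ i, if act i c then a (nxt i c) else 0) = μ * a c)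
    (hne : ∃ c ∈ Ω, a c ≠ 0) : μ ≤ lam := by
  obtain ⟨c1, hc1, hac1⟩ := hne
  obtain ⟨c, hc, hmax⟩ := Set.exists_max_image Ω (fun c => ‖a c‖ / a₀ c) (Set.toFinite Ω) ⟨c1, hc1⟩
  have hM : 0 < ‖a c‖ / a₀ c :=
    lt_of_lt_of_le (div_pos (norm_pos_iff.2 hac1) (hpos c1 hc1)) (hmax c1 hc1)
  set M := ‖a c‖ / a₀ c with hMdef
  have hac : ‖a c‖ = M * a₀ c := by
    rw [hMdef, div_mul_cancel₀ _ (hpos c hc).ne']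
  have h1 : |μ| * ‖a c‖ ≤ M * (lam * a₀ c) := by
    calc |μ| * ‖a c‖ = ‖(μ : ℂ) * a c‖ := by rw [norm_mul, Complex.norm_real, Real.norm_eq_abs]
      _ = ‖∑ i, if act i c then a (nxt i c) else 0‖ := by rw [h c hc]
      _ ≤ ∑ i, ‖if act i c then a (nxt i c) else 0‖ := norm_sum_le _ _
      _ ≤ ∑ i, M * (if act i c then a₀ (nxt i c) else 0) := by
          refine Finset.sum_le_sum fun i _ => ?_
          split_ifs with hi
          · have hn := hcl c hc i hi
            have := hmax _ hn
            rwa [div_le_iff₀ (hpos _ hn)] at this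
          · simp
      _ = M * (lam * a₀ c) := by rw [← Finset.mul_sum, h0 c hc]
  rw [hac] at h1
  have h2 : |μ| * (M * a₀ c) ≤ lam * (M * a₀ c) := by linarith
  exact le_trans (le_abs_self μ) (le_of_mul_le_mul_right h2 (mul_pos hM (hpos c hc)))

/-- A real eigenfunction for the eigenvalue of a positive one is a multiple of it if hopping connects all
configurations: the set where `a / a₀` is maximal is closed under hopping. -/
theorem eq_const_mul_of_real_eigenfunction (hpos : ∀ c ∈ Ω, 0 < a₀ c)
    (hcl : ∀ c ∈ Ω, ∀ i, act i c → nxt i c ∈ Ω)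
    (h0 : ∀ c ∈ Ω, (∑ i, if act i c then a₀ (nxt i c) else 0) = lam * a₀ c)
    (hconn : ∀ c ∈ Ω, ∀ c' ∈ Ω, Relation.ReflTransGen (fun c c' => ∃ i, act i c ∧ c' = nxt i c) c c')
    {a : C → ℝ} (h : ∀ c ∈ Ω, (∑ i, if act i c then a (nxt i c) else 0) = lam * a c) :
    ∃ r : ℝ, ∀ c ∈ Ω, a c = r * a₀ c := by
  rcases Ω.eq_empty_or_nonempty with rfl | hΩ
  · exact ⟨0, by simp⟩
  obtain ⟨c, hc, hmax⟩ := Set.exists_max_image Ω (fun c => a c / a₀ c) (Set.toFinite Ω) hΩ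
  set M := a c / a₀ c with hM
  refine ⟨M, fun c' hc' => ?_⟩
  have hle : ∀ d ∈ Ω, a d ≤ M * a₀ d := fun d hd => by
    have := hmax d hd
    rwa [div_le_iff₀ (hpos d hd)] at this
  have key : ∀ e, Relation.ReflTransGen (fun c c' => ∃ i, act i c ∧ c' = nxt i c) c e →
      e ∈ Ω ∧ a e = M * a₀ e := by
    intro e he
    induction he with
    | refl => exact ⟨hc, by rw [hM, div_mul_cancel₀ _ (hpos c hc).ne']⟩
    | @tail d e _ hstep ih =>
      obtain ⟨i, hi, rfl⟩ := hstep
      obtain ⟨hd, hda⟩ := ih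
      have hsum : ∑ i, (if act i d then M * a₀ (nxt i d) - a (nxt i d) else 0) = 0 := by
        have e1 : ∀ i, (if act i d then M * a₀ (nxt i d) - a (nxt i d) else 0) =
            M * (if act i d then a₀ (nxt i d) else 0) - (if act i d then a (nxt i d) else 0) := by
          intro i
          split_ifs <;> simp
        simp only [e1]
        rw [Finset.sum_sub_distrib, ← Finset.mul_sum, h0 d hd, h d hd, hda]
        ring
      have h2 := (Finset.sum_eq_zero_iff_of_nonneg (fun i _ => by
        split_ifs with hi
        · exact sub_nonneg.2 (hle _ (hcl d hd i hi))
        · exact le_rfl)).1 hsum i (Finset.mem_univ i)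
      rw [if_pos hi] at h2
      exact ⟨hcl d hd i hi, by linarith⟩
  exact (key c' (hconn c hc c' hc')).2

/-- The same for complex eigenfunctions, by taking real and imaginary parts. -/
theorem eq_const_mul_of_eigenfunction (hpos : ∀ c ∈ Ω, 0 < a₀ c)
    (hcl : ∀ c ∈ Ω, ∀ i, act i c → nxt i c ∈ Ω)
    (h0 : ∀ c ∈ Ω, (∑ i, if act i c then a₀ (nxt i c) else 0) = lam * a₀ c)
    (hconn : ∀ c ∈ Ω, ∀ c' ∈ Ω, Relation.ReflTransGen (fun c c' => ∃ i, act i c ∧ c' = nxt i c) c c')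
    {a : C → ℂ} (h : ∀ c ∈ Ω, (∑ i, if act i c then a (nxt i c) else 0) = lam * a c) :
    ∃ z : ℂ, ∀ c ∈ Ω, a c = z * a₀ c := by
  obtain ⟨r, hr⟩ := eq_const_mul_of_real_eigenfunction hpos hcl h0 hconn (a := fun c => (a c).re)
    (fun c hc => by
      have := congrArg Complex.re (h c hc)
      simpa [Complex.re_sum, apply_ite Complex.re] using this)
  obtain ⟨s, hs⟩ := eq_const_mul_of_real_eigenfunction hpos hcl h0 hconn (a := fun c => (a c).im)
    (fun c hc => by
      have := congrArg Complex.im (h c hc)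
      simpa [Complex.im_sum, apply_ite Complex.im] using this)
  refine ⟨⟨r, s⟩, fun c hc => ?_⟩
  apply Complex.ext
  · simpa using hr c hc
  · simpa using hs c hc

end PerronFrobenius

/-! ### The gauged hopping operator -/

/-- The hops: direction, line, position of the vertex on the line, and sense (`true` for a hop from the
bond before the vertex to the bond after it). -/
abbrev Hop (L : ℕ) : Type := Dir × Fin L × Fin L × Bool

/-- The vertex over which the electrons hop. -/
def Hop.over (h : Hop L) : Site b L := vert h.1 h.2.1 h.2.2.1

/-- The bond from which an electron hops. -/
def Hop.src (h : Hop L) : Site b L :=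
  .bond h.1 h.2.1 (if h.2.2.2 then b.before h.2.2.1 else b.after h.2.2.1)

/-- The bond to which an electron hops. -/
def Hop.dst (h : Hop L) : Site b L :=
  .bond h.1 h.2.1 (if h.2.2.2 then b.after h.2.2.1 else b.before h.2.2.1)

/-- The permutation of orbitals effected by a hop. -/
def Hop.perm (h : Hop L) : Equiv.Perm (Site b L) := hopPerm h.over h.src h.dst

/-- The hop is possible. -/
def Allowed (h : Hop L) (c : Cfg b L) : Prop :=
  c h.over ≠ none ∧ c h.src ≠ none ∧ c h.dst = none

instance (h : Hop L) (c : Cfg b L) : Decidable (Allowed h c) := by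
  unfold Allowed
  infer_instance

theorem vert_ne_bond (δ δ' : Dir) (ℓ ℓ' k : Fin L) (m : Fin (b.bonds L)) :
    (vert δ ℓ k : Site b L) ≠ .bond δ' ℓ' m := by
  cases δ <;> simp [vert]

theorem Hop.over_ne_src (h : Hop L) : (h.over : Site b L) ≠ h.src := vert_ne_bond _ _ _ _ _ _

theorem Hop.over_ne_dst (h : Hop L) : (h.over : Site b L) ≠ h.dst := vert_ne_bond _ _ _ _ _ _

theorem Allowed.src_ne_dst {h : Hop L} {c : Cfg b L} (hc : Allowed h c) :
    (h.src : Site b L) ≠ h.dst := fun e => hc.2.1 (e ▸ hc.2.2)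

/-- On states whose charges satisfy the parity condition, the Hamiltonian is, up to the gauge signs,
`-t` times the sum over all possible hops. -/
theorem gauge_mul_hamiltonian (hL : 2 ≤ L) (t : ℝ) {f : Fock (Mode b L)} (hf : VanishesOnDouble f)
    {c : Cfg b L} (hc : b.ParityOK (lineCharges (modes c))) :
    gauge c * hamiltonian b L t f (modes c) =
      -t * ∑ h : Hop L, if Allowed h c then
        gauge (c ∘ h.perm) * f (modes (c ∘ h.perm)) else 0 := by
  rw [hamiltonian_apply_modes hL t hf, mul_left_comm, neg_mul, ← mul_neg]
  congr 1
  rw [← Finset.sum_neg_distrib]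
  simp only [Fintype.sum_prod_type, Finset.mul_sum, Fintype.sum_bool]
  refine Finset.sum_congr rfl fun δ _ => ?_
  refine Finset.sum_congr rfl fun ℓ _ => ?_
  refine Finset.sum_congr rfl fun k _ => ?_
  rw [vertTerm, mul_add]
  have key : ∀ p p' : Site b L, ((p = .bond δ ℓ (b.before k) ∧ p' = .bond δ ℓ (b.after k)) ∨
      (p = .bond δ ℓ (b.after k) ∧ p' = .bond δ ℓ (b.before k))) →
      gauge c * hopTerm f c (vert δ ℓ k) p p' =
      - if c (vert δ ℓ k) ≠ none ∧ c p ≠ none ∧ c p' = none then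
        gauge (c ∘ hopPerm (vert δ ℓ k) p p') * f (modes (c ∘ hopPerm (vert δ ℓ k) p p')) else 0 := by
    intro p p' hpp
    unfold hopTerm
    split_ifs with h
    · have h1 := hopSign_mul_gauge hc hpp h.1 h.2.1 h.2.2
      have h2 : gauge c * hopSign c p p' = - gauge (c ∘ hopPerm (vert δ ℓ k) p p') := by
        have h3 := gauge_mul_self (c ∘ hopPerm (vert δ ℓ k) p p')
        linear_combination gauge (c ∘ hopPerm (vert δ ℓ k) p p') * h1 - gauge c * hopSign c p p' * h3
      rw [← mul_assoc, h2]
      ring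
    · simp
  rw [key _ _ (Or.inl ⟨rfl, rfl⟩), key _ _ (Or.inr ⟨rfl, rfl⟩)]
  simp [Allowed, Hop.over, Hop.src, Hop.dst, Hop.perm]

/-- One configuration arises from another by a hop. -/
def Step (c c' : Cfg b L) : Prop := ∃ h : Hop L, Allowed h c ∧ c' = c ∘ h.perm

/-! ### Permutations of orbitals realized by hops -/

/-- The occupied orbitals of a configuration. -/
def pat (c : Cfg b L) : Site b L → Bool := fun x => (c x).isSome

theorem pat_comp (c : Cfg b L) (π : Equiv.Perm (Site b L)) : pat (c ∘ π) = pat c ∘ π := rfl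

theorem pat_eq_true {c : Cfg b L} {x : Site b L} : pat c x = true ↔ c x ≠ none := by
  simp [pat, Option.isSome_iff_ne_none]

theorem pat_eq_false {c : Cfg b L} {x : Site b L} : pat c x = false ↔ c x = none := by
  simp [pat]

/-- The configuration `c'` can be reached from `c` by hops. -/
abbrev Reach (c c' : Cfg b L) : Prop := Relation.ReflTransGen Step c c'

/-- The reversed hop. -/
def Hop.reverse (h : Hop L) : Hop L := (h.1, h.2.1, h.2.2.1, !h.2.2.2)

theorem Hop.over_reverse (h : Hop L) : (h.reverse.over : Site b L) = h.over := rfl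

theorem Hop.src_reverse (h : Hop L) : (h.reverse.src : Site b L) = h.dst := by
  rcases h with ⟨δ, ℓ, k, _ | _⟩ <;> rfl

theorem Hop.dst_reverse (h : Hop L) : (h.reverse.dst : Site b L) = h.src := by
  rcases h with ⟨δ, ℓ, k, _ | _⟩ <;> rfl

theorem Hop.perm_reverse (h : Hop L) : (h.reverse.perm : Equiv.Perm (Site b L)) = h.perm⁻¹ := by
  rw [Hop.perm, Hop.perm, hopPerm_inv, Hop.over_reverse, Hop.src_reverse, Hop.dst_reverse]

theorem Step.symm {c c' : Cfg b L} (h : Step c c') : Step c' c := by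
  obtain ⟨h, hc, rfl⟩ := h
  refine ⟨h.reverse, ⟨?_, ?_, ?_⟩, ?_⟩
  · rw [Hop.over_reverse, Function.comp, Hop.perm, hopPerm_apply_v h.over_ne_src hc.src_ne_dst]
    exact hc.2.1
  · rw [Hop.src_reverse, Function.comp, Hop.perm, hopPerm_apply_dst h.over_ne_dst hc.src_ne_dst]
    exact hc.1
  · rw [Hop.dst_reverse, Function.comp, Hop.perm, hopPerm_apply_src]
    exact hc.2.2
  · rw [Hop.perm_reverse]
    funext x
    simp

theorem Reach.symm {c c' : Cfg b L} (h : Reach c c') : Reach c' c :=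
  haveI : Std.Symm (Step : Cfg b L → Cfg b L → Prop) := ⟨fun _ _ h => h.symm⟩
  Relation.ReflTransGen.stdSymm.symm _ _ h

/-- From every configuration with occupied set `o`, hops lead to the one permuted by `π`. -/
def Carries (o : Site b L → Bool) (π : Equiv.Perm (Site b L)) : Prop :=
  ∀ c : Cfg b L, pat c = o → Reach c (c ∘ π)

theorem Carries.one (o : Site b L → Bool) : Carries o 1 := fun _ _ => Relation.ReflTransGen.refl

theorem Carries.mul {o : Site b L → Bool} {π π' : Equiv.Perm (Site b L)} (h : Carries o π)
    (h' : Carries (o ∘ π) π') : Carries o (π * π') := by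
  intro c hc
  exact (h c hc).trans (h' (c ∘ π) (by rw [pat_comp, hc]))

theorem Carries.inv {o : Site b L → Bool} {π : Equiv.Perm (Site b L)} (h : Carries o π) :
    Carries (o ∘ π) π⁻¹ := by
  intro c hc
  have h1 := h (c ∘ ⇑π⁻¹) (by rw [pat_comp, hc]; funext x; simp)
  have h2 : (c ∘ ⇑π⁻¹) ∘ ⇑π = c := by funext x; simp
  rw [h2] at h1
  exact h1.symm

theorem carries_hop {o : Site b L → Bool} (h : Hop L) (hv : o h.over = true) (hp : o h.src = true)
    (hp' : o h.dst = false) : Carries o h.perm := by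
  rintro c rfl
  exact Relation.ReflTransGen.single ⟨h, ⟨pat_eq_true.1 hv, pat_eq_true.1 hp, pat_eq_false.1 hp'⟩, rfl⟩

/-- Exchanging the spins of the occupied orbitals `x` and `y` can be achieved by hops. -/
def Linked (o : Site b L → Bool) (x y : Site b L) : Prop :=
  o x = true ∧ o y = true ∧ Carries o (Equiv.swap x y)

theorem comp_swap_eq {o : Site b L → Bool} {x y : Site b L} (h : o x = o y) :
    o ∘ Equiv.swap x y = o := by
  funext z
  simp only [Function.comp, Equiv.swap_apply_def]
  split_ifs with h1 h2
  · rw [h1, h]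
  · rw [h2, h]
  · rfl

theorem Linked.refl {o : Site b L → Bool} {x : Site b L} (h : o x = true) : Linked o x x :=
  ⟨h, h, by rw [Equiv.swap_self]; exact Carries.one o⟩

theorem Linked.symm {o : Site b L → Bool} {x y : Site b L} (h : Linked o x y) : Linked o y x :=
  ⟨h.2.1, h.1, by rw [Equiv.swap_comm]; exact h.2.2⟩

theorem Linked.trans {o : Site b L → Bool} {x y z : Site b L} (h : Linked o x y)
    (h' : Linked o y z) : Linked o x z := by
  by_cases hxy : x = y
  · rwa [hxy]
  by_cases hyz : y = z
  · rwa [← hyz]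
  by_cases hxz : x = z
  · rw [← hxz]
    exact Linked.refl h.1
  refine ⟨h.1, h'.2.1, ?_⟩
  have e1 := comp_swap_eq (h.1.trans h.2.1.symm)
  have e2 := comp_swap_eq (h'.1.trans h'.2.1.symm)
  have key : Equiv.swap x z = Equiv.swap x y * Equiv.swap y z * Equiv.swap x y := by
    have h1 := Equiv.swap_apply_apply (Equiv.swap x y) y z
    rwa [Equiv.swap_apply_right, Equiv.swap_apply_of_ne_of_ne (Ne.symm hxz) (Ne.symm hyz),
      Equiv.swap_inv] at h1
  rw [key, mul_assoc]
  refine h.2.2.mul ?_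
  rw [e1]
  refine h'.2.2.mul ?_
  rw [e2]
  exact h.2.2

/-- Links are carried along by a rearrangement of the occupied set. -/
theorem Linked.transport {o : Site b L → Bool} {π : Equiv.Perm (Site b L)} (h : Carries o π)
    {x y : Site b L} (hl : Linked (o ∘ π) x y) : Linked o (π x) (π y) := by
  refine ⟨hl.1, hl.2.1, ?_⟩
  rw [Equiv.swap_apply_apply, mul_assoc]
  refine h.mul (hl.2.2.mul ?_)
  rw [comp_swap_eq (hl.1.trans hl.2.1.symm)]
  exact h.inv

/-! ### The exchange at a crossing of two wires -/

theorem Spin.eq_or_eq_of_ne {a a' : Spin} (h : a ≠ a') (s : Spin) : s = a ∨ s = a' := by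
  cases a <;> cases a' <;> cases s <;> simp_all

/-- If both wires through `v` can hop over `v`, the group commutator of the two hops permutes `v`
and the two occupied bonds `x`, `y` cyclically. Up to the spins, which take two values only, this
realizes the exchange of `v` and `x`. -/
theorem linked_of_commutator {o : Site b L → Bool} {v x x' y y' : Site b L}
    (hvx : v ≠ x) (hvx' : v ≠ x') (hvy : v ≠ y) (hvy' : v ≠ y') (hxy : x ≠ y) (hxy' : x ≠ y')
    (hx'y : x' ≠ y) (hx'y' : x' ≠ y')
    (hv : o v = true) (hx : o x = true) (hx' : o x' = false) (hy : o y = true) (hy' : o y' = false)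
    (hrow : ∀ o' : Site b L → Bool, o' v = true →
      (o' x = true → o' x' = false → Carries o' (hopPerm v x x')) ∧
      (o' x' = true → o' x = false → Carries o' (hopPerm v x' x)))
    (hcol : ∀ o' : Site b L → Bool, o' v = true →
      (o' y = true → o' y' = false → Carries o' (hopPerm v y y')) ∧
      (o' y' = true → o' y = false → Carries o' (hopPerm v y' y))) : Linked o v x := by
  have hxx' : x ≠ x' := fun h => by rw [h, hx'] at hx; cases hx
  have hyy' : y ≠ y' := fun h => by rw [h, hy'] at hy; cases hy
  set ρ : Equiv.Perm (Site b L) :=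
    hopPerm v x x' * (hopPerm v y y' * (hopPerm v x' x * hopPerm v y' y)) with hρ
  have rv : ρ v = x := by
    simp only [hρ, Equiv.Perm.mul_apply]
    rw [hopPerm_apply_v hvy' hyy'.symm, hopPerm_apply_of_ne hvy'.symm hx'y'.symm hxy'.symm,
      hopPerm_apply_dst hvy' hyy', hopPerm_apply_v hvx hxx']
  have rx : ρ x = y := by
    simp only [hρ, Equiv.Perm.mul_apply]
    rw [hopPerm_apply_of_ne hvx.symm hxy' hxy, hopPerm_apply_dst hvx hxx'.symm,
      hopPerm_apply_v hvy hyy', hopPerm_apply_of_ne hvy.symm hxy.symm hx'y.symm]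
  have ry : ρ y = v := by
    simp only [hρ, Equiv.Perm.mul_apply]
    rw [hopPerm_apply_dst hvy hyy'.symm, hopPerm_apply_v hvx' hxx'.symm,
      hopPerm_apply_of_ne hvx'.symm hx'y hx'y', hopPerm_apply_dst hvx' hxx']
  have rz : ∀ z, z ≠ v → z ≠ x → z ≠ y → ρ z = z := by
    intro z h1 h2 h3
    simp only [hρ, Equiv.Perm.mul_apply]
    by_cases h4 : z = x'
    · subst h4
      rw [hopPerm_apply_of_ne h1 hx'y' h3, hopPerm_apply_src, hopPerm_apply_of_ne hvx.symm hxy hxy',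
        hopPerm_apply_src]
    by_cases h5 : z = y'
    · subst h5
      rw [hopPerm_apply_src, hopPerm_apply_of_ne hvy.symm hx'y.symm hxy.symm, hopPerm_apply_src,
        hopPerm_apply_of_ne h1 hxy'.symm hx'y'.symm]
    rw [hopPerm_apply_of_ne h1 h5 h3, hopPerm_apply_of_ne h1 h4 h2, hopPerm_apply_of_ne h1 h3 h5,
      hopPerm_apply_of_ne h1 h2 h4]
  have hρo : o ∘ ρ = o := by
    funext z
    by_cases h1 : z = v
    · rw [h1, Function.comp, rv, hv, hx]
    by_cases h2 : z = x
    · rw [h2, Function.comp, rx, hy, hx]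
    by_cases h3 : z = y
    · rw [h3, Function.comp, ry, hy, hv]
    rw [Function.comp, rz z h1 h2 h3]
  have hρc : Carries o ρ := by
    refine ((hrow o hv).1 hx hx').mul (((hcol _ ?_).1 ?_ ?_).mul (((hrow _ ?_).2 ?_ ?_).mul
      ((hcol _ ?_).2 ?_ ?_))) <;> simp only [Function.comp]
    · rwa [hopPerm_apply_v hvx hxx']
    · rwa [hopPerm_apply_of_ne hvy.symm hxy.symm hx'y.symm]
    · rwa [hopPerm_apply_of_ne hvy'.symm hxy'.symm hx'y'.symm]
    · rwa [hopPerm_apply_v hvy hyy', hopPerm_apply_of_ne hvy.symm hxy.symm hx'y.symm]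
    · rwa [hopPerm_apply_of_ne hvx'.symm hx'y hx'y', hopPerm_apply_dst hvx' hxx']
    · rwa [hopPerm_apply_of_ne hvx.symm hxy hxy', hopPerm_apply_src]
    · rwa [hopPerm_apply_v hvx' hxx'.symm, hopPerm_apply_of_ne hvx'.symm hx'y hx'y',
        hopPerm_apply_dst hvx' hxx']
    · rwa [hopPerm_apply_of_ne hvy'.symm hx'y'.symm hxy'.symm, hopPerm_apply_dst hvy' hyy',
        hopPerm_apply_v hvx hxx']
    · rwa [hopPerm_apply_of_ne hvy.symm hx'y.symm hxy.symm, hopPerm_apply_src,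
        hopPerm_apply_of_ne hvy'.symm hxy'.symm hx'y'.symm]
  have hρc' : Carries o ρ⁻¹ := by
    have := hρc.inv
    rwa [hρo] at this
  refine ⟨hv, hx, fun c hc => ?_⟩
  have hcv : c v ≠ none := pat_eq_true.1 (by rw [hc, hv])
  have hcx : c x ≠ none := pat_eq_true.1 (by rw [hc, hx])
  have hcy : c y ≠ none := pat_eq_true.1 (by rw [hc, hy])
  obtain ⟨sv, hsv⟩ := Option.ne_none_iff_exists'.1 hcv
  obtain ⟨sx, hsx⟩ := Option.ne_none_iff_exists'.1 hcx
  obtain ⟨sy, hsy⟩ := Option.ne_none_iff_exists'.1 hcy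
  -- of the spins on `v`, `x`, `y` two are equal: the exchange of `v` and `x` acts on the spins as the
  -- identity, as the cyclic permutation, or as its inverse
  by_cases h1 : sv = sx
  · have : c ∘ Equiv.swap v x = c := by
      funext z
      simp only [Function.comp, Equiv.swap_apply_def]
      split_ifs with h2 h3
      · rw [h2, hsv, hsx, h1]
      · rw [h3, hsv, hsx, h1]
      · rfl
    rw [this]
  rcases Spin.eq_or_eq_of_ne h1 sy with h2 | h2
  · have : c ∘ Equiv.swap v x = c ∘ ρ := by
      funext z
      simp only [Function.comp]
      by_cases h3 : z = v
      · rw [h3, Equiv.swap_apply_left, rv]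
      by_cases h4 : z = x
      · rw [h4, Equiv.swap_apply_right, rx, hsv, hsy, h2]
      rw [Equiv.swap_apply_of_ne_of_ne h3 h4]
      by_cases h5 : z = y
      · rw [h5, ry, hsv, hsy, h2]
      rw [rz z h3 h4 h5]
    rw [this]
    exact hρc c hc
  · have iv : ρ⁻¹ v = y := Equiv.Perm.inv_eq_iff_eq.2 ry.symm
    have ix : ρ⁻¹ x = v := Equiv.Perm.inv_eq_iff_eq.2 rv.symm
    have iy : ρ⁻¹ y = x := Equiv.Perm.inv_eq_iff_eq.2 rx.symm
    have : c ∘ Equiv.swap v x = c ∘ ⇑ρ⁻¹ := by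
      funext z
      simp only [Function.comp]
      by_cases h3 : z = v
      · rw [h3, Equiv.swap_apply_left, iv, hsx, hsy, h2]
      by_cases h4 : z = x
      · rw [h4, Equiv.swap_apply_right, ix]
      rw [Equiv.swap_apply_of_ne_of_ne h3 h4]
      by_cases h5 : z = y
      · rw [h5, iy, hsx, hsy, h2]
      rw [Equiv.Perm.inv_eq_iff_eq.2 (rz z h3 h4 h5).symm]
    rw [this]
    exact hρc' c hc

/-! ### Moving electrons and vacancies along a wire -/

/-- All vertices are occupied. -/
def VertOcc (o : Site b L → Bool) : Prop := ∀ i j, o (.vertex i j) = true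

theorem VertOcc.vert {o : Site b L → Bool} (h : VertOcc o) (δ : Dir) (ℓ k : Fin L) :
    o (vert δ ℓ k) = true := by
  cases δ <;> exact h _ _

theorem vert_injective {δ : Dir} {ℓ ℓ' k k' : Fin L}
    (h : (vert δ ℓ k : Site b L) = vert δ ℓ' k') : ℓ = ℓ' ∧ k = k' := by
  cases δ <;> simp [vert] at h <;> tauto

/-- The other direction. -/
def Dir.other : Dir → Dir
  | .x => .y
  | .y => .x

theorem Dir.other_ne (δ : Dir) : δ.other ≠ δ := by cases δ <;> simp [Dir.other]

theorem vert_other (δ : Dir) (ℓ k : Fin L) : (vert δ.other k ℓ : Site b L) = vert δ ℓ k := by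
  cases δ <;> rfl

/-- A hop permutes the occupied set as the transposition of the two bonds. -/
theorem comp_hopPerm_eq {o : Site b L → Bool} {v p p' : Site b L} (hv : o v = true)
    (hp : o p = true) (hvp : v ≠ p) (hvp' : v ≠ p') (hpp : p ≠ p') :
    o ∘ hopPerm v p p' = o ∘ Equiv.swap p p' := by
  funext z
  simp only [Function.comp]
  by_cases h1 : z = v
  · rw [h1, hopPerm_apply_v hvp hpp, Equiv.swap_apply_of_ne_of_ne hvp hvp', hv, hp]
  by_cases h2 : z = p
  · rw [h2, hopPerm_apply_src, Equiv.swap_apply_left]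
  by_cases h3 : z = p'
  · rw [h3, hopPerm_apply_dst hvp' hpp, Equiv.swap_apply_right, hv, hp]
  rw [hopPerm_apply_of_ne h1 h2 h3, Equiv.swap_apply_of_ne_of_ne h2 h3]

/-- Hopping over one vertex exchanges the status of the two adjacent bonds. -/
theorem exists_carries_swap {o : Site b L → Bool} (ho : VertOcc o) {δ : Dir} {ℓ k : Fin L}
    (h : o (.bond δ ℓ (b.before k)) ≠ o (.bond δ ℓ (b.after k))) :
    ∃ π : Equiv.Perm (Site b L), Carries o π ∧
      o ∘ π = o ∘ Equiv.swap (.bond δ ℓ (b.before k)) (.bond δ ℓ (b.after k)) ∧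
      ∀ z, z ≠ .bond δ ℓ (b.before k) → z ≠ .bond δ ℓ (b.after k) → z ≠ vert δ ℓ k → π z = z := by
  have hv := ho.vert δ ℓ k
  have hne : (.bond δ ℓ (b.before k) : Site b L) ≠ .bond δ ℓ (b.after k) := fun e => h (by rw [e])
  rcases h1 : o (.bond δ ℓ (b.before k)) with _ | _
  · have h2 : o (.bond δ ℓ (b.after k)) = true := by
      rw [h1] at h
      simpa using h.symm
    refine ⟨Hop.perm (δ, ℓ, k, false), carries_hop (δ, ℓ, k, false) hv h2 h1, ?_, ?_⟩
    · rw [Equiv.swap_comm]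
      exact comp_hopPerm_eq hv h2 (vert_ne_bond _ _ _ _ _ _) (vert_ne_bond _ _ _ _ _ _) hne.symm
    · intro z hz1 hz2 hz3
      exact hopPerm_apply_of_ne hz3 hz2 hz1
  · have h2 : o (.bond δ ℓ (b.after k)) = false := by
      rw [h1] at h
      simpa using h.symm
    refine ⟨Hop.perm (δ, ℓ, k, true), carries_hop (δ, ℓ, k, true) hv h1 h2, ?_, ?_⟩
    · exact comp_hopPerm_eq hv h1 (vert_ne_bond _ _ _ _ _ _) (vert_ne_bond _ _ _ _ _ _) hne
    · intro z hz1 hz2 hz3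
      exact hopPerm_apply_of_ne hz3 hz1 hz2

theorem VertOcc.comp_swap {o : Site b L → Bool} (ho : VertOcc o) (δ δ' : Dir) (ℓ ℓ' : Fin L)
    (m m' : Fin (b.bonds L)) : VertOcc (o ∘ Equiv.swap (.bond δ ℓ m) (.bond δ' ℓ' m')) := by
  intro i j
  rw [Function.comp, Equiv.swap_apply_of_ne_of_ne (by simp) (by simp)]
  exact ho i j

/-- The status (occupied or vacant) of the bond before the vertex `t` can be moved to the bond before a
later vertex `k` without touching anything outside the segment between them. -/
theorem exists_carries_before {δ : Dir} {ℓ : Fin L} {k : Fin L} (n : ℕ) :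
    ∀ {o : Site b L → Bool} (_ : VertOcc o) {t : Fin L} (_ : t.val + n = k.val),
    ∃ π : Equiv.Perm (Site b L), Carries o π ∧ VertOcc (o ∘ π) ∧
      o (π (.bond δ ℓ (b.before k))) = o (.bond δ ℓ (b.before t)) ∧
      ∀ z, π z ≠ z → (∃ m : Fin (b.bonds L), z = .bond δ ℓ m ∧ t.val ≤ m.val ∧ m.val ≤ k.val) ∨
        ∃ i : Fin L, z = vert δ ℓ i ∧ t ≤ i ∧ i < k := by
  induction n with
  | zero =>
    intro o ho t ht
    have : t = k := Fin.ext (by omega)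
    subst this
    exact ⟨1, Carries.one o, ho, rfl, fun z hz => absurd rfl hz⟩
  | succ n ih =>
    intro o ho t ht
    have hk := k.isLt
    let t' : Fin L := ⟨t.val + 1, by omega⟩
    have hat : b.after t = b.before t' := by
      apply Fin.ext
      rw [before_val, after_val_of_lt (by have := le_bonds b L; omega)]
    have ht' : t'.val + n = k.val := by
      simp only [t']
      omega
    by_cases hs : o (.bond δ ℓ (b.before t)) = o (.bond δ ℓ (b.after t))
    · obtain ⟨π, h1, h2, h3, h4⟩ := ih ho ht'
      refine ⟨π, h1, h2, by rw [h3, hs, hat], fun z hz => ?_⟩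
      rcases h4 z hz with ⟨m, hm, hm1, hm2⟩ | ⟨i, hi, hi1, hi2⟩
      · exact Or.inl ⟨m, hm, by simp only [t'] at hm1; omega, hm2⟩
      · exact Or.inr ⟨i, hi, by rw [Fin.le_def] at hi1 ⊢; simp only [t'] at hi1; omega, hi2⟩
    · obtain ⟨σ, g1, g2, g3⟩ := exists_carries_swap ho hs
      have ho' : VertOcc (o ∘ σ) := by
        rw [g2]
        exact ho.comp_swap _ _ _ _ _ _
      obtain ⟨π, h1, h2, h3, h4⟩ := ih ho' ht'
      refine ⟨σ * π, g1.mul h1, h2, ?_, fun z hz => ?_⟩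
      · have h5 : o (σ (π (.bond δ ℓ (b.before k)))) = (o ∘ σ) (.bond δ ℓ (b.before t')) := h3
        rw [Equiv.Perm.mul_apply, h5, ← hat, g2, Function.comp, Equiv.swap_apply_right]
      · by_cases hz1 : π z = z
        · rw [Equiv.Perm.mul_apply, hz1] at hz
          by_cases e1 : z = .bond δ ℓ (b.before t)
          · exact Or.inl ⟨_, e1, by rw [before_val], by rw [before_val]; omega⟩
          by_cases e2 : z = .bond δ ℓ (b.after t)
          · exact Or.inl ⟨_, e2, by rw [hat, before_val]; simp only [t']; omega,
              by rw [hat, before_val]; simp only [t']; omega⟩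
          by_cases e3 : z = vert δ ℓ t
          · exact Or.inr ⟨t, e3, le_rfl, by rw [Fin.lt_def]; omega⟩
          exact absurd (g3 z e1 e2 e3) hz
        · rcases h4 z hz1 with ⟨m, hm, hm1, hm2⟩ | ⟨i, hi, hi1, hi2⟩
          · exact Or.inl ⟨m, hm, by simp only [t'] at hm1; omega, hm2⟩
          · exact Or.inr ⟨i, hi, by rw [Fin.le_def] at hi1 ⊢; simp only [t'] at hi1; omega, hi2⟩

/-- The status of the bond after the vertex `t` can be moved to the bond after an earlier vertex `k`
without touching anything outside the segment between them. -/
theorem exists_carries_after {δ : Dir} {ℓ : Fin L} {k : Fin L} (n : ℕ) :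
    ∀ {o : Site b L → Bool} (_ : VertOcc o) {t : Fin L} (_ : k.val + n = t.val),
    ∃ π : Equiv.Perm (Site b L), Carries o π ∧ VertOcc (o ∘ π) ∧
      o (π (.bond δ ℓ (b.after k))) = o (.bond δ ℓ (b.after t)) ∧
      ∀ z, π z ≠ z → (∃ i : Fin L, z = .bond δ ℓ (b.after i) ∧ k ≤ i ∧ i ≤ t) ∨
        ∃ i : Fin L, z = vert δ ℓ i ∧ k < i ∧ i ≤ t := by
  induction n with
  | zero =>
    intro o ho t ht
    have : k = t := Fin.ext (by omega)
    subst this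
    exact ⟨1, Carries.one o, ho, rfl, fun z hz => absurd rfl hz⟩
  | succ n ih =>
    intro o ho t ht
    have hk := t.isLt
    let t' : Fin L := ⟨t.val - 1, by omega⟩
    have hat : b.after t' = b.before t := by
      apply Fin.ext
      rw [before_val, after_val_of_lt (by have := le_bonds b L; simp only [t']; omega)]
      simp only [t']
      omega
    have ht' : k.val + n = t'.val := by
      simp only [t']
      omega
    have hlt : t' ≤ t := by
      rw [Fin.le_def]
      simp only [t']
      omega
    have hkt : k ≤ t' := by
      rw [Fin.le_def]
      omega
    by_cases hs : o (.bond δ ℓ (b.before t)) = o (.bond δ ℓ (b.after t))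
    · obtain ⟨π, h1, h2, h3, h4⟩ := ih ho ht'
      refine ⟨π, h1, h2, by rw [h3, hat, hs], fun z hz => ?_⟩
      rcases h4 z hz with ⟨i, hi, hi1, hi2⟩ | ⟨i, hi, hi1, hi2⟩
      · exact Or.inl ⟨i, hi, hi1, hi2.trans hlt⟩
      · exact Or.inr ⟨i, hi, hi1, hi2.trans hlt⟩
    · obtain ⟨σ, g1, g2, g3⟩ := exists_carries_swap ho hs
      have ho' : VertOcc (o ∘ σ) := by
        rw [g2]
        exact ho.comp_swap _ _ _ _ _ _
      obtain ⟨π, h1, h2, h3, h4⟩ := ih ho' ht'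
      refine ⟨σ * π, g1.mul h1, h2, ?_, fun z hz => ?_⟩
      · have h5 : o (σ (π (.bond δ ℓ (b.after k)))) = (o ∘ σ) (.bond δ ℓ (b.after t')) := h3
        rw [Equiv.Perm.mul_apply, h5, hat, g2, Function.comp, Equiv.swap_apply_left]
      · by_cases hz1 : π z = z
        · rw [Equiv.Perm.mul_apply, hz1] at hz
          by_cases e1 : z = .bond δ ℓ (b.before t)
          · exact Or.inl ⟨t', by rw [hat, e1], hkt, hlt⟩
          by_cases e2 : z = .bond δ ℓ (b.after t)
          · exact Or.inl ⟨t, e2, hkt.trans hlt, le_rfl⟩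
          by_cases e3 : z = vert δ ℓ t
          · exact Or.inr ⟨t, e3, by rw [Fin.lt_def]; omega, le_rfl⟩
          exact absurd (g3 z e1 e2 e3) hz
        · rcases h4 z hz1 with ⟨i, hi, hi1, hi2⟩ | ⟨i, hi, hi1, hi2⟩
          · exact Or.inl ⟨i, hi, hi1, hi2.trans hlt⟩
          · exact Or.inr ⟨i, hi, hi1, hi2.trans hlt⟩

/-- A wire with an occupied and a vacant bond can be brought into a state that allows a hop over a
given vertex, without moving the electron on this vertex. -/
theorem exists_carries_active {o : Site b L → Bool} (ho : VertOcc o) {δ : Dir} {ℓ : Fin L}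
    (hmix : ∃ m m', o (.bond δ ℓ m) ≠ o (.bond δ ℓ m')) (k : Fin L) :
    ∃ π : Equiv.Perm (Site b L), Carries o π ∧ VertOcc (o ∘ π) ∧
      o (π (.bond δ ℓ (b.before k))) ≠ o (π (.bond δ ℓ (b.after k))) ∧
      ∀ z, π z ≠ z → (∃ m, z = .bond δ ℓ m) ∨ ∃ i, z = vert δ ℓ i ∧ i ≠ k := by
  by_cases h : o (.bond δ ℓ (b.before k)) = o (.bond δ ℓ (b.after k))
  swap
  · exact ⟨1, Carries.one o, ho, h, fun z hz => absurd rfl hz⟩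
  obtain ⟨x, hx⟩ : ∃ x, o (.bond δ ℓ x) ≠ o (.bond δ ℓ (b.before k)) := by
    by_contra hcon
    push Not at hcon
    obtain ⟨m, m', hm⟩ := hmix
    exact hm ((hcon m).trans (hcon m').symm)
  have hxL := x.isLt
  have hkL := k.isLt
  by_cases hxk : x.val ≤ k.val
  · let t : Fin L := ⟨x.val, by omega⟩
    have hbt : b.before t = x := Fin.ext (before_val t)
    obtain ⟨π, h1, h2, h3, h4⟩ := exists_carries_before (δ := δ) (ℓ := ℓ) (k := k) (k.val - x.val) ho
      (t := t) (by simp only [t]; omega)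
    refine ⟨π, h1, h2, ?_, fun z hz => ?_⟩
    · have h5 : π (.bond δ ℓ (b.after k)) = .bond δ ℓ (b.after k) := by
        by_contra hz
        rcases h4 _ hz with ⟨m, hm, hm1, hm2⟩ | ⟨i, hi, -⟩
        · simp only [Site.bond.injEq, true_and] at hm
          subst hm
          rcases (val_add_one_le_bonds b k).lt_or_eq with h6 | h6
          · rw [after_val_of_lt h6] at hm2
            omega
          · rw [after_val_of_eq h6] at hm1
            have h7 : x = b.after k := Fin.ext (by
              rw [after_val_of_eq h6]
              simp only [t] at hm1
              omega)
            rw [h7] at hx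
            exact hx h.symm
        · exact vert_ne_bond _ _ _ _ _ _ hi.symm
      rw [h3, h5, hbt, ← h]
      exact hx
    · rcases h4 z hz with ⟨m, hm, -⟩ | ⟨i, hi, -, hi2⟩
      · exact Or.inl ⟨m, hm⟩
      · exact Or.inr ⟨i, hi, hi2.ne⟩
  · have hxL' : x.val ≤ L := by
      cases b <;> simp only [Boundary.bonds] at hxL <;> omega
    let t : Fin L := ⟨x.val - 1, by omega⟩
    have hat : b.after t = x := by
      apply Fin.ext
      rw [after_val_of_lt (by simp only [t]; omega)]
      simp only [t]
      omega
    obtain ⟨π, h1, h2, h3, h4⟩ := exists_carries_after (δ := δ) (ℓ := ℓ) (k := k) (x.val - 1 - k.val) ho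
      (t := t) (by simp only [t]; omega)
    refine ⟨π, h1, h2, ?_, fun z hz => ?_⟩
    · have h5 : π (.bond δ ℓ (b.before k)) = .bond δ ℓ (b.before k) := by
        by_contra hz
        rcases h4 _ hz with ⟨i, hi, hi1, hi2⟩ | ⟨i, hi, -⟩
        · simp only [Site.bond.injEq, true_and] at hi
          have h6 := congrArg Fin.val hi
          rw [Fin.le_def] at hi1 hi2
          simp only [t] at hi2
          rw [before_val, after_val_of_lt (by omega)] at h6
          omega
        · exact vert_ne_bond _ _ _ _ _ _ hi.symm
      rw [h3, h5, hat]
      exact hx.symm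
    · rcases h4 z hz with ⟨i, hi, -⟩ | ⟨i, hi, hi1, -⟩
      · exact Or.inl ⟨_, hi⟩
      · exact Or.inr ⟨i, hi, hi1.ne'⟩

theorem carries_hopPerm_of_adjacent {o : Site b L → Bool} {δ : Dir} {ℓ k : Fin L}
    (hv : o (vert δ ℓ k) = true) {p p' : Site b L}
    (hpp : (p = .bond δ ℓ (b.before k) ∧ p' = .bond δ ℓ (b.after k)) ∨
      (p = .bond δ ℓ (b.after k) ∧ p' = .bond δ ℓ (b.before k)))
    (hp : o p = true) (hp' : o p' = false) : Carries o (hopPerm (vert δ ℓ k) p p') := by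
  rcases hpp with ⟨rfl, rfl⟩ | ⟨rfl, rfl⟩
  · exact carries_hop (δ, ℓ, k, true) hv hp hp'
  · exact carries_hop (δ, ℓ, k, false) hv hp hp'

/-- If a wire allows a hop over a vertex, the spins on the vertex and on the adjacent occupied bond
can be exchanged: the crossing wire is made active at this vertex first. -/
theorem linked_of_active {o : Site b L → Bool} (ho : VertOcc o) {δ : Dir} {ℓ k : Fin L}
    (hmix : ∃ m m', o (.bond δ.other k m) ≠ o (.bond δ.other k m')) {x x' : Site b L}
    (hxx : (x = .bond δ ℓ (b.before k) ∧ x' = .bond δ ℓ (b.after k)) ∨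
      (x = .bond δ ℓ (b.after k) ∧ x' = .bond δ ℓ (b.before k)))
    (hx : o x = true) (hx' : o x' = false) : Linked o (vert δ ℓ k) x := by
  obtain ⟨π, h1, h2, h3, h4⟩ := exists_carries_active ho hmix ℓ
  have hbond : ∀ m, π (.bond δ ℓ m) = .bond δ ℓ m := by
    intro m
    by_contra hz
    rcases h4 _ hz with ⟨m', hm⟩ | ⟨i, hi, -⟩
    · simp only [Site.bond.injEq] at hm
      exact δ.other_ne hm.1.symm
    · exact vert_ne_bond _ _ _ _ _ _ hi.symm
  have hvert : π (vert δ ℓ k) = vert δ ℓ k := by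
    by_contra hz
    rcases h4 _ hz with ⟨m', hm⟩ | ⟨i, hi, hi'⟩
    · exact vert_ne_bond _ _ _ _ _ _ hm
    · rw [← vert_other δ ℓ k] at hi
      exact hi' (vert_injective hi).2.symm
  have hπx : π x = x := by rcases hxx with h | h <;> rw [h.1, hbond]
  have hπx' : π x' = x' := by rcases hxx with h | h <;> rw [h.2, hbond]
  obtain ⟨y, y', hyy, hy, hy'⟩ : ∃ y y' : Site b L,
      ((y = .bond δ.other k (b.before ℓ) ∧ y' = .bond δ.other k (b.after ℓ)) ∨
        (y = .bond δ.other k (b.after ℓ) ∧ y' = .bond δ.other k (b.before ℓ))) ∧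
      (o ∘ π) y = true ∧ (o ∘ π) y' = false := by
    rcases h5 : o (π (.bond δ.other k (b.before ℓ))) with _ | _
    · refine ⟨_, _, Or.inr ⟨rfl, rfl⟩, ?_, h5⟩
      rw [h5] at h3
      simpa using h3.symm
    · refine ⟨_, _, Or.inl ⟨rfl, rfl⟩, h5, ?_⟩
      rw [h5] at h3
      simpa using h3.symm
  have hne : ∀ m m', (.bond δ ℓ m : Site b L) ≠ .bond δ.other k m' := by
    intro m m' h
    simp only [Site.bond.injEq] at h
    exact δ.other_ne h.1.symm
  have key : Linked (o ∘ π) (vert δ ℓ k) x := by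
    refine linked_of_commutator (x' := x') (y := y) (y' := y') ?_ ?_ ?_ ?_ ?_ ?_ ?_ ?_
      (h2.vert δ ℓ k) (by rw [Function.comp, hπx, hx]) (by rw [Function.comp, hπx', hx']) hy hy'
      (fun o' ho' => ⟨carries_hopPerm_of_adjacent ho' hxx,
        carries_hopPerm_of_adjacent ho' (hxx.elim (fun h => Or.inr h.symm) (fun h => Or.inl h.symm))⟩)
      (fun o' ho' => ?_)
    · rcases hxx with h | h <;> rw [h.1] <;> exact vert_ne_bond _ _ _ _ _ _
    · rcases hxx with h | h <;> rw [h.2] <;> exact vert_ne_bond _ _ _ _ _ _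
    · rcases hyy with h | h <;> rw [h.1] <;> exact vert_ne_bond _ _ _ _ _ _
    · rcases hyy with h | h <;> rw [h.2] <;> exact vert_ne_bond _ _ _ _ _ _
    · rcases hxx with h | h <;> rcases hyy with h' | h' <;> rw [h.1, h'.1] <;> exact hne _ _
    · rcases hxx with h | h <;> rcases hyy with h' | h' <;> rw [h.1, h'.2] <;> exact hne _ _
    · rcases hxx with h | h <;> rcases hyy with h' | h' <;> rw [h.2, h'.1] <;> exact hne _ _
    · rcases hxx with h | h <;> rcases hyy with h' | h' <;> rw [h.2, h'.2] <;> exact hne _ _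
    · rw [← vert_other] at ho' ⊢
      exact ⟨carries_hopPerm_of_adjacent ho' hyy,
        carries_hopPerm_of_adjacent ho' (hyy.elim (fun h => Or.inr h.symm) (fun h => Or.inl h.symm))⟩
  have := Linked.transport h1 key
  rwa [hvert, hπx] at this

/-! ### Connectedness of the sectors -/

/-- The charges of an occupied set. -/
def bondCount (o : Site b L → Bool) : Charges L :=
  fun δ ℓ => (Finset.univ.filter (fun m => o (.bond δ ℓ m) = true)).card

theorem bondCount_comp_swap (o : Site b L → Bool) (δ : Dir) (ℓ : Fin L) (m m' : Fin (b.bonds L)) :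
    bondCount (o ∘ Equiv.swap (.bond δ ℓ m) (.bond δ ℓ m')) = bondCount o := by
  funext δ' ℓ'
  unfold bondCount
  by_cases h : δ' = δ ∧ ℓ' = ℓ
  · obtain ⟨rfl, rfl⟩ := h
    refine Finset.card_equiv (Equiv.swap m m') fun x => ?_
    have : Equiv.swap (.bond δ' ℓ' m : Site b L) (.bond δ' ℓ' m') (.bond δ' ℓ' x) =
        .bond δ' ℓ' (Equiv.swap m m' x) := by
      simp only [Equiv.swap_apply_def, Site.bond.injEq, true_and]
      split_ifs <;> rfl
    simp [this]
  · congr 1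
    ext x
    rw [Finset.mem_filter, Finset.mem_filter, Function.comp, Equiv.swap_apply_of_ne_of_ne] <;>
    · simp only [ne_eq, Site.bond.injEq]
      tauto

/-- The electrons of each wire occupy the bonds `1, …, q` of it. This reference pattern has a vacancy on
either side of the electrons. -/
def blockPat (q : Charges L) : Site b L → Bool
  | .bond δ ℓ m => decide (1 ≤ m.val ∧ m.val ≤ q δ ℓ)
  | .vertex _ _ => true

/-- The electrons of each wire occupy the bonds `0, …, q - 1` of it. -/
def packedPat (q : Charges L) : Site b L → Bool
  | .bond δ ℓ m => decide (m.val < q δ ℓ)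
  | .vertex _ _ => true

theorem vertOcc_blockPat (q : Charges L) : VertOcc (blockPat q : Site b L → Bool) := fun _ _ => rfl

theorem blockPat_mixed {q : Charges L} (hq : ∀ δ ℓ, 0 < q δ ℓ ∧ q δ ℓ < L)
    (δ : Dir) (ℓ : Fin L) :
    ∃ m m' : Fin (b.bonds L), blockPat q (.bond δ ℓ m) ≠ blockPat q (.bond δ ℓ m') := by
  have h1 := hq δ ℓ
  have h2 := le_bonds b L
  exact ⟨⟨0, by omega⟩, ⟨1, by omega⟩, by simp [blockPat]; omega⟩

/-- A vertex inside the block or at its beginning is linked to the bond after it, once the vacancy on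
the bond `0` is moved to the bond before it. -/
theorem blockPat_link_after {q : Charges L} (hq : ∀ δ ℓ, 0 < q δ ℓ ∧ q δ ℓ < L)
    {δ : Dir} {ℓ i : Fin L} (hi : i.val < q δ ℓ) :
    Linked (blockPat q : Site b L → Bool) (vert δ ℓ i) (.bond δ ℓ (b.after i)) := by
  have h1 := hq δ ℓ
  have h2 := le_bonds b L
  have ha : (b.after i).val = i.val + 1 := after_val_of_lt (by omega)
  obtain ⟨π, g1, g2, g3, g4⟩ := exists_carries_before (δ := δ) (ℓ := ℓ) (k := i) i.val
    (vertOcc_blockPat (b := b) q) (t := ⟨0, by omega⟩) (by simp)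
  have hfix : π (.bond δ ℓ (b.after i)) = .bond δ ℓ (b.after i) := by
    by_contra hz
    rcases g4 _ hz with ⟨m, hm, -, hm2⟩ | ⟨j, hj, -⟩
    · simp only [Site.bond.injEq, true_and] at hm
      rw [← hm] at hm2
      omega
    · exact vert_ne_bond _ _ _ _ _ _ hj.symm
  have hfixv : π (vert δ ℓ i) = vert δ ℓ i := by
    by_contra hz
    rcases g4 _ hz with ⟨m, hm, -⟩ | ⟨j, hj, -, hj2⟩
    · exact vert_ne_bond _ _ _ _ _ _ hm
    · exact hj2.ne (vert_injective hj).2.symm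
  have hbond : ∀ m, π (.bond δ.other i m) = .bond δ.other i m := by
    intro m
    by_contra hz
    rcases g4 _ hz with ⟨m', hm, -⟩ | ⟨j, hj, -⟩
    · simp only [Site.bond.injEq] at hm
      exact δ.other_ne hm.1
    · exact vert_ne_bond _ _ _ _ _ _ hj.symm
  have key := linked_of_active g2 (δ := δ) (ℓ := ℓ) (k := i)
    (by simpa only [Function.comp, hbond] using blockPat_mixed hq δ.other i)
    (Or.inr ⟨rfl, rfl⟩) (by simp [hfix, blockPat, ha]; omega)
    (by rw [Function.comp, g3]; simp [blockPat, before_val])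
  have := Linked.transport g1 key
  rwa [hfix, hfixv] at this

/-- A vertex inside the block or at its end is linked to the bond before it, once the vacancy behind the
block is moved to the bond after it. -/
theorem blockPat_link_before {q : Charges L} (hq : ∀ δ ℓ, 0 < q δ ℓ ∧ q δ ℓ < L)
    {δ : Dir} {ℓ i : Fin L} (hi0 : 1 ≤ i.val) (hi : i.val ≤ q δ ℓ) :
    Linked (blockPat q : Site b L → Bool) (vert δ ℓ i) (.bond δ ℓ (b.before i)) := by
  have h1 := hq δ ℓ
  have h2 := le_bonds b L
  let t : Fin L := ⟨q δ ℓ, h1.2⟩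
  have hvac : (blockPat q : Site b L → Bool) (.bond δ ℓ (b.after t)) = false := by
    rcases (val_add_one_le_bonds b t).lt_or_eq with h6 | h6
    · simp [blockPat, after_val_of_lt h6, t]
    · simp [blockPat, after_val_of_eq h6]
  obtain ⟨π, g1, g2, g3, g4⟩ := exists_carries_after (δ := δ) (ℓ := ℓ) (k := i) (q δ ℓ - i.val)
    (vertOcc_blockPat (b := b) q) (t := t) (by simp only [t]; omega)
  have hfix : π (.bond δ ℓ (b.before i)) = .bond δ ℓ (b.before i) := by
    by_contra hz
    rcases g4 _ hz with ⟨j, hj, hj1, -⟩ | ⟨j, hj, -⟩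
    · simp only [Site.bond.injEq, true_and] at hj
      have h6 := congrArg Fin.val hj
      rw [before_val] at h6
      rw [Fin.le_def] at hj1
      rcases (val_add_one_le_bonds b j).lt_or_eq with h7 | h7
      · rw [after_val_of_lt h7] at h6
        omega
      · rw [after_val_of_eq h7] at h6
        omega
    · exact vert_ne_bond _ _ _ _ _ _ hj.symm
  have hfixv : π (vert δ ℓ i) = vert δ ℓ i := by
    by_contra hz
    rcases g4 _ hz with ⟨m, hm, -⟩ | ⟨j, hj, hj1, -⟩
    · exact vert_ne_bond _ _ _ _ _ _ hm
    · exact hj1.ne (vert_injective hj).2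
  have hbond : ∀ m, π (.bond δ.other i m) = .bond δ.other i m := by
    intro m
    by_contra hz
    rcases g4 _ hz with ⟨m', hm, -⟩ | ⟨j, hj, -⟩
    · simp only [Site.bond.injEq] at hm
      exact δ.other_ne hm.1
    · exact vert_ne_bond _ _ _ _ _ _ hj.symm
  have key := linked_of_active g2 (δ := δ) (ℓ := ℓ) (k := i)
    (by simpa only [Function.comp, hbond] using blockPat_mixed hq δ.other i)
    (Or.inl ⟨rfl, rfl⟩) (by simp [hfix, blockPat, before_val]; omega)
    (by rw [Function.comp, g3, hvac])
  have := Linked.transport g1 key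
  rwa [hfix, hfixv] at this

/-- A vertex beyond the block is linked to an orbital closer to the block: to the one whose electron
arrives at the bond before this vertex when the outermost electron is moved there. -/
theorem blockPat_link_beyond {q : Charges L} (hq : ∀ δ ℓ, 0 < q δ ℓ ∧ q δ ℓ < L)
    {δ : Dir} {ℓ i : Fin L} (hi : q δ ℓ < i.val) :
    ∃ z : Site b L, Linked (blockPat q) (vert δ ℓ i) z ∧
      (z = .bond δ ℓ (b.before ⟨q δ ℓ, (hq δ ℓ).2⟩) ∨ ∃ j < i, z = vert δ ℓ j) := by
  have h1 := hq δ ℓ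
  have h2 := le_bonds b L
  let t : Fin L := ⟨q δ ℓ, h1.2⟩
  have hocc : (blockPat q : Site b L → Bool) (.bond δ ℓ (b.before t)) = true := by
    simp only [blockPat, before_val, t, decide_eq_true_eq]
    omega
  obtain ⟨π, g1, g2, g3, g4⟩ := exists_carries_before (δ := δ) (ℓ := ℓ) (k := i) (i.val - q δ ℓ)
    (vertOcc_blockPat (b := b) q) (t := t) (by simp only [t]; omega)
  have hfix : π (.bond δ ℓ (b.after i)) = .bond δ ℓ (b.after i) := by
    by_contra hz
    rcases g4 _ hz with ⟨m, hm, hm1, hm2⟩ | ⟨j, hj, -⟩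
    · simp only [Site.bond.injEq, true_and] at hm
      rw [← hm] at hm1 hm2
      simp only [t] at hm1
      rcases (val_add_one_le_bonds b i).lt_or_eq with h7 | h7
      · rw [after_val_of_lt h7] at hm2
        omega
      · rw [after_val_of_eq h7] at hm1
        omega
    · exact vert_ne_bond _ _ _ _ _ _ hj.symm
  have hvac : (blockPat q : Site b L → Bool) (.bond δ ℓ (b.after i)) = false := by
    rcases (val_add_one_le_bonds b i).lt_or_eq with h6 | h6
    · simp [blockPat, after_val_of_lt h6]
      omega
    · simp [blockPat, after_val_of_eq h6]
  have hfixv : π (vert δ ℓ i) = vert δ ℓ i := by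
    by_contra hz
    rcases g4 _ hz with ⟨m, hm, -⟩ | ⟨j, hj, -, hj2⟩
    · exact vert_ne_bond _ _ _ _ _ _ hm
    · exact hj2.ne (vert_injective hj).2.symm
  have hbond : ∀ m, π (.bond δ.other i m) = .bond δ.other i m := by
    intro m
    by_contra hz
    rcases g4 _ hz with ⟨m', hm, -⟩ | ⟨j, hj, -⟩
    · simp only [Site.bond.injEq] at hm
      exact δ.other_ne hm.1
    · exact vert_ne_bond _ _ _ _ _ _ hj.symm
  have key := linked_of_active g2 (δ := δ) (ℓ := ℓ) (k := i)
    (by simpa only [Function.comp, hbond] using blockPat_mixed hq δ.other i)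
    (Or.inl ⟨rfl, rfl⟩) (by rw [Function.comp, g3, hocc]) (by rw [Function.comp, hfix, hvac])
  have key2 := Linked.transport g1 key
  rw [hfixv] at key2
  refine ⟨_, key2, ?_⟩
  by_cases hπ : π (.bond δ ℓ (b.before i)) = .bond δ ℓ (b.before i)
  · exfalso
    have h3 := key2.2.1
    rw [hπ] at h3
    simp [blockPat, before_val] at h3
    omega
  · have h4 : π (π (.bond δ ℓ (b.before i))) ≠ π (.bond δ ℓ (b.before i)) := fun h =>
      hπ (π.injective h)
    rcases g4 _ h4 with ⟨m, hm, hm1, hm2⟩ | ⟨j, hj, -, hj2⟩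
    · left
      rw [hm]
      congr 1
      apply Fin.ext
      rw [before_val]
      have h3 := key2.2.1
      rw [hm] at h3
      simp [blockPat] at h3
      simp only [t] at hm1
      simp only
      omega
    · exact Or.inr ⟨j, hj2, hj⟩

/-- All vertices of a line are linked to its first vertex. -/
theorem blockPat_link_vert {q : Charges L} (hq : ∀ δ ℓ, 0 < q δ ℓ ∧ q δ ℓ < L)
    (δ : Dir) (ℓ : Fin L) (hL : 0 < L) (n : ℕ) :
    ∀ i : Fin L, i.val = n →
      Linked (blockPat q : Site b L → Bool) (vert δ ℓ i) (vert δ ℓ ⟨0, hL⟩) := by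
  induction n using Nat.strong_induction_on with
  | _ n ih =>
    intro i hi
    have h1 := hq δ ℓ
    have h2 := le_bonds b L
    by_cases hi0 : i.val = 0
    · have : i = ⟨0, hL⟩ := Fin.ext hi0
      rw [this]
      exact Linked.refl ((vertOcc_blockPat q).vert _ _ _)
    by_cases hi1 : i.val ≤ q δ ℓ
    · have hlt := i.isLt
      let j : Fin L := ⟨i.val - 1, by omega⟩
      have hja : b.after j = b.before i := by
        apply Fin.ext
        rw [before_val, after_val_of_lt (by simp only [j]; omega)]
        simp only [j]
        omega
      have e1 := blockPat_link_before (b := b) hq (δ := δ) (ℓ := ℓ) (by omega) hi1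
      have e2 := blockPat_link_after (b := b) hq (δ := δ) (ℓ := ℓ) (i := j) (by simp only [j]; omega)
      rw [hja] at e2
      exact (e1.trans e2.symm).trans (ih j.val (by simp only [j]; omega) j rfl)
    · obtain ⟨z, hz, rfl | ⟨j, hj, rfl⟩⟩ := blockPat_link_beyond (b := b) hq (not_le.1 hi1)
      · have e1 := blockPat_link_before (b := b) hq (δ := δ) (ℓ := ℓ) (i := ⟨q δ ℓ, h1.2⟩) h1.1 le_rfl
        exact (hz.trans e1.symm).trans (ih (q δ ℓ) (by omega) _ rfl)
      · exact hz.trans (ih j.val (by rw [← hi]; exact hj) j rfl)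

/-- At the block pattern, all spins can be permuted. -/
theorem blockPat_linked {q : Charges L} (hq : ∀ δ ℓ, 0 < q δ ℓ ∧ q δ ℓ < L)
    {x y : Site b L} (hx : blockPat q x = true) (hy : blockPat q y = true) :
    Linked (blockPat q) x y := by
  have hL : 0 < L := by
    rcases x with ⟨-, ℓ, -⟩ | ⟨i, -⟩
    · exact ℓ.pos
    · exact i.pos
  have key : ∀ x : Site b L, blockPat q x = true →
      Linked (blockPat q) x (.vertex ⟨0, hL⟩ ⟨0, hL⟩) := by
    have hvert : ∀ i j, Linked (blockPat q : Site b L → Bool) (.vertex i j)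
        (.vertex ⟨0, hL⟩ ⟨0, hL⟩) := by
      intro i j
      have e1 := blockPat_link_vert (b := b) hq .x j hL _ i rfl
      have e2 := blockPat_link_vert (b := b) hq .y ⟨0, hL⟩ hL _ j rfl
      exact e1.trans e2
    intro x hx
    rcases x with ⟨δ, ℓ, m⟩ | ⟨i, j⟩
    · simp only [blockPat, decide_eq_true_eq] at hx
      have h1 := hq δ ℓ
      have h2 := le_bonds b L
      let j : Fin L := ⟨m.val - 1, by omega⟩
      have hja : b.after j = m := by
        apply Fin.ext
        rw [after_val_of_lt (by simp only [j]; omega)]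
        simp only [j]
        omega
      have e2 := blockPat_link_after (b := b) hq (δ := δ) (ℓ := ℓ) (i := j) (by simp only [j]; omega)
      rw [hja] at e2
      refine e2.symm.trans ?_
      cases δ <;> exact hvert _ _
    · exact hvert i j
  exact (key x hx).trans (key y hy).symm

/-- The weight of an orbital in the potential that decreases when an electron moves towards the
beginning of its wire. -/
def siteWeight : Site b L → ℕ
  | .bond _ _ m => m.val
  | .vertex _ _ => 0

/-- All electrons can be moved to the beginnings of their wires. -/
theorem exists_carries_packed (n : ℕ) : ∀ {o : Site b L → Bool} (_ : VertOcc o)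
    (_ : (∑ z, if o z then siteWeight z else 0) = n),
    ∃ π : Equiv.Perm (Site b L), Carries o π ∧ o ∘ π = packedPat (bondCount o) := by
  induction n using Nat.strong_induction_on with
  | _ n ih =>
    intro o ho hn
    by_cases hex : ∃ (δ : Dir) (ℓ k : Fin L), (b.after k).val = k.val + 1 ∧
        o (.bond δ ℓ (b.before k)) = false ∧ o (.bond δ ℓ (b.after k)) = true
    · obtain ⟨δ, ℓ, k, hk, hk1, hk2⟩ := hex
      obtain ⟨σ, g1, g2, -⟩ := exists_carries_swap ho (δ := δ) (ℓ := ℓ) (k := k) (by simp [hk1, hk2])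
      have ho' : VertOcc (o ∘ σ) := by
        rw [g2]
        exact ho.comp_swap _ _ _ _ _ _
      have hlt : (∑ z, if (o ∘ σ) z then siteWeight z else 0) < n := by
        rw [← hn, g2, ← Equiv.sum_comp (Equiv.swap (.bond δ ℓ (b.before k) : Site b L)
          (.bond δ ℓ (b.after k)))]
        simp only [Function.comp, Equiv.swap_apply_self]
        refine Finset.sum_lt_sum (fun z _ => ?_) ⟨.bond δ ℓ (b.after k), Finset.mem_univ _, ?_⟩
        · by_cases h1 : z = .bond δ ℓ (b.before k)
          · simp [h1, hk1]
          by_cases h2 : z = .bond δ ℓ (b.after k)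
          · simp only [h2, Equiv.swap_apply_right, siteWeight, before_val, hk]
            split_ifs
            omega
          rw [Equiv.swap_apply_of_ne_of_ne h1 h2]
        · simp [hk2, siteWeight, before_val, hk]
      obtain ⟨π, h1, h2⟩ := ih _ hlt ho' rfl
      refine ⟨σ * π, g1.mul h1, ?_⟩
      have h3 : bondCount (o ∘ σ) = bondCount o := by rw [g2, bondCount_comp_swap]
      rw [← h3, ← h2]
      rfl
    · push Not at hex
      refine ⟨1, Carries.one o, ?_⟩
      funext z
      simp only [Equiv.Perm.coe_one, Function.comp, id]
      rcases z with ⟨δ, ℓ, m⟩ | ⟨i, j⟩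
      · have hdown : ∀ m m' : Fin (b.bonds L), m ≤ m' → o (.bond δ ℓ m') = true →
            o (.bond δ ℓ m) = true := by
          have hstep : ∀ (d : ℕ) (m m' : Fin (b.bonds L)), m.val + d = m'.val →
              o (.bond δ ℓ m') = true → o (.bond δ ℓ m) = true := by
            intro d
            induction d with
            | zero =>
              intro m m' h h'
              have : m = m' := Fin.ext (by omega)
              rwa [this]
            | succ d ihd =>
              intro m m' h h'
              have hm' := m'.isLt
              have hle : b.bonds L ≤ L + 1 := by cases b <;> simp [Boundary.bonds]
              let k : Fin L := ⟨m'.val - 1, by omega⟩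
              have hk : (b.after k).val = k.val + 1 := after_val_of_lt (by simp only [k]; omega)
              have hka : b.after k = m' := Fin.ext (by rw [hk]; simp only [k]; omega)
              refine ihd m (b.before k) (by rw [before_val]; simp only [k]; omega) ?_
              by_contra hf
              exact hex δ ℓ k hk (by simpa using hf) (by rw [hka, h'])
          intro m m' hmm
          exact hstep (m'.val - m.val) m m' (by rw [Fin.le_def] at hmm; omega)
        simp only [packedPat]
        set F := Finset.univ.filter (fun m => o (.bond δ ℓ m) = true) with hF
        have hcard : bondCount o δ ℓ = F.card := rfl
        rw [hcard]
        rcases h : o (.bond δ ℓ m) with _ | _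
        · symm
          rw [decide_eq_false_iff_not, not_lt]
          calc F.card ≤ (Finset.Iio m).card := by
                refine Finset.card_le_card fun m' hm' => ?_
                rw [Finset.mem_Iio]
                by_contra hcon
                have := hdown m m' (not_lt.1 hcon) (by simpa [hF] using hm')
                rw [h] at this
                cases this
            _ = m.val := Fin.card_Iio m
        · symm
          rw [decide_eq_true_eq]
          calc m.val < (Finset.Iic m).card := by rw [Fin.card_Iic]; omega
            _ ≤ F.card := by
                refine Finset.card_le_card fun m' hm' => ?_
                simpa [hF] using hdown m' m (Finset.mem_Iic.1 hm') h
      · exact ho i j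

theorem bondCount_blockPat {q : Charges L} (hq : ∀ δ ℓ, q δ ℓ < L) :
    bondCount (blockPat q : Site b L → Bool) = q := by
  funext δ ℓ
  have h1 := hq δ ℓ
  have h2 := le_bonds b L
  simp only [bondCount, blockPat, decide_eq_true_eq]
  rw [← Finset.card_map Fin.valEmbedding]
  have : Finset.map Fin.valEmbedding (Finset.univ.filter (fun m : Fin (b.bonds L) =>
      1 ≤ m.val ∧ m.val ≤ q δ ℓ)) = Finset.Icc 1 (q δ ℓ) := by
    ext a
    simp only [Finset.mem_map, Finset.mem_filter, Finset.mem_univ, true_and, Finset.mem_Icc,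
      Fin.valEmbedding_apply]
    constructor
    · rintro ⟨m, hm, rfl⟩
      exact hm
    · rintro h
      exact ⟨⟨a, by omega⟩, h, rfl⟩
  rw [this]
  simp

/-- The number of down spins. -/
def downs (c : Cfg b L) : ℕ := (Finset.univ.filter (fun x => c x = some .down)).card

theorem downs_comp (c : Cfg b L) (π : Equiv.Perm (Site b L)) : downs (c ∘ π) = downs c :=
  Finset.card_equiv π (by simp)

/-- If all occupied orbitals are linked, configurations that differ in their spins only are
connected. -/
theorem reach_of_linked {o : Site b L → Bool}
    (hl : ∀ x y, o x = true → o y = true → Linked o x y) (n : ℕ) :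
    ∀ {d d' : Cfg b L} (_ : pat d = o) (_ : pat d' = o) (_ : downs d = downs d')
      (_ : (Finset.univ.filter (fun x => d x ≠ d' x)).card = n), Reach d d' := by
  induction n using Nat.strong_induction_on with
  | _ n ih =>
    intro d d' hd hd' hdown hn
    by_cases heq : d = d'
    · rw [heq]
    have hsome : ∀ x, d x = none ↔ d' x = none := fun x => by
      rw [← pat_eq_false, ← pat_eq_false, hd, hd']
    have hdiff : ∀ {e e' : Cfg b L}, (∀ x, e x = none ↔ e' x = none) → downs e = downs e' →
        (∃ x, e x = some .down ∧ e' x ≠ some .down) → ∃ y, e y = some .up ∧ e' y = some .down := by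
      rintro e e' hs hdn ⟨x, hx, hx'⟩
      by_contra hcon
      push Not at hcon
      have hsub : Finset.univ.filter (fun x => e' x = some .down) ⊂
          Finset.univ.filter (fun x => e x = some .down) := by
        rw [Finset.ssubset_iff_of_subset]
        · exact ⟨x, by simp [hx], by simp [hx']⟩
        · intro y hy
          simp only [Finset.mem_filter, Finset.mem_univ, true_and] at hy ⊢
          rcases h : e y with _ | _ | _
          · rw [(hs y).1 h] at hy
            cases hy
          · exact absurd hy (hcon y h)
          · rfl
      exact absurd hdn (Finset.card_lt_card hsub).ne'
    obtain ⟨x, y, hx, hx', hy, hy'⟩ : ∃ x y, d x = some .down ∧ d' x = some .up ∧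
        d y = some .up ∧ d' y = some .down := by
      obtain ⟨z, hz⟩ := Function.ne_iff.1 heq
      rcases h1 : d z with _ | _ | _ <;> rcases h2 : d' z with _ | _ | _ <;>
        have h3 := hsome z <;> simp only [h1, h2] at h3 hz <;> simp at h3 hz
      · obtain ⟨x, hx, hx'⟩ := hdiff (fun x => (hsome x).symm) hdown.symm ⟨z, h2, by simp [h1]⟩
        exact ⟨x, z, hx', hx, h1, h2⟩
      · obtain ⟨y, hy, hy'⟩ := hdiff hsome hdown ⟨z, h1, by simp [h2]⟩
        exact ⟨z, y, h1, h2, hy, hy'⟩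
    have hox : o x = true := by rw [← hd, pat_eq_true, hx]; simp
    have hoy : o y = true := by rw [← hd, pat_eq_true, hy]; simp
    have hxy : x ≠ y := fun h => by rw [h, hy] at hx; simp at hx
    refine ((hl x y hox hoy).2.2 d hd).trans (ih _ ?_ ?_ hd' ?_ rfl)
    · rw [← hn]
      refine Finset.card_lt_card ((Finset.ssubset_iff_of_subset fun z hz => ?_).2 ⟨x, ?_, ?_⟩)
      · simp only [Finset.mem_filter, Finset.mem_univ, true_and, Function.comp] at hz ⊢
        by_cases h1 : z = x
        · rw [h1, Equiv.swap_apply_left, hy, hx'] at hz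
          simp at hz
        by_cases h2 : z = y
        · rw [h2, Equiv.swap_apply_right, hx, hy'] at hz
          simp at hz
        rwa [Equiv.swap_apply_of_ne_of_ne h1 h2] at hz
      · simp [hx, hx']
      · simp [hy, hx']
    · rw [pat_comp, hd, comp_swap_eq (hox.trans hoy.symm)]
    · rw [downs_comp, hdown]

/-- Any two configurations with the same admissible charges and the same number of down spins are
connected by hops. -/
theorem reach_of_charges_eq {q : Charges L} (hq : ∀ δ ℓ, 0 < q δ ℓ ∧ q δ ℓ < L) {c c' : Cfg b L}
    (hc : VertOcc (pat c)) (hc' : VertOcc (pat c')) (hcq : bondCount (pat c) = q)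
    (hcq' : bondCount (pat c') = q) (hd : downs c = downs c') : Reach c c' := by
  obtain ⟨π₀, h1, h2⟩ := exists_carries_packed _ (vertOcc_blockPat (b := b) q) rfl
  rw [bondCount_blockPat fun δ ℓ => (hq δ ℓ).2] at h2
  have key : ∀ {c : Cfg b L}, VertOcc (pat c) → bondCount (pat c) = q →
      ∃ d, Reach c d ∧ pat d = blockPat q ∧ downs d = downs c := by
    intro c hc hcq
    obtain ⟨π, g1, g2⟩ := exists_carries_packed _ hc rfl
    rw [hcq] at g2
    have h3 := h1.inv
    rw [h2, ← g2] at h3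
    refine ⟨c ∘ (π * π₀⁻¹ : Equiv.Perm (Site b L)), (g1.mul h3) c rfl, ?_, downs_comp _ _⟩
    rw [pat_comp]
    have : pat c ∘ (π * π₀⁻¹ : Equiv.Perm (Site b L)) = (pat c ∘ π) ∘ (π₀⁻¹ : Equiv.Perm (Site b L)) :=
      rfl
    rw [this, g2, ← h2]
    funext z
    simp
  obtain ⟨d, hd1, hd2, hd3⟩ := key hc hcq
  obtain ⟨d', hd1', hd2', hd3'⟩ := key hc' hcq'
  refine (hd1.trans ?_).trans hd1'.symm
  exact reach_of_linked (fun x y hx hy => blockPat_linked hq hx hy) _ hd2 hd2'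
    (by rw [hd3, hd3', hd]) rfl

/-! ### Free fermions on a wire -/

open Finset in
/-- The derivation property of the determinant: scaling the entries of one row by the diagonal
matrix `lam` and summing over the rows gives the trace of `lam`. -/
theorem sum_det_updateRow_mul {m : ℕ} (M : Matrix (Fin m) (Fin m) ℂ) (lam : Fin m → ℂ) :
    ∑ l, (M.updateRow l (fun j => lam j * M l j)).det = (∑ j, lam j) * M.det := by
  have h1 : ∀ (l : Fin m) (σ : Equiv.Perm (Fin m)),
      ∏ i, M.updateRow l (fun j => lam j * M l j) (σ i) i = lam (σ⁻¹ l) * ∏ i, M (σ i) i := by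
    intro l σ
    have h2 : ∀ i, M.updateRow l (fun j => lam j * M l j) (σ i) i =
        (if i = σ⁻¹ l then lam i else 1) * M (σ i) i := by
      intro i
      by_cases hi : i = σ⁻¹ l
      · subst hi
        simp
      · have : σ i ≠ l := fun h => hi (by rw [← h]; simp)
        rw [Matrix.updateRow_ne this, if_neg hi, one_mul]
    simp only [h2, prod_mul_distrib, prod_ite_eq', mem_univ, if_true]
  simp only [Matrix.det_apply', h1]
  rw [sum_comm, mul_sum]
  refine sum_congr rfl fun σ _ => ?_
  rw [← mul_sum, ← sum_mul, Equiv.sum_comp σ⁻¹ lam]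
  ring

/-- The wave function with the `(j + 1)`-st of the `m` lowest momenta, without the sign factor of
`orbital`, extended to all integers. -/
def waveFn : Boundary → (L m j : ℕ) → ℤ → ℂ
  | .obc, L, m, j, z => (Real.sin (momentum .obc L m (j + 1) * (z + 1)) : ℂ)
  | .pbc, L, m, j, z => Complex.exp (Complex.I * (momentum .pbc L m (j + 1) * z : ℝ))

theorem orbital_eq (b : Boundary) (L m j : ℕ) (i : Fin (b.bonds L)) :
    orbital b L m (j + 1) i = (-1) ^ i.val * waveFn b L m j i.val := by
  cases b <;> simp [orbital, waveFn]

/-- The wave functions are eigenfunctions of the hopping on the integers. -/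
theorem waveFn_add_waveFn (b : Boundary) (L m j : ℕ) (z : ℤ) :
    waveFn b L m j (z + 1) + waveFn b L m j (z - 1) =
      ((2 * Real.cos (momentum b L m (j + 1)) : ℝ) : ℂ) * waveFn b L m j z := by
  cases b
  · simp only [waveFn]
    norm_cast
    push_cast
    set k := momentum .obc L m (j + 1)
    rw [show k * ((z : ℝ) + 1 + 1) = k * (z + 1) + k by ring,
      show k * ((z : ℝ) - 1 + 1) = k * (z + 1) - k by ring, Real.sin_add, Real.sin_sub]
    ring
  · simp only [waveFn]
    set k := momentum .pbc L m (j + 1)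
    push_cast
    rw [show Complex.I * ((k : ℂ) * (z + 1)) = Complex.I * (k * z) + k * Complex.I by ring,
      show Complex.I * ((k : ℂ) * (z - 1)) = Complex.I * (k * z) + (-k) * Complex.I by ring,
      Complex.exp_add, Complex.exp_add, Complex.two_cos]
    ring

/-- The Slater determinant of the `m` lowest states at integer positions. -/
def slaterDet (b : Boundary) (L m : ℕ) (y : Fin m → ℤ) : ℂ :=
  (Matrix.of fun l j : Fin m => waveFn b L m j (y l)).det

theorem of_update (b : Boundary) (L m : ℕ) (y : Fin m → ℤ) (l : Fin m) (z : ℤ) :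
    (Matrix.of fun l' j : Fin m => waveFn b L m j (Function.update y l z l')) =
      (Matrix.of fun l' j : Fin m => waveFn b L m j (y l')).updateRow l
        (fun j => waveFn b L m j z) := by
  ext l' j
  by_cases h : l' = l
  · subst h
    simp
  · simp [h]

/-- Slater determinants are eigenfunctions of the free hopping of `m` particles on the integers. -/
theorem sum_slaterDet (b : Boundary) (L m : ℕ) (y : Fin m → ℤ) :
    ∑ l, (slaterDet b L m (Function.update y l (y l + 1)) +
        slaterDet b L m (Function.update y l (y l - 1))) =
      ((∑ j ∈ Finset.Icc 1 m, 2 * Real.cos (momentum b L m j) : ℝ) : ℂ) * slaterDet b L m y := by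
  have h1 := sum_det_updateRow_mul (Matrix.of fun l j : Fin m => waveFn b L m j (y l))
    (fun j => ((2 * Real.cos (momentum b L m (j + 1)) : ℝ) : ℂ))
  have h2 : ((∑ j ∈ Finset.Icc 1 m, 2 * Real.cos (momentum b L m j) : ℝ) : ℂ) =
      ∑ j : Fin m, ((2 * Real.cos (momentum b L m (j + 1)) : ℝ) : ℂ) := by
    rw [← Complex.ofReal_sum]
    congr 1
    rw [Fin.sum_univ_eq_sum_range (fun j => 2 * Real.cos (momentum b L m (j + 1))) m,
      show Finset.Icc 1 m = Finset.Ico 1 (m + 1) from rfl, Finset.sum_Ico_eq_sum_range]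
    simp [add_comm]
  rw [h2, slaterDet, ← h1]
  refine Finset.sum_congr rfl fun l _ => ?_
  simp only [slaterDet, of_update]
  rw [← Matrix.det_updateRow_add]
  congr 2
  funext j
  exact waveFn_add_waveFn b L m j (y l)

/-- Weakly increasing positions that span at most one period (PBC), or that lie between the two
sites next to the ends of the wire, where the wave functions vanish (OBC). -/
def WeaklyOrdered (b : Boundary) (L : ℕ) {m : ℕ} (y : Fin m → ℤ) : Prop :=
  (∀ i j, i < j → y i ≤ y j) ∧
    match b with
    | .obc => ∀ i, -1 ≤ y i ∧ y i ≤ L + 1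
    | .pbc => ∀ i j, i < j → y j - y i ≤ L

/-- Strictly increasing positions on a wire. -/
def StrictlyOrdered (b : Boundary) (L : ℕ) {m : ℕ} (y : Fin m → ℤ) : Prop :=
  (∀ i j, i < j → y i < y j) ∧ ∀ i, 0 ≤ y i ∧ y i < b.bonds L

/-- The Chebyshev polynomial `U j` has leading coefficient `2 ^ j`, so that this determinant is a
Vandermonde determinant up to a power of two. -/
theorem det_chebyshev {m : ℕ} (v : Fin m → ℂ) :
    (Matrix.of fun i j : Fin m => (Polynomial.Chebyshev.U ℂ (j : ℕ)).eval (v i)).det =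
      (∏ i, ∏ j ∈ Finset.Ioi i, (v j - v i)) * ∏ j : Fin m, 2 ^ (j : ℕ) := by
  have hp : ∀ j : Fin m, ((2 : ℂ) ^ (j : ℕ)) ≠ 0 := fun j => pow_ne_zero _ two_ne_zero
  have hdeg : ∀ j : Fin m, (Polynomial.C (((2 : ℂ) ^ (j : ℕ))⁻¹) *
      Polynomial.Chebyshev.U ℂ (j : ℕ)).natDegree = j := fun j => by
    rw [Polynomial.natDegree_C_mul (inv_ne_zero (hp j)), Polynomial.Chebyshev.natDegree_U_natCast]
  have hmon : ∀ j : Fin m, (Polynomial.C (((2 : ℂ) ^ (j : ℕ))⁻¹) *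
      Polynomial.Chebyshev.U ℂ (j : ℕ)).Monic := fun j => by
    rw [Polynomial.Monic, Polynomial.leadingCoeff_mul, Polynomial.leadingCoeff_C,
      Polynomial.Chebyshev.leadingCoeff_U_natCast, inv_mul_cancel₀ (hp j)]
  rw [← Matrix.det_vandermonde, Matrix.det_eval_matrixOfPolynomials_eq_det_vandermonde v _ hdeg hmon]
  simp only [Polynomial.eval_mul, Polynomial.eval_C]
  have h := Matrix.det_mul_row (fun j : Fin m => ((2 : ℂ) ^ (j : ℕ))⁻¹)
    (Matrix.of fun i j : Fin m => (Polynomial.Chebyshev.U ℂ (j : ℕ)).eval (v i))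
  simp only [Matrix.of_apply] at h
  rw [h, mul_comm, ← mul_assoc, ← Finset.prod_mul_distrib]
  simp

/-- Open wires: by the Chebyshev form of the wave functions, the Slater determinant is a
Vandermonde product in the variables `cos θ`. -/
theorem slaterDet_obc (L m : ℕ) (y : Fin m → ℤ) :
    slaterDet .obc L m y = (∏ i : Fin m, ∏ _j ∈ Finset.Ioi i, (-1 : ℂ)) *
      (((∏ i, Real.sin (Real.pi * (y i + 1) / (L + 2))) *
        ((∏ i, ∏ j ∈ Finset.Ioi i, (Real.cos (Real.pi * (y i + 1) / (L + 2)) -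
          Real.cos (Real.pi * (y j + 1) / (L + 2)))) * ∏ j : Fin m, 2 ^ (j : ℕ)) : ℝ) : ℂ) := by
  have h1 : (Matrix.of fun l j : Fin m => waveFn .obc L m j (y l)) =
      Matrix.of fun l j : Fin m => ((Real.sin (Real.pi * (y l + 1) / (L + 2)) : ℝ) : ℂ) *
        (Matrix.of fun i j : Fin m => (Polynomial.Chebyshev.U ℂ (j : ℕ)).eval
          ((Real.cos (Real.pi * (y i + 1) / (L + 2)) : ℝ) : ℂ)) l j := by
    ext l j
    simp only [Matrix.of_apply, waveFn, momentum]
    symm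
    rw [mul_comm, Complex.ofReal_sin, Complex.ofReal_cos, Polynomial.Chebyshev.U_complex_cos,
      Complex.ofReal_sin]
    push_cast
    congr 1
    ring
  rw [slaterDet, h1, Matrix.det_mul_column, det_chebyshev]
  push_cast
  have h2 : ∏ i, ∏ j ∈ Finset.Ioi i, (Complex.cos (Real.pi * (y j + 1) / (L + 2)) -
        Complex.cos (Real.pi * (y i + 1) / (L + 2))) =
      (∏ i : Fin m, ∏ _j ∈ Finset.Ioi i, (-1 : ℂ)) * ∏ i, ∏ j ∈ Finset.Ioi i,
        (Complex.cos (Real.pi * (y i + 1) / (L + 2)) - Complex.cos (Real.pi * (y j + 1) / (L + 2))) := by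
    rw [← Finset.prod_mul_distrib]
    refine Finset.prod_congr rfl fun i _ => ?_
    rw [← Finset.prod_mul_distrib]
    refine Finset.prod_congr rfl fun j _ => ?_
    ring
  rw [h2]
  ring

/-- Periodic wires: the momenta are equally spaced, so that the Slater determinant is a Vandermonde
determinant; as they are symmetric about zero, it is real up to a constant. -/
theorem slaterDet_pbc {L : ℕ} (m : ℕ) (y : Fin m → ℤ) :
    slaterDet .pbc L m y = (∏ i : Fin m, ∏ _j ∈ Finset.Ioi i, (2 * Complex.I)) *
      ((∏ i, ∏ j ∈ Finset.Ioi i, Real.sin (Real.pi * (y j - y i) / L) : ℝ) : ℂ) := by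
  set u : Fin m → ℂ := fun l => Complex.exp (Complex.I * (Real.pi * y l / L : ℝ)) with hu
  have hu0 : ∀ l, u l ≠ 0 := fun l => Complex.exp_ne_zero _
  have h1 : (Matrix.of fun l j : Fin m => waveFn .pbc L m j (y l)) =
      Matrix.of fun l j : Fin m => (u l * (u l ^ m)⁻¹) * Matrix.vandermonde (fun l => u l ^ 2) l j := by
    ext l j
    simp only [Matrix.of_apply, waveFn, momentum, Matrix.vandermonde_apply, hu]
    rw [← Complex.exp_nat_mul, ← Complex.exp_nat_mul, ← Complex.exp_nat_mul, ← Complex.exp_neg,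
      ← Complex.exp_add, ← Complex.exp_add]
    congr 1
    push_cast
    ring
  have h2 : ∏ l, (u l * (u l ^ m)⁻¹) = ∏ i, ∏ j ∈ Finset.Ioi i, (u i * u j)⁻¹ := by
    have h3 := Finset.prod_prod_Ioi_mul_eq_prod_prod_off_diag (fun _ i : Fin m => (u i)⁻¹)
    calc ∏ l, (u l * (u l ^ m)⁻¹) = ∏ i, ∏ j ∈ ({i}ᶜ : Finset (Fin m)), (u i)⁻¹ := by
          refine Finset.prod_congr rfl fun l _ => ?_
          rw [Finset.prod_const, Finset.card_compl, Finset.card_singleton, Fintype.card_fin]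
          obtain ⟨m', rfl⟩ : ∃ m', m = m' + 1 := ⟨m - 1, by have := l.pos; omega⟩
          rw [Nat.add_sub_cancel, pow_succ, mul_inv, inv_pow]
          field_simp [hu0 l]
      _ = _ := by
          rw [← h3]
          refine Finset.prod_congr rfl fun i _ => Finset.prod_congr rfl fun j _ => ?_
          rw [mul_inv]
  rw [slaterDet, h1, Matrix.det_mul_column, Matrix.det_vandermonde, h2]
  push_cast
  rw [← Finset.prod_mul_distrib, ← Finset.prod_mul_distrib]
  refine Finset.prod_congr rfl fun i _ => ?_
  rw [← Finset.prod_mul_distrib, ← Finset.prod_mul_distrib]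
  refine Finset.prod_congr rfl fun j _ => ?_
  have h4 : (2 * Complex.I) * Complex.sin (Real.pi * ((y j : ℂ) - y i) / L) =
      u j * (u i)⁻¹ - u i * (u j)⁻¹ := by
    simp only [hu]
    rw [← Complex.exp_neg, ← Complex.exp_neg, ← Complex.exp_add, ← Complex.exp_add, mul_assoc,
      mul_left_comm, Complex.two_sin, ← mul_assoc, mul_comm Complex.I, mul_assoc, Complex.I_mul_I]
    push_cast
    ring_nf
  rw [h4]
  field_simp [hu0 i, hu0 j]

/-- Up to a constant, the Slater determinant is nonnegative at weakly ordered positions and positive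
at strictly ordered ones. -/
theorem exists_slaterDet_sign (b : Boundary) {L : ℕ} (hL : 0 < L) (m : ℕ) :
    ∃ ζ : ℂ, ζ ≠ 0 ∧ ∃ r : (Fin m → ℤ) → ℝ, (∀ y, slaterDet b L m y = ζ * r y) ∧
      (∀ y, WeaklyOrdered b L y → 0 ≤ r y) ∧ ∀ y, StrictlyOrdered b L y → 0 < r y := by
  have hLr : (0 : ℝ) < L := by exact_mod_cast hL
  cases b
  · refine ⟨_, ?_, _, slaterDet_obc L m, ?_, ?_⟩
    · exact Finset.prod_ne_zero_iff.2 fun i _ => Finset.prod_ne_zero_iff.2 fun j _ => by simp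
    · rintro y ⟨h1, h2⟩
      have hθ : ∀ i, 0 ≤ Real.pi * ((y i : ℝ) + 1) / (L + 2) ∧
          Real.pi * ((y i : ℝ) + 1) / (L + 2) ≤ Real.pi := by
        intro i
        have h3 : (-1 : ℝ) ≤ y i := by exact_mod_cast (h2 i).1
        have h4 : (y i : ℝ) ≤ L + 1 := by exact_mod_cast (h2 i).2
        have h5 := Real.pi_pos
        constructor
        · apply div_nonneg <;> nlinarith
        · rw [div_le_iff₀ (by linarith)]
          nlinarith
      refine mul_nonneg (Finset.prod_nonneg fun i _ => Real.sin_nonneg_of_nonneg_of_le_pi (hθ i).1 (hθ i).2)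
        (mul_nonneg (Finset.prod_nonneg fun i _ => Finset.prod_nonneg fun j hj => ?_)
          (Finset.prod_nonneg fun j _ => by positivity))
      rw [sub_nonneg]
      apply Real.cos_le_cos_of_nonneg_of_le_pi (hθ i).1 (hθ j).2
      have h6 : (y i : ℝ) ≤ y j := by exact_mod_cast h1 i j (Finset.mem_Ioi.1 hj)
      have h5 := Real.pi_pos
      gcongr
    · rintro y ⟨h1, h2⟩
      have hθ : ∀ i, 0 < Real.pi * ((y i : ℝ) + 1) / (L + 2) ∧
          Real.pi * ((y i : ℝ) + 1) / (L + 2) < Real.pi := by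
        intro i
        have h3 : (0 : ℝ) ≤ y i := by exact_mod_cast (h2 i).1
        have h4 : (y i : ℝ) < L + 1 := by
          have := (h2 i).2
          simp only [Boundary.bonds] at this
          exact_mod_cast this
        have h5 := Real.pi_pos
        constructor
        · positivity
        · rw [div_lt_iff₀ (by linarith)]
          nlinarith
      refine mul_pos (Finset.prod_pos fun i _ => Real.sin_pos_of_pos_of_lt_pi (hθ i).1 (hθ i).2)
        (mul_pos (Finset.prod_pos fun i _ => Finset.prod_pos fun j hj => ?_)
          (Finset.prod_pos fun j _ => by positivity))
      rw [sub_pos]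
      apply Real.cos_lt_cos_of_nonneg_of_le_pi (hθ i).1.le (hθ j).2.le
      have h6 : (y i : ℝ) < y j := by exact_mod_cast h1 i j (Finset.mem_Ioi.1 hj)
      have h5 := Real.pi_pos
      gcongr
  · refine ⟨_, ?_, _, slaterDet_pbc m, ?_, ?_⟩
    · exact Finset.prod_ne_zero_iff.2 fun i _ => Finset.prod_ne_zero_iff.2 fun j _ => by simp
    · rintro y ⟨h1, h2⟩
      refine Finset.prod_nonneg fun i _ => Finset.prod_nonneg fun j hj => ?_
      have h3 : (y i : ℝ) ≤ y j := by exact_mod_cast h1 i j (Finset.mem_Ioi.1 hj)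
      have h4 : (y j : ℝ) - y i ≤ L := by exact_mod_cast h2 i j (Finset.mem_Ioi.1 hj)
      have h5 := Real.pi_pos
      apply Real.sin_nonneg_of_nonneg_of_le_pi
      · apply div_nonneg _ hLr.le
        nlinarith
      · rw [div_le_iff₀ hLr]
        nlinarith
    · rintro y ⟨h1, h2⟩
      refine Finset.prod_pos fun i _ => Finset.prod_pos fun j hj => ?_
      have h3 : (y i : ℝ) < y j := by exact_mod_cast h1 i j (Finset.mem_Ioi.1 hj)
      have h4 : (y j : ℝ) < L := by exact_mod_cast (h2 j).2
      have h6 : (0 : ℝ) ≤ y i := by exact_mod_cast (h2 i).1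
      have h5 := Real.pi_pos
      apply Real.sin_pos_of_pos_of_lt_pi
      · apply div_pos _ hLr
        nlinarith
      · rw [div_lt_iff₀ hLr]
        nlinarith

/-- The Slater determinant of the first `m` functions `φ` at the points of `X` in increasing order;
zero if `X` does not have `m` points. -/
def slater {n : ℕ} (φ : ℕ → Fin n → ℂ) (m : ℕ) (X : Finset (Fin n)) : ℂ :=
  if h : X.card = m then (Matrix.of fun l j : Fin m => φ j (X.orderEmbOfFin h l)).det else 0

/-- The modulus of the amplitude of the Fermi sea of a wire with `m` electrons. -/
def wireAmp (b : Boundary) (L m : ℕ) (X : Finset (Fin (b.bonds L))) : ℝ :=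
  ‖slater (fun j => orbital b L m (j + 1)) m X‖

/-- The sign factors of the orbitals can be taken out of the determinant. -/
theorem slater_orbital {m : ℕ} {X : Finset (Fin (b.bonds L))} (h : X.card = m) :
    slater (fun j => orbital b L m (j + 1)) m X =
      (∏ x ∈ X, (-1) ^ x.val) * slaterDet b L m (fun l => (X.orderEmbOfFin h l).val) := by
  rw [slater, dif_pos h]
  simp only [orbital_eq]
  have h1 := Matrix.det_mul_column (fun l : Fin m => ((-1 : ℂ)) ^ (X.orderEmbOfFin h l).val)
    (Matrix.of fun l j : Fin m => waveFn b L m j (X.orderEmbOfFin h l).val)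
  simp only [Matrix.of_apply] at h1
  rw [h1, slaterDet]
  congr 1
  conv_rhs => rw [← Finset.image_orderEmbOfFin_univ X h]
  rw [Finset.prod_image (fun _ _ _ _ e => (X.orderEmbOfFin h).injective e)]

theorem norm_prod_neg_one_pow (X : Finset (Fin (b.bonds L))) :
    ‖∏ x ∈ X, (-1 : ℂ) ^ x.val‖ = 1 := by
  rw [norm_prod]
  exact Finset.prod_eq_one fun x _ => by simp

theorem wireAmp_eq {m : ℕ} {X : Finset (Fin (b.bonds L))} (h : X.card = m) :
    wireAmp b L m X = ‖slaterDet b L m (fun l => (X.orderEmbOfFin h l).val)‖ := by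
  rw [wireAmp, slater_orbital h, norm_mul, norm_prod_neg_one_pow, one_mul]

/-- The modulus does not depend on the order of the points. -/
theorem norm_slaterDet_of_injective {m : ℕ} {X : Finset (Fin (b.bonds L))} (h : X.card = m)
    {y : Fin m → Fin (b.bonds L)} (hy : Function.Injective y) (hX : ∀ l, y l ∈ X) :
    ‖slaterDet b L m (fun l => (y l).val)‖ = wireAmp b L m X := by
  let f : Fin m → Fin m := fun l => (X.orderIsoOfFin h).symm ⟨y l, hX l⟩
  have hf : ∀ l, X.orderEmbOfFin h (f l) = y l := fun l => by
    rw [← Finset.coe_orderIsoOfFin_apply]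
    simp [f]
  have hinj : Function.Injective f := fun l l' e => hy (by rw [← hf l, ← hf l', e])
  let σ : Equiv.Perm (Fin m) := Equiv.ofBijective f (Finite.injective_iff_bijective.1 hinj)
  have h1 := Matrix.det_permute σ
    (Matrix.of fun l j : Fin m => waveFn b L m j ((X.orderEmbOfFin h l).val : ℕ))
  have h2 : (Matrix.of fun l j : Fin m => waveFn b L m j ((X.orderEmbOfFin h l).val : ℕ)).submatrix σ id =
      Matrix.of fun l j : Fin m => waveFn b L m j ((y l).val : ℕ) := by
    ext l j
    have h3 : X.orderEmbOfFin h (σ l) = y l := hf l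
    simp [h3]
  rw [h2] at h1
  rw [wireAmp_eq h, slaterDet, slaterDet, h1, norm_mul]
  rcases Int.units_eq_one_or (Equiv.Perm.sign σ) with h4 | h4 <;> simp [h4]

theorem strictlyOrdered_orderEmb {m : ℕ} {X : Finset (Fin (b.bonds L))} (h : X.card = m) :
    StrictlyOrdered b L (fun l => ((X.orderEmbOfFin h l).val : ℤ)) := by
  refine ⟨fun i j hij => ?_, fun i => ⟨by positivity, ?_⟩⟩
  · have := (X.orderEmbOfFin h).strictMono hij
    rw [Fin.lt_def] at this
    exact Int.ofNat_lt.2 this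
  · exact Int.ofNat_lt.2 (X.orderEmbOfFin h i).isLt

theorem wireAmp_pos (hL : 0 < L) {m : ℕ} {X : Finset (Fin (b.bonds L))} (h : X.card = m) :
    0 < wireAmp b L m X := by
  obtain ⟨ζ, hζ, r, h1, -, h3⟩ := exists_slaterDet_sign b hL m
  rw [wireAmp_eq h, h1, norm_mul]
  have := h3 _ (strictlyOrdered_orderEmb h)
  exact mul_pos (norm_pos_iff.2 hζ) (norm_pos_iff.2 (by exact_mod_cast this.ne'))

/-- The amplitude of the Fermi sea of a wire is, up to a constant, the gauge sign times its
modulus. -/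
theorem exists_slater_eq (b : Boundary) (hL : 0 < L) (m : ℕ) :
    ∃ ζ : ℂ, ζ ≠ 0 ∧ ∀ X : Finset (Fin (b.bonds L)), X.card = m →
      slater (fun j => orbital b L m (j + 1)) m X = ζ * ((∏ x ∈ X, (-1) ^ x.val) * wireAmp b L m X) := by
  obtain ⟨ζ, hζ, r, h1, -, h3⟩ := exists_slaterDet_sign b hL m
  have hn : (‖ζ‖ : ℂ) ≠ 0 := by simpa using hζ
  refine ⟨ζ / ‖ζ‖, div_ne_zero hζ hn, fun X h => ?_⟩
  rw [slater_orbital h, wireAmp_eq h, h1, norm_mul, Complex.norm_real, Real.norm_eq_abs,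
    abs_of_pos (h3 _ (strictlyOrdered_orderEmb h))]
  push_cast
  field_simp

theorem det_updateRow_smul_row {m : ℕ} (M : Matrix (Fin m) (Fin m) ℂ) {l l' : Fin m} (h : l' ≠ l)
    (ε : ℂ) : (M.updateRow l (ε • M l')).det = 0 := by
  rw [Matrix.det_updateRow_smul, Matrix.det_zero_of_row_eq h (by simp [Matrix.updateRow_ne h]), mul_zero]

/-- Moving one electron of a wire, to a position equivalent to the bond `x'`. -/
theorem norm_slaterDet_update {m : ℕ} {X : Finset (Fin (b.bonds L))} (h : X.card = m) (l : Fin m)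
    {z : ℤ} {x' : Fin (b.bonds L)} {ε : ℂ} (hε : ‖ε‖ = 1)
    (hz : ∀ j : Fin m, waveFn b L m j z = ε * waveFn b L m j x'.val) :
    ‖slaterDet b L m (Function.update (fun l => ((X.orderEmbOfFin h l).val : ℤ)) l z)‖ =
      if x' ∈ X.erase (X.orderEmbOfFin h l) then 0
      else wireAmp b L m (insert x' (X.erase (X.orderEmbOfFin h l))) := by
  have hrow : (fun j : Fin m => waveFn b L m j z) = ε • fun j : Fin m => waveFn b L m j x'.val := by
    funext j
    exact hz j
  rw [slaterDet, of_update, hrow]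
  split_ifs with hx
  · obtain ⟨hne, hmem⟩ := Finset.mem_erase.1 hx
    rw [← Finset.mem_coe, ← Finset.range_orderEmbOfFin X h] at hmem
    obtain ⟨l', rfl⟩ := hmem
    have hl : l' ≠ l := fun e => hne (by rw [e])
    have := det_updateRow_smul_row
      (Matrix.of fun l j : Fin m => waveFn b L m j ((X.orderEmbOfFin h l).val : ℕ)) hl ε
    rw [norm_eq_zero]
    exact this
  · rw [Matrix.det_updateRow_smul, norm_mul, hε, one_mul, ← of_update, ← slaterDet]
    have hmem := X.orderEmbOfFin_mem h l
    have hcard : (insert x' (X.erase (X.orderEmbOfFin h l))).card = m := by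
      rw [Finset.card_insert_of_notMem hx, Finset.card_erase_of_mem hmem, h]
      have := l.pos
      omega
    rw [← norm_slaterDet_of_injective hcard (y := Function.update (X.orderEmbOfFin h) l x')]
    · congr 2
      funext l'
      by_cases e : l' = l
      · subst e
        simp
      · simp [e]
    · intro i j hij
      have hne : ∀ i, i ≠ l → X.orderEmbOfFin h i ≠ x' := by
        rintro i hi rfl
        exact hx (Finset.mem_erase.2 ⟨fun e => hi ((X.orderEmbOfFin h).injective e),
          X.orderEmbOfFin_mem h i⟩)
      by_cases hi : i = l <;> by_cases hj : j = l
      · rw [hi, hj]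
      · rw [hi, Function.update_self, Function.update_of_ne hj] at hij
        exact absurd hij.symm (hne j hj)
      · rw [hj, Function.update_self, Function.update_of_ne hi] at hij
        exact absurd hij (hne i hi)
      · rw [Function.update_of_ne hi, Function.update_of_ne hj] at hij
        exact (X.orderEmbOfFin h).injective hij
    · intro i
      by_cases hi : i = l
      · rw [hi, Function.update_self]
        exact Finset.mem_insert_self _ _
      · rw [Function.update_of_ne hi]
        exact Finset.mem_insert_of_mem (Finset.mem_erase.2
          ⟨fun e => hi ((X.orderEmbOfFin h).injective e), X.orderEmbOfFin_mem h i⟩)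

/-- A translation by the length of a periodic wire multiplies all `m` wave functions by the same phase:
their momenta differ by multiples of `2 π / L`. -/
theorem waveFn_pbc_add {L : ℕ} (hL : 0 < L) (m : ℕ) :
    ∃ ε : ℂ, ‖ε‖ = 1 ∧ ∀ (j : ℕ) (z : ℤ), waveFn .pbc L m j (z + L) = ε * waveFn .pbc L m j z := by
  refine ⟨Complex.exp ((Real.pi * (1 - m) : ℝ) * Complex.I), Complex.norm_exp_ofReal_mul_I _,
    fun j z => ?_⟩
  have hL' : (L : ℂ) ≠ 0 := by exact_mod_cast hL.ne'
  simp only [waveFn, momentum]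
  rw [← Complex.exp_add, Complex.exp_eq_exp_iff_exists_int]
  refine ⟨j, ?_⟩
  push_cast
  field_simp
  ring

theorem waveFn_obc_neg_one (m j : ℕ) : waveFn .obc L m j (-1) = 0 := by
  simp [waveFn]

theorem waveFn_obc_end (m j : ℕ) : waveFn .obc L m j (L + 1) = 0 := by
  simp only [waveFn, momentum]
  have hL : (L : ℝ) + 2 ≠ 0 := by positivity
  rw [Complex.ofReal_eq_zero]
  push_cast
  rw [show Real.pi * ((j : ℝ) + 1) / (L + 2) * (L + 1 + 1) = (j + 1 : ℕ) * Real.pi by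
    push_cast
    field_simp
    ring]
  exact Real.sin_nat_mul_pi _

theorem slaterDet_update_eq_zero {m : ℕ} (y : Fin m → ℤ) (l : Fin m) {z : ℤ}
    (hz : ∀ j, waveFn b L m j z = 0) : slaterDet b L m (Function.update y l z) = 0 := by
  rw [slaterDet]
  refine Matrix.det_eq_zero_of_row_eq_zero l fun j => ?_
  simp [hz]

theorem before_injective : Function.Injective (b.before : Fin L → Fin (b.bonds L)) := by
  intro k k' h
  have := congrArg Fin.val h
  rw [before_val, before_val] at this
  exact Fin.ext this

theorem after_injective : Function.Injective (b.after : Fin L → Fin (b.bonds L)) := by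
  intro k k' h
  have h1 := congrArg Fin.val h
  rcases (val_add_one_le_bonds b k).lt_or_eq with h2 | h2 <;>
    rcases (val_add_one_le_bonds b k').lt_or_eq with h3 | h3
  · rw [after_val_of_lt h2, after_val_of_lt h3] at h1
    exact Fin.ext (by omega)
  · rw [after_val_of_lt h2, after_val_of_eq h3] at h1
    omega
  · rw [after_val_of_eq h2, after_val_of_lt h3] at h1
    omega
  · exact Fin.ext (by omega)

/-- The forward displacement of one electron, as a sum over the vertices it may pass. -/
theorem norm_slaterDet_forward (hL : 2 ≤ L) {m : ℕ} {X : Finset (Fin (b.bonds L))} (h : X.card = m)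
    (l : Fin m) :
    ‖slaterDet b L m (Function.update (fun l => ((X.orderEmbOfFin h l).val : ℤ)) l
        ((X.orderEmbOfFin h l).val + 1))‖ =
      ∑ k : Fin L, if X.orderEmbOfFin h l = b.before k then
        (if b.after k ∈ X then 0 else wireAmp b L m (insert (b.after k) (X.erase (b.before k)))) else 0 := by
  set x := X.orderEmbOfFin h l with hx
  have hxlt := x.isLt
  by_cases hxL : x.val < L
  · let k : Fin L := ⟨x.val, hxL⟩
    have hk : x = b.before k := Fin.ext (before_val k).symm
    rw [Finset.sum_eq_single k]
    · rw [if_pos hk]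
      obtain ⟨ε, hε, hz⟩ : ∃ ε : ℂ, ‖ε‖ = 1 ∧ ∀ j : Fin m,
          waveFn b L m j (x.val + 1) = ε * waveFn b L m j (b.after k).val := by
        rcases (val_add_one_le_bonds b k).lt_or_eq with h2 | h2
        · refine ⟨1, by simp, fun j => ?_⟩
          rw [after_val_of_lt h2, one_mul]
          simp [k]
        · cases b with
          | obc =>
            simp only [Boundary.bonds] at h2
            omega
          | pbc =>
            obtain ⟨ε, hε, hz⟩ := waveFn_pbc_add (L := L) (by omega) m
            refine ⟨ε, hε, fun j => ?_⟩
            rw [after_val_of_eq h2, ← hz]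
            congr 1
            simp only [Boundary.bonds, k] at h2
            push_cast
            omega
      rw [norm_slaterDet_update h l hε hz, ← hx, hk]
      have hne := before_ne_after hL k (b := b)
      simp [hne.symm]
    · intro k' _ hk'
      rw [if_neg]
      rw [hk]
      exact fun e => hk' (before_injective e).symm
    · simp
  · rw [Finset.sum_eq_zero]
    · rw [norm_eq_zero]
      cases b with
      | obc =>
        simp only [Boundary.bonds] at hxlt
        have : (x.val : ℤ) = L := by omega
        rw [this]
        exact slaterDet_update_eq_zero _ _ fun j => waveFn_obc_end m j
      | pbc => exact absurd hxlt hxL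
    · intro k _
      rw [if_neg]
      intro e
      have := congrArg Fin.val e
      rw [before_val] at this
      have := k.isLt
      omega

/-- The backward displacement of one electron, as a sum over the vertices it may pass. -/
theorem norm_slaterDet_backward (hL : 2 ≤ L) {m : ℕ} {X : Finset (Fin (b.bonds L))} (h : X.card = m)
    (l : Fin m) :
    ‖slaterDet b L m (Function.update (fun l => ((X.orderEmbOfFin h l).val : ℤ)) l
        ((X.orderEmbOfFin h l).val - 1))‖ =
      ∑ k : Fin L, if X.orderEmbOfFin h l = b.after k then
        (if b.before k ∈ X then 0 else wireAmp b L m (insert (b.before k) (X.erase (b.after k)))) else 0 := by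
  set x := X.orderEmbOfFin h l with hx
  have hxlt := x.isLt
  have main : ∀ k : Fin L, x = b.after k → (∃ ε : ℂ, ‖ε‖ = 1 ∧ ∀ j : Fin m,
      waveFn b L m j (x.val - 1) = ε * waveFn b L m j (b.before k).val) →
      ‖slaterDet b L m (Function.update (fun l => ((X.orderEmbOfFin h l).val : ℤ)) l (x.val - 1))‖ =
      ∑ k : Fin L, if x = b.after k then
        (if b.before k ∈ X then 0 else wireAmp b L m (insert (b.before k) (X.erase (b.after k)))) else 0 := by
    rintro k hk ⟨ε, hε, hz⟩
    rw [Finset.sum_eq_single k]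
    · rw [if_pos hk, norm_slaterDet_update h l hε hz, ← hx, hk]
      have hne := before_ne_after hL k (b := b)
      simp [hne]
    · intro k' _ hk'
      rw [if_neg]
      rw [hk]
      exact fun e => hk' (after_injective e).symm
    · simp
  have hle : b.bonds L ≤ L + 1 := by cases b <;> simp [Boundary.bonds]
  by_cases hx0 : x.val = 0
  · cases b with
    | obc =>
      rw [Finset.sum_eq_zero]
      · rw [norm_eq_zero, hx0]
        exact slaterDet_update_eq_zero _ _ fun j => waveFn_obc_neg_one m j
      · intro k _
        rw [if_neg]
        intro e
        have := congrArg Fin.val e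
        rw [after_val_of_lt (by simp [Boundary.bonds])] at this
        omega
    | pbc =>
      have h2 : (⟨L - 1, by omega⟩ : Fin L).val + 1 = Boundary.pbc.bonds L := by
        simp only [Boundary.bonds]
        omega
      refine main ⟨L - 1, by omega⟩ (Fin.ext ?_) ?_
      · rw [after_val_of_eq h2, hx0]
      · obtain ⟨ε, hε, hz⟩ := waveFn_pbc_add (L := L) (by omega) m
        have hε0 : ε ≠ 0 := fun e => by simp [e] at hε
        refine ⟨ε⁻¹, by simp [hε], fun j => ?_⟩
        rw [eq_inv_mul_iff_mul_eq₀ hε0, ← hz, before_val, hx0]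
        congr 1
        push_cast
        omega
  · refine main ⟨x.val - 1, by omega⟩ (Fin.ext ?_) ⟨1, by simp, fun j => ?_⟩
    · rw [after_val_of_lt (by simp only; omega)]
      simp only
      omega
    · rw [one_mul, before_val]
      congr 1
      simp only
      omega

/-- After a step of one electron the positions are still weakly ordered, so that the signs of the
Slater determinants do not spoil the positivity. -/
theorem weaklyOrdered_update {m : ℕ} {X : Finset (Fin (b.bonds L))} (h : X.card = m) (l : Fin m)
    {s : ℤ} (hs : s = 1 ∨ s = -1) :
    WeaklyOrdered b L (Function.update (fun l => ((X.orderEmbOfFin h l).val : ℤ)) l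
        ((X.orderEmbOfFin h l).val + s)) := by
  obtain ⟨h1, -⟩ := strictlyOrdered_orderEmb h
  simp only at h1
  refine ⟨fun i j hij => ?_, ?_⟩
  · have h3 := h1 i j hij
    by_cases hi : i = l <;> by_cases hj : j = l
    · rw [hi, hj]
    · subst hi
      rw [Function.update_self, Function.update_of_ne hj]
      omega
    · subst hj
      rw [Function.update_self, Function.update_of_ne hi]
      omega
    · rw [Function.update_of_ne hi, Function.update_of_ne hj]
      exact h3.le
  · cases b with
    | obc =>
      intro i
      have h3 : (X.orderEmbOfFin h i).val < L + 1 := (X.orderEmbOfFin h i).isLt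
      by_cases hi : i = l
      · subst hi
        rw [Function.update_self]
        omega
      · rw [Function.update_of_ne hi]
        omega
    | pbc =>
      intro i j hij
      have h3 : (X.orderEmbOfFin h i).val < L := (X.orderEmbOfFin h i).isLt
      have h4 : (X.orderEmbOfFin h j).val < L := (X.orderEmbOfFin h j).isLt
      have h5 := h1 i j hij
      by_cases hi : i = l <;> by_cases hj : j = l
      · rw [hi, hj]
        simp
      · subst hi
        rw [Function.update_self, Function.update_of_ne hj]
        omega
      · subst hj
        rw [Function.update_self, Function.update_of_ne hi]
        omega
      · rw [Function.update_of_ne hi, Function.update_of_ne hj]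
        omega

theorem sum_orderEmb_eq {n m : ℕ} {X : Finset (Fin n)} (h : X.card = m) (a : Fin n) (t : ℝ) :
    (∑ l, if X.orderEmbOfFin h l = a then t else 0) = if a ∈ X then t else 0 := by
  split_ifs with ha
  · rw [← Finset.mem_coe, ← Finset.range_orderEmbOfFin X h] at ha
    obtain ⟨l, rfl⟩ := ha
    rw [Finset.sum_eq_single l]
    · simp
    · intro l' _ hl'
      rw [if_neg fun e => hl' ((X.orderEmbOfFin h).injective e)]
    · simp
  · refine Finset.sum_eq_zero fun l _ => if_neg ?_
    rintro rfl
    exact ha (X.orderEmbOfFin_mem h l)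

/-- The moduli of the amplitudes of the Fermi sea form an eigenfunction of the hopping on a wire. -/
theorem sum_wireAmp_hop (hL : 2 ≤ L) {m : ℕ} {X : Finset (Fin (b.bonds L))} (h : X.card = m) :
    (∑ k : Fin L,
      ((if b.before k ∈ X ∧ b.after k ∉ X then
          wireAmp b L m (insert (b.after k) (X.erase (b.before k))) else 0) +
        if b.after k ∈ X ∧ b.before k ∉ X then
          wireAmp b L m (insert (b.before k) (X.erase (b.after k))) else 0)) =
      (∑ j ∈ Finset.Icc 1 m, 2 * Real.cos (momentum b L m j)) * wireAmp b L m X := by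
  obtain ⟨ζ, hζ, r, h1, h2, h3⟩ := exists_slaterDet_sign b (by omega : 0 < L) m
  set x : Fin m → ℤ := fun l => ((X.orderEmbOfFin h l).val : ℤ) with hx
  have hpos : ∀ y, WeaklyOrdered b L y → ‖slaterDet b L m y‖ = ‖ζ‖ * r y := fun y hy => by
    rw [h1, norm_mul, Complex.norm_real, Real.norm_eq_abs, abs_of_nonneg (h2 y hy)]
  have hsum := sum_slaterDet b L m x
  simp only [h1] at hsum
  have hr : ∑ l, (r (Function.update x l (x l + 1)) + r (Function.update x l (x l - 1))) =
      (∑ j ∈ Finset.Icc 1 m, 2 * Real.cos (momentum b L m j)) * r x := by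
    have h4 : ζ * ((∑ l, (r (Function.update x l (x l + 1)) + r (Function.update x l (x l - 1))) : ℝ) : ℂ)
        = ζ * (((∑ j ∈ Finset.Icc 1 m, 2 * Real.cos (momentum b L m j)) * r x : ℝ) : ℂ) := by
      rw [Complex.ofReal_mul, mul_left_comm ζ, ← hsum, Complex.ofReal_sum, Finset.mul_sum]
      refine Finset.sum_congr rfl fun l _ => ?_
      push_cast
      ring
    exact Complex.ofReal_injective (mul_left_cancel₀ hζ h4)
  have hAX : wireAmp b L m X = ‖ζ‖ * r x := by
    rw [wireAmp_eq h, h1, norm_mul, Complex.norm_real, Real.norm_eq_abs,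
      abs_of_pos (h3 _ (strictlyOrdered_orderEmb h))]
  rw [hAX, mul_left_comm, ← hr, Finset.mul_sum]
  have hl : ∀ l, ‖ζ‖ * (r (Function.update x l (x l + 1)) + r (Function.update x l (x l - 1))) =
      (∑ k : Fin L, if X.orderEmbOfFin h l = b.before k then
        (if b.after k ∈ X then 0 else wireAmp b L m (insert (b.after k) (X.erase (b.before k)))) else 0) +
      ∑ k : Fin L, if X.orderEmbOfFin h l = b.after k then
        (if b.before k ∈ X then 0 else wireAmp b L m (insert (b.before k) (X.erase (b.after k)))) else 0 := by
    intro l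
    rw [mul_add, ← hpos _ (weaklyOrdered_update h l (Or.inl rfl)), sub_eq_add_neg,
      ← hpos _ (weaklyOrdered_update h l (Or.inr rfl)), ← norm_slaterDet_forward hL h l,
      ← norm_slaterDet_backward hL h l]
    rfl
  simp only [hl]
  symm
  rw [Finset.sum_add_distrib, Finset.sum_comm, Finset.sum_comm (s := Finset.univ (α := Fin m)),
    ← Finset.sum_add_distrib]
  refine Finset.sum_congr rfl fun k _ => ?_
  rw [sum_orderEmb_eq, sum_orderEmb_eq]
  by_cases e1 : b.before k ∈ X <;> by_cases e2 : b.after k ∈ X <;> simp [e1, e2]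

/-! ### The positive eigenfunction of the hopping -/

theorem mem_wirePat {c : Cfg b L} {δ : Dir} {ℓ : Fin L} {k : Fin (b.bonds L)} :
    k ∈ wirePat c δ ℓ ↔ pat c (.bond δ ℓ k) = true := by
  simp [wirePat, pat_eq_true]

theorem bondCount_pat (c : Cfg b L) : bondCount (pat c) = lineCharges (modes c) := by
  funext δ ℓ
  rw [lineCharges_modes]
  simp only [bondCount, wirePat, pat_eq_true]

theorem pat_hop {h : Hop L} {c : Cfg b L} (hc : Allowed h c) :
    pat (c ∘ h.perm) = pat c ∘ Equiv.swap h.src h.dst :=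
  comp_hopPerm_eq (pat_eq_true.2 hc.1) (pat_eq_true.2 hc.2.1) h.over_ne_src h.over_ne_dst hc.src_ne_dst

theorem Allowed.vertOcc {h : Hop L} {c : Cfg b L} (hc : Allowed h c) (hv : VertOcc (pat c)) :
    VertOcc (pat (c ∘ h.perm)) := by
  rw [pat_hop hc]
  exact hv.comp_swap _ _ _ _ _ _

theorem Allowed.lineCharges {h : Hop L} {c : Cfg b L} (hc : Allowed h c) :
    lineCharges (modes (c ∘ h.perm)) = LiebLattice.lineCharges (modes c) := by
  rw [← bondCount_pat, ← bondCount_pat, pat_hop hc]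
  exact bondCount_comp_swap _ _ _ _ _

/-- A hop moves one electron along its own wire and leaves all other wires unchanged. -/
theorem wirePat_hop {c : Cfg b L} {δ : Dir} {ℓ k : Fin L} {s : Bool}
    (hc : Allowed (δ, ℓ, k, s) c) (δ' : Dir) (ℓ' : Fin L) :
    wirePat (c ∘ Hop.perm (δ, ℓ, k, s)) δ' ℓ' =
      if δ' = δ ∧ ℓ' = ℓ then
        insert (if s then b.after k else b.before k)
          ((wirePat c δ' ℓ').erase (if s then b.before k else b.after k))
      else wirePat c δ' ℓ' := by
  ext m
  rw [mem_wirePat, pat_hop hc]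
  have hs := pat_eq_true.2 hc.2.1
  have hd := pat_eq_false.2 hc.2.2
  have hne := hc.src_ne_dst
  simp only [Hop.src, Hop.dst] at hs hd hne ⊢
  generalize (if s then b.before k else b.after k) = p at *
  generalize (if s then b.after k else b.before k) = p' at *
  split_ifs with h
  · obtain ⟨rfl, rfl⟩ := h
    rw [Finset.mem_insert, Finset.mem_erase, mem_wirePat, Function.comp]
    simp only [ne_eq, Site.bond.injEq, true_and] at hne
    by_cases h1 : m = p
    · subst h1
      simp [hd, hne]
    by_cases h2 : m = p'
    · subst h2
      simp [hs]
    rw [Equiv.swap_apply_of_ne_of_ne (by simpa using h1) (by simpa using h2)]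
    simp [h1, h2]
  · rw [mem_wirePat, Function.comp, Equiv.swap_apply_of_ne_of_ne]
    · simp only [ne_eq, Site.bond.injEq]
      tauto
    · simp only [ne_eq, Site.bond.injEq]
      tauto

/-- The modulus of the amplitude of the Fermi sea, as a function of all configurations. -/
def seaAmp (c : Cfg b L) : ℝ :=
  ∏ w : Dir × Fin L, wireAmp b L (wirePat c w.1 w.2).card (wirePat c w.1 w.2)

theorem seaAmp_pos (hL : 0 < L) (c : Cfg b L) : 0 < seaAmp c :=
  Finset.prod_pos fun _ _ => wireAmp_pos hL rfl

theorem seaAmp_hop {c : Cfg b L} {δ : Dir} {ℓ k : Fin L} {s : Bool}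
    (hc : Allowed (δ, ℓ, k, s) c) :
    seaAmp (c ∘ Hop.perm (δ, ℓ, k, s)) =
      wireAmp b L (wirePat c δ ℓ).card (insert (if s then b.after k else b.before k)
          ((wirePat c δ ℓ).erase (if s then b.before k else b.after k))) *
        ∏ w ∈ Finset.univ.erase (δ, ℓ), wireAmp b L (wirePat c w.1 w.2).card (wirePat c w.1 w.2) := by
  have hcard : ∀ δ' ℓ', (wirePat (c ∘ Hop.perm (δ, ℓ, k, s)) δ' ℓ').card = (wirePat c δ' ℓ').card := by
    intro δ' ℓ'
    rw [← lineCharges_modes, hc.lineCharges, lineCharges_modes]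
  unfold seaAmp
  rw [← Finset.mul_prod_erase _ _ (Finset.mem_univ (δ, ℓ))]
  simp only [hcard]
  congr 1
  · rw [wirePat_hop hc, if_pos ⟨rfl, rfl⟩]
  · refine Finset.prod_congr rfl fun w hw => ?_
    rw [wirePat_hop hc, if_neg]
    rintro ⟨h1, h2⟩
    exact (Finset.mem_erase.1 hw).1 (Prod.ext h1 h2)

/-- The eigenvalue of the hopping on the Fermi sea with charges `Q`. -/
def seaEigenvalue (b : Boundary) {L : ℕ} (Q : Charges L) : ℝ :=
  ∑ δ, ∑ ℓ, ∑ j ∈ Finset.Icc 1 (Q δ ℓ), 2 * Real.cos (momentum b L (Q δ ℓ) j)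

theorem sum_wireEnergy (t : ℝ) (Q : Charges L) :
    ∑ δ, ∑ ℓ, wireEnergy b L t (Q δ ℓ) = -t * seaEigenvalue b Q := by
  simp only [seaEigenvalue, wireEnergy, Finset.mul_sum]
  refine Finset.sum_congr rfl fun δ _ => Finset.sum_congr rfl fun ℓ _ =>
    Finset.sum_congr rfl fun j _ => ?_
  ring

/-- The positive amplitudes form an eigenfunction of the hopping: the wires move independently. -/
theorem sum_seaAmp_hop (hL : 2 ≤ L) {c : Cfg b L} (hv : VertOcc (pat c)) :
    (∑ h : Hop L, if Allowed h c then seaAmp (c ∘ h.perm) else 0) =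
      seaEigenvalue b (lineCharges (modes c)) * seaAmp c := by
  simp only [Fintype.sum_prod_type, seaEigenvalue, Finset.sum_mul, lineCharges_modes]
  refine Finset.sum_congr rfl fun δ _ => Finset.sum_congr rfl fun ℓ _ => ?_
  rw [← Finset.sum_mul, seaAmp, ← Finset.mul_prod_erase _ _ (Finset.mem_univ (δ, ℓ)), ← mul_assoc,
    ← sum_wireAmp_hop hL rfl, Finset.sum_mul]
  refine Finset.sum_congr rfl fun k _ => ?_
  have hvk : c (vert δ ℓ k) ≠ none := pat_eq_true.1 (hv.vert δ ℓ k)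
  have key : ∀ s : Bool, (if Allowed (δ, ℓ, k, s) c then seaAmp (c ∘ Hop.perm (δ, ℓ, k, s)) else 0) =
      (if (if s then b.before k else b.after k) ∈ wirePat c δ ℓ ∧
          (if s then b.after k else b.before k) ∉ wirePat c δ ℓ then
        wireAmp b L (wirePat c δ ℓ).card (insert (if s then b.after k else b.before k)
          ((wirePat c δ ℓ).erase (if s then b.before k else b.after k))) else 0) *
        ∏ w ∈ Finset.univ.erase (δ, ℓ), wireAmp b L (wirePat c w.1 w.2).card (wirePat c w.1 w.2) := by
    intro s
    have hiff : Allowed (δ, ℓ, k, s) c ↔ ((if s then b.before k else b.after k) ∈ wirePat c δ ℓ ∧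
          (if s then b.after k else b.before k) ∉ wirePat c δ ℓ) := by
      simp [Allowed, Hop.over, Hop.src, Hop.dst, hvk, wirePat]
    by_cases h : Allowed (δ, ℓ, k, s) c
    · rw [if_pos h, if_pos (hiff.1 h), seaAmp_hop h]
    · rw [if_neg h, if_neg (fun e => h (hiff.2 e)), zero_mul]
  rw [Fintype.sum_bool, key, key, ← add_mul]
  simp

/-! ### Amplitudes of the Fermi sea -/

section Fill

variable {α : Type} [LinearOrder α] {n : ℕ}

/-- Creation of one fermion in each of the first `m` states `φ j` of the modes `a i`. -/
def fill (a : Fin n → α) (φ : ℕ → Fin n → ℂ) (m : ℕ) : Module.End ℂ (Fock α) :=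
  ((List.range m).map (fun j => ∑ i, φ j i • create (a i))).prod

/-- The indices of the occupied modes among the `a i`. -/
def occIdx (a : Fin n → α) (S : Finset α) : Finset (Fin n) :=
  Finset.univ.filter (fun i => a i ∈ S)

theorem mem_occIdx {a : Fin n → α} {S : Finset α} {i : Fin n} : i ∈ occIdx a S ↔ a i ∈ S := by
  simp [occIdx]

theorem card_filter_lt_orderEmb {m : ℕ} {X : Finset (Fin n)} (h : X.card = m) (l : Fin m) :
    (X.filter (fun i => i < X.orderEmbOfFin h l)).card = l.val := by
  have : X.filter (fun i => i < X.orderEmbOfFin h l) =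
      (Finset.Iio l).map (X.orderEmbOfFin h).toEmbedding := by
    ext i
    simp only [Finset.mem_filter, Finset.mem_map, Finset.mem_Iio, RelEmbedding.coe_toEmbedding]
    constructor
    · rintro ⟨h1, h2⟩
      rw [← Finset.mem_coe, ← Finset.range_orderEmbOfFin X h] at h1
      obtain ⟨l', rfl⟩ := h1
      exact ⟨l', (X.orderEmbOfFin h).lt_iff_lt.1 h2, rfl⟩
    · rintro ⟨l', h1, rfl⟩
      exact ⟨X.orderEmbOfFin_mem h l', (X.orderEmbOfFin h).lt_iff_lt.2 h1⟩
  rw [this, Finset.card_map, Fin.card_Iio]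

/-- Laplace expansion of a Slater determinant along its first orbital. -/
theorem slater_succ (φ : ℕ → Fin n → ℂ) (m : ℕ) (X : Finset (Fin n)) :
    slater φ (m + 1) X = ∑ i ∈ X, φ 0 i * ((-1) ^ (X.filter (fun i' => i' < i)).card *
      slater (fun j => φ (j + 1)) m (X.erase i)) := by
  by_cases h : X.card = m + 1
  · rw [slater, dif_pos h, Matrix.det_succ_column_zero]
    conv_rhs => rw [← Finset.image_orderEmbOfFin_univ X h]
    rw [Finset.sum_image (fun _ _ _ _ e => (X.orderEmbOfFin h).injective e)]
    refine Finset.sum_congr rfl fun l _ => ?_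
    rw [Finset.image_orderEmbOfFin_univ X h, card_filter_lt_orderEmb h l]
    have hmem := X.orderEmbOfFin_mem h l
    have hcard : (X.erase (X.orderEmbOfFin h l)).card = m := by
      rw [Finset.card_erase_of_mem hmem, h, Nat.add_sub_cancel]
    have hfun : (fun l' => X.orderEmbOfFin h (l.succAbove l')) =
        (X.erase (X.orderEmbOfFin h l)).orderEmbOfFin hcard :=
      Finset.orderEmbOfFin_unique hcard
        (fun l' => Finset.mem_erase.2 ⟨fun e => Fin.succAbove_ne l l'
          ((X.orderEmbOfFin h).injective e), X.orderEmbOfFin_mem h _⟩)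
        ((X.orderEmbOfFin h).strictMono.comp (Fin.strictMono_succAbove l))
    rw [slater, dif_pos hcard, ← hfun]
    simp only [Matrix.of_apply, Fin.val_zero, Matrix.submatrix]
    rw [mul_left_comm, mul_assoc]
    rfl
  · rw [slater, dif_neg h, Finset.sum_eq_zero]
    intro i hi
    rw [slater, dif_neg, mul_zero, mul_zero]
    rw [Finset.card_erase_of_mem hi]
    have := Finset.card_pos.2 ⟨i, hi⟩
    omega

/-- Filling modes that lie below all occupied ones multiplies the amplitudes by a Slater
determinant. -/
theorem fill_apply {a : Fin n → α} (ha : StrictMono a) {f : Fock α}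
    (hf : ∀ S, f S ≠ 0 → ∀ x ∈ S, ∀ i, a i < x) (m : ℕ) : ∀ (φ : ℕ → Fin n → ℂ) (S : Finset α),
    fill a φ m f S = slater φ m (occIdx a S) * f (S \ Finset.univ.image a) := by
  induction m with
  | zero =>
    intro φ S
    simp only [fill, List.range_zero, List.map_nil, List.prod_nil, Module.End.one_apply]
    by_cases h : (occIdx a S).card = 0
    · rw [slater, dif_pos h, Matrix.det_isEmpty, one_mul]
      congr 1
      rw [eq_comm, Finset.sdiff_eq_self_iff_disjoint, Finset.disjoint_right]
      rw [Finset.card_eq_zero] at h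
      intro x hx hS
      obtain ⟨i, -, rfl⟩ := Finset.mem_image.1 hx
      have := mem_occIdx.2 hS
      simp [h] at this
    · rw [slater, dif_neg h, zero_mul]
      by_contra h1
      obtain ⟨i, hi⟩ := Finset.card_pos.1 (Nat.pos_of_ne_zero h)
      exact lt_irrefl _ (hf S h1 _ (mem_occIdx.1 hi) i)
  | succ m ih =>
    intro φ S
    have h0 : fill a φ (m + 1) = (∑ i, φ 0 i • create (a i)) * fill a (fun j => φ (j + 1)) m := by
      simp [fill, List.range_succ_eq_map, Function.comp_def]
    rw [h0, Module.End.mul_apply, LinearMap.sum_apply, Finset.sum_apply, slater_succ, Finset.sum_mul,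
      occIdx, Finset.sum_filter]
    refine Finset.sum_congr rfl fun i _ => ?_
    simp only [LinearMap.smul_apply, Pi.smul_apply, smul_eq_mul, create, LinearMap.coe_mk,
      AddHom.coe_mk]
    split_ifs with hi
    · rw [ih]
      have h1 : occIdx a (S.erase (a i)) = (Finset.univ.filter (fun i => a i ∈ S)).erase i := by
        ext i'
        simp [mem_occIdx, ha.injective.eq_iff]
      have h2 : S.erase (a i) \ Finset.univ.image a = S \ Finset.univ.image a := by
        ext x
        simp only [Finset.mem_sdiff, Finset.mem_erase, Finset.mem_image, Finset.mem_univ, true_and]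
        constructor
        · tauto
        · rintro ⟨h3, h4⟩
          exact ⟨⟨fun e => h4 ⟨i, e.symm⟩, h3⟩, h4⟩
      rw [h1, h2]
      by_cases hS : f (S \ Finset.univ.image a) = 0
      · simp [hS]
      · have h3 : jwSign (a i) S =
            (-1) ^ ((Finset.univ.filter (fun i => a i ∈ S)).filter (fun i' => i' < i)).card := by
          unfold jwSign
          congr 1
          symm
          refine Finset.card_bij (fun i' _ => a i') ?_ (fun _ _ _ _ e => ha.injective e) ?_
          · intro i' hi'
            simp only [Finset.mem_filter, Finset.mem_univ, true_and] at hi' ⊢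
            exact ⟨hi'.1, ha hi'.2⟩
          · intro x hx
            rw [Finset.mem_filter] at hx
            by_cases hxa : x ∈ Finset.univ.image a
            · obtain ⟨i', -, rfl⟩ := Finset.mem_image.1 hxa
              exact ⟨i', by simpa using ⟨hx.1, ha.lt_iff_lt.1 hx.2⟩, rfl⟩
            · exact absurd hx.2 (hf _ hS x (Finset.mem_sdiff.2 ⟨hx.1, hxa⟩) i).not_gt
        rw [h3]
        ring
    · simp

/-- Filling several groups of modes, each group lying below the next ones. -/
theorem prod_fill_apply {ι : Type} {a : ι → Fin n → α} {φ : ι → ℕ → Fin n → ℂ} {m : ι → ℕ}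
    {f : Fock α} : ∀ {ws : List ι} (_ : ∀ w ∈ ws, StrictMono (a w))
    (_ : ws.Pairwise (fun w w' => ∀ i j, a w i < a w' j))
    (_ : ∀ S, f S ≠ 0 → ∀ x ∈ S, ∀ w ∈ ws, ∀ i, a w i < x) (S : Finset α) (T : Finset α)
    (_ : ∀ x, x ∈ T ↔ x ∈ S ∧ ∀ w ∈ ws, ∀ i, x ≠ a w i),
    (ws.map (fun w => fill (a w) (φ w) (m w))).prod f S =
      (ws.map (fun w => slater (φ w) (m w) (occIdx (a w) S))).prod * f T := by
  intro ws
  induction ws with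
  | nil =>
    intro _ _ _ S T hT
    have : T = S := by
      ext x
      simp [hT]
    simp [this]
  | cons w ws ih =>
    intro ha hp hf S T hT
    rw [List.pairwise_cons] at hp
    have ih' := @ih (fun w' hw' => ha w' (List.mem_cons_of_mem _ hw')) hp.2
      (fun S hS x hx w' hw' => hf S hS x hx w' (List.mem_cons_of_mem _ hw'))
    classical
    rw [List.map_cons, List.prod_cons, Module.End.mul_apply, fill_apply (ha w List.mem_cons_self)]
    · rw [ih' _ T, List.map_cons, List.prod_cons, mul_assoc]
      · congr 3
        refine List.map_congr_left fun w' hw' => ?_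
        congr 1
        ext i
        rw [mem_occIdx, mem_occIdx, Finset.mem_sdiff, and_iff_left]
        intro h
        obtain ⟨i', -, h'⟩ := Finset.mem_image.1 h
        exact (hp.1 w' hw' i' i).ne h'
      · intro x
        rw [hT, Finset.mem_sdiff, List.forall_mem_cons, Finset.mem_image, and_assoc]
        simp only [Finset.mem_univ, true_and, not_exists, ne_eq, eq_comm (a := x)]
    · intro S hS x hx i
      rw [ih' S (S.filter (fun x => ∀ w ∈ ws, ∀ i, x ≠ a w i)) (by simp)] at hS
      by_cases hxw : ∀ w ∈ ws, ∀ i, x ≠ a w i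
      · exact hf _ (right_ne_zero_of_mul hS) x (Finset.mem_filter.2 ⟨hx, hxw⟩) w List.mem_cons_self i
      · push Not at hxw
        obtain ⟨w', hw', j, rfl⟩ := hxw
        exact hp.1 w' hw' i j

/-- Creation of fermions on modes in increasing order gives a basis state. -/
theorem prod_create_vacuum : ∀ {xs : List α} (_ : xs.Pairwise (· < ·)) (S : Finset α),
    (xs.map create).prod vacuum S = if S = xs.toFinset then 1 else 0 := by
  intro xs
  induction xs with
  | nil =>
    intro _ S
    simp only [List.map_nil, List.prod_nil, Module.End.one_apply, vacuum, List.toFinset_nil]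
    congr
  | cons x xs ih =>
    intro hp S
    rw [List.pairwise_cons] at hp
    rw [List.map_cons, List.prod_cons, Module.End.mul_apply]
    simp only [create, LinearMap.coe_mk, AddHom.coe_mk]
    rw [ih hp.2]
    have hx : x ∉ xs.toFinset := by
      rw [List.mem_toFinset]
      exact fun h => lt_irrefl _ (hp.1 x h)
    rw [List.toFinset_cons]
    by_cases h : x ∈ S
    · rw [if_pos h]
      by_cases h1 : S.erase x = xs.toFinset
      · rw [if_pos h1, if_pos (by rw [← h1, Finset.insert_erase h]), jwSign,
          Finset.card_eq_zero.2, pow_zero, one_mul]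
        rw [Finset.filter_eq_empty_iff]
        intro y hy hyx
        have : y ∈ S.erase x := Finset.mem_erase.2 ⟨hyx.ne, hy⟩
        rw [h1, List.mem_toFinset] at this
        exact lt_asymm hyx (hp.1 y this)
      · rw [if_neg h1, if_neg, mul_zero]
        rintro rfl
        exact h1 (Finset.erase_insert hx)
    · rw [if_neg h, if_neg]
      rintro rfl
      exact h (Finset.mem_insert_self _ _)

end Fill

/-- The up-spin modes on the bonds of a wire. -/
def wireMode (w : Dir × Fin L) (i : Fin (b.bonds L)) : Mode b L := ⟨.bond w.1 w.2 i, .up⟩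

/-- The wires in the order of their modes. -/
def wires (L : ℕ) : List (Dir × Fin L) :=
  (List.finRange L).map (fun ℓ => (.x, ℓ)) ++ (List.finRange L).map (fun ℓ => (.y, ℓ))

/-- The up-spin modes on the vertices in increasing order. -/
def vertexModes (b : Boundary) (L : ℕ) : List (Mode b L) :=
  (List.finRange L).flatMap (fun i => (List.finRange L).map (fun j => ⟨.vertex i j, .up⟩))

theorem mem_wires (w : Dir × Fin L) : w ∈ wires L := by
  obtain ⟨δ, ℓ⟩ := w
  cases δ <;> simp [wires]

theorem mem_vertexModes {x : Mode b L} : x ∈ vertexModes b L ↔ ∃ i j, x = ⟨.vertex i j, .up⟩ := by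
  simp [vertexModes, eq_comm]

theorem prod_wires {M : Type*} [CommMonoid M] (g : Dir × Fin L → M) :
    ((wires L).map g).prod = ∏ w, g w := by
  rw [wires, List.map_append, List.prod_append, List.map_map, List.map_map, ← List.ofFn_eq_map,
    ← List.ofFn_eq_map, List.prod_ofFn, List.prod_ofFn, Fintype.prod_prod_type,
    show (Finset.univ : Finset Dir) = {.x, .y} from rfl, Finset.prod_pair (by simp)]
  rfl

theorem wires_pairwise :
    (wires L).Pairwise (fun w w' => ∀ i j, (wireMode w i : Mode b L) < wireMode w' j) := by
  rw [wires, List.pairwise_append, List.pairwise_map, List.pairwise_map]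
  refine ⟨(List.pairwise_lt_finRange L).imp ?_, (List.pairwise_lt_finRange L).imp ?_, ?_⟩
  · intro ℓ ℓ' h i j
    rw [mode_lt_iff_key]
    simp [wireMode, Mode.key, Prod.Lex.toLex_lt_toLex, Fin.lt_def.1 h]
  · intro ℓ ℓ' h i j
    rw [mode_lt_iff_key]
    simp [wireMode, Mode.key, Prod.Lex.toLex_lt_toLex, Fin.lt_def.1 h]
  · intro w hw w' hw' i j
    obtain ⟨ℓ, -, rfl⟩ := List.mem_map.1 hw
    obtain ⟨ℓ', -, rfl⟩ := List.mem_map.1 hw'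
    rw [mode_lt_iff_key]
    simp [wireMode, Mode.key, Prod.Lex.toLex_lt_toLex]

theorem vertexModes_pairwise : (vertexModes b L).Pairwise (· < ·) := by
  rw [vertexModes, List.pairwise_flatMap]
  refine ⟨fun i _ => ?_, (List.pairwise_lt_finRange L).imp ?_⟩
  · rw [List.pairwise_map]
    refine (List.pairwise_lt_finRange L).imp fun h => ?_
    rw [mode_lt_iff_key]
    simp [Mode.key, Prod.Lex.toLex_lt_toLex, Fin.lt_def.1 h]
  · intro i i' h x hx y hy
    obtain ⟨j, -, rfl⟩ := List.mem_map.1 hx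
    obtain ⟨j', -, rfl⟩ := List.mem_map.1 hy
    rw [mode_lt_iff_key]
    simp [Mode.key, Prod.Lex.toLex_lt_toLex, Fin.lt_def.1 h]

theorem fermiSea_eq (b : Boundary) (Q : Charges L) :
    fermiSea b Q = ((wires L).map (fun w => fill (wireMode w)
      (fun j => orbital b L (Q w.1 w.2) (j + 1)) (Q w.1 w.2))).prod
        (((vertexModes b L).map create).prod vacuum) := by
  rw [wires, List.map_append, List.prod_append, List.map_map, List.map_map, vertexModes,
    List.map_flatMap]
  simp only [List.map_map]
  rfl

theorem strictMono_wireMode (w : Dir × Fin L) :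
    StrictMono (wireMode w : Fin (b.bonds L) → Mode b L) := fun _ _ h => (bond_lt_bond _ _ _ _).2 h

/-- The amplitudes of the Fermi sea are products of Slater determinants. -/
theorem fermiSea_apply (Q : Charges L) (S : Finset (Mode b L)) :
    fermiSea b Q S = (∏ w : Dir × Fin L, slater (fun j => orbital b L (Q w.1 w.2) (j + 1)) (Q w.1 w.2)
        (occIdx (wireMode w) S)) *
      if S.filter (fun x => ∀ w i, x ≠ wireMode w i) = (vertexModes b L).toFinset then 1 else 0 := by
  rw [fermiSea_eq, prod_fill_apply (T := S.filter (fun x => ∀ w i, x ≠ wireMode w i)), prod_wires,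
    prod_create_vacuum vertexModes_pairwise]
  · exact fun w _ => strictMono_wireMode w
  · exact wires_pairwise
  · intro T hT x hx w _ i
    rw [prod_create_vacuum vertexModes_pairwise] at hT
    split_ifs at hT with h
    · rw [h, List.mem_toFinset, mem_vertexModes] at hx
      obtain ⟨i', j', rfl⟩ := hx
      exact bond_lt_vertex _ _ _ _ _
    · exact absurd rfl hT
  · intro x
    simp [mem_wires]

theorem filter_modes_eq_vertexModes_iff {S : Finset (Mode b L)} :
    S.filter (fun x => ∀ w i, x ≠ wireMode w i) = (vertexModes b L).toFinset ↔
      (∀ x ∈ S, x.spin = .up) ∧ ∀ i j, (⟨.vertex i j, .up⟩ : Mode b L) ∈ S := by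
  constructor
  · intro h
    refine ⟨?_, fun i j => ?_⟩
    · intro x hx
      by_cases hw : ∀ w i, x ≠ wireMode w i
      · have : x ∈ S.filter (fun x => ∀ w i, x ≠ wireMode w i) := Finset.mem_filter.2 ⟨hx, hw⟩
        rw [h, List.mem_toFinset, mem_vertexModes] at this
        obtain ⟨i, j, rfl⟩ := this
        rfl
      · push Not at hw
        obtain ⟨w, i, rfl⟩ := hw
        rfl
    · have : (⟨.vertex i j, .up⟩ : Mode b L) ∈ (vertexModes b L).toFinset :=
        List.mem_toFinset.2 (mem_vertexModes.2 ⟨i, j, rfl⟩)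
      rw [← h] at this
      exact (Finset.mem_filter.1 this).1
  · rintro ⟨h1, h2⟩
    ext ⟨x, σ⟩
    rw [List.mem_toFinset, mem_vertexModes, Finset.mem_filter]
    constructor
    · rintro ⟨h3, h4⟩
      have h5 : σ = .up := h1 _ h3
      subst h5
      rcases x with ⟨δ, ℓ, k⟩ | ⟨i, j⟩
      · exact absurd rfl (h4 (δ, ℓ) k)
      · exact ⟨i, j, rfl⟩
    · rintro ⟨i, j, h⟩
      rw [h]
      exact ⟨h2 i j, fun w k => by simp [wireMode]⟩

theorem spin_up_iff {c : Cfg b L} : (∀ x ∈ modes c, x.spin = .up) ↔ downs c = 0 := by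
  rw [downs, Finset.card_eq_zero, Finset.filter_eq_empty_iff]
  constructor
  · intro h x _ hx
    simpa using h ⟨x, .down⟩ (by simpa using hx)
  · rintro h ⟨x, σ⟩ hx
    rw [mem_modes] at hx
    cases σ
    · rfl
    · exact absurd hx (h (Finset.mem_univ x))

theorem fermiSea_vanishesOnDouble (Q : Charges L) : VanishesOnDouble (fermiSea b Q) := by
  intro S hS
  by_contra h
  rw [fermiSea_apply] at h
  have h1 := right_ne_zero_of_mul h
  rw [ne_eq, ite_eq_right_iff, Classical.not_imp, filter_modes_eq_vertexModes_iff] at h1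
  refine hS fun x => Finset.card_le_one.2 ?_
  rintro ⟨y, σ⟩ hy ⟨z, τ⟩ hz
  rw [Finset.mem_filter] at hy hz
  have h2 := h1.1.1 _ hy.1
  have h3 := h1.1.1 _ hz.1
  simp only at h2 h3
  rw [h2, h3, Mode.mk.injEq]
  exact ⟨hy.2.trans hz.2.symm, rfl⟩

/-- The orbitals as bonds of wires and vertices. -/
def siteEquiv (b : Boundary) (L : ℕ) :
    (Dir × Fin L) × Fin (b.bonds L) ⊕ (Fin L × Fin L) ≃ Site b L where
  toFun s := match s with
    | .inl q => .bond q.1.1 q.1.2 q.2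
    | .inr q => .vertex q.1 q.2
  invFun s := match s with
    | .bond δ ℓ k => .inl ((δ, ℓ), k)
    | .vertex i j => .inr (i, j)
  left_inv := by rintro (q | q) <;> rfl
  right_inv := by rintro (q | q) <;> rfl

theorem gauge_eq_prod (c : Cfg b L) :
    gauge c = ∏ w : Dir × Fin L, ∏ k ∈ wirePat c w.1 w.2, (-1 : ℂ) ^ k.val := by
  rw [gauge, ← (siteEquiv b L).prod_comp, Fintype.prod_sum_type, Fintype.prod_prod_type]
  have h1 : ∏ q : Fin L × Fin L, 
      (if c (siteEquiv b L (.inr q)) = none then 1 else siteSign (siteEquiv b L (.inr q))) = 1 :=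
    Finset.prod_eq_one fun q _ => ite_eq_left_iff.2 fun _ => rfl
  rw [h1, mul_one]
  refine Finset.prod_congr rfl fun w _ => ?_
  rw [wirePat, Finset.prod_filter]
  refine Finset.prod_congr rfl fun k _ => ?_
  simp only [siteEquiv, Equiv.coe_fn_mk, siteSign]
  split_ifs <;> simp_all

open scoped Classical in
/-- Up to a constant, the Fermi sea has the gauge signs times the positive amplitudes. -/
theorem exists_fermiSea_eq (hL : 0 < L) (Q : Charges L) :
    ∃ ζ : ℂ, ζ ≠ 0 ∧ ∀ c : Cfg b L, fermiSea b Q (modes c) =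
      if VertOcc (pat c) ∧ lineCharges (modes c) = Q ∧ downs c = 0 then
        ζ * (gauge c * seaAmp c) else 0 := by
  choose ζ hζ h using fun m => exists_slater_eq b hL m
  refine ⟨∏ w : Dir × Fin L, ζ (Q w.1 w.2), Finset.prod_ne_zero_iff.2 fun w _ => hζ _, fun c => ?_⟩
  rw [fermiSea_apply]
  simp only [filter_modes_eq_vertexModes_iff, spin_up_iff]
  have hdown : downs c = 0 → ∀ x, c x ≠ none → c x = some .up := by
    intro h0 x hx
    obtain ⟨σ, hσ⟩ := Option.ne_none_iff_exists'.1 hx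
    have : σ = .up := (spin_up_iff.2 h0) ⟨x, σ⟩ (by simpa using hσ)
    rw [hσ, this]
  by_cases h0 : downs c = 0
  · have hvert : (∀ i j, (⟨.vertex i j, .up⟩ : Mode b L) ∈ modes c) ↔ VertOcc (pat c) := by
      refine forall_congr' fun i => forall_congr' fun j => ?_
      rw [mem_modes, pat_eq_true]
      exact ⟨fun h => by simp [h], hdown h0 _⟩
    have hX : ∀ w : Dir × Fin L, occIdx (wireMode w) (modes c) = wirePat c w.1 w.2 := by
      intro w
      ext k
      rw [mem_occIdx, mem_modes, wirePat, Finset.mem_filter]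
      exact ⟨fun h => ⟨Finset.mem_univ _, by simp [show c (.bond w.1 w.2 k) = some .up from h]⟩,
        fun h => hdown h0 _ h.2⟩
    simp only [hvert, hX, h0, true_and, and_true]
    by_cases hQ : lineCharges (modes c) = Q
    · simp only [hQ, and_true, mul_ite, mul_one, mul_zero]
      refine if_congr Iff.rfl ?_ rfl
      rw [gauge_eq_prod, seaAmp, Complex.ofReal_prod, ← Finset.prod_mul_distrib,
        ← Finset.prod_mul_distrib]
      refine Finset.prod_congr rfl fun w _ => ?_
      have hcard : (wirePat c w.1 w.2).card = Q w.1 w.2 := by rw [← lineCharges_modes, hQ]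
      rw [h _ _ hcard, hcard]
    · rw [if_neg (show ¬ (VertOcc (pat c) ∧ lineCharges (modes c) = Q) from fun e => hQ e.2)]
      obtain ⟨δ, hδ⟩ := Function.ne_iff.1 hQ
      obtain ⟨ℓ, hℓ⟩ := Function.ne_iff.1 hδ
      rw [Finset.prod_eq_zero (Finset.mem_univ (δ, ℓ)), zero_mul]
      rw [lineCharges_modes] at hℓ
      exact dif_neg hℓ
  · rw [if_neg (fun e => h0 e.1), if_neg (fun e => h0 e.2.2), mul_zero]

/-! ### Total spin -/

open scoped Classical in
/-- The state without doubly occupied orbitals with given amplitudes. -/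
def ofAmp (a : Cfg b L → ℂ) : Fock (Mode b L) :=
  fun S => if h : NoDoubleOccupancy S then a (exists_modes_eq h).choose else 0

theorem ofAmp_modes (a : Cfg b L → ℂ) (c : Cfg b L) : ofAmp a (modes c) = a c := by
  rw [ofAmp, dif_pos (noDoubleOccupancy_modes c)]
  exact congrArg a (modes_injective (exists_modes_eq (noDoubleOccupancy_modes c)).choose_spec)

theorem ofAmp_vanishesOnDouble (a : Cfg b L → ℂ) : VanishesOnDouble (ofAmp a) :=
  fun _ hS => dif_neg hS

theorem VanishesOnDouble.smul {f : Fock (Mode b L)} (hf : VanishesOnDouble f) (z : ℂ) :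
    VanishesOnDouble (z • f) := fun S hS => by simp [hf S hS]

theorem VanishesOnDouble.sum {ι : Type*} {s : Finset ι} {f : ι → Fock (Mode b L)}
    (hf : ∀ i ∈ s, VanishesOnDouble (f i)) : VanishesOnDouble (∑ i ∈ s, f i) := fun S hS => by
  rw [Finset.sum_apply]
  exact Finset.sum_eq_zero fun i hi => hf i hi S hS

/-- The signs of the two operators of a spin flip cancel. -/
theorem create_annihilate_modes (c : Cfg b L) (x : Site b L) (σ τ : Spin) (f : Fock (Mode b L)) :
    (create ⟨x, σ⟩ * annihilate ⟨x, τ⟩ : Module.End ℂ (Fock (Mode b L))) f (modes c) =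
      if c x = some σ then f (modes (Function.update c x (some τ))) else 0 := by
  rw [Module.End.mul_apply, create_modes]
  refine if_congr Iff.rfl ?_ rfl
  have h1 : Function.update c x none x = none := by simp
  have h2 : below (Function.update c x none) x = below c x := by
    refine below_congr fun y hy => ?_
    rw [Function.update_of_ne]
    rintro rfl
    exact lt_irrefl _ hy
  rw [annihilate_modes_of_eq_none h1, h2, Function.update_idem, ← mul_assoc, ← sq, neg_one_pow_sq,
    one_mul]

/-- Spin flips preserve the occupation of every orbital. -/
theorem create_annihilate_vanishesOnDouble {f : Fock (Mode b L)} (hf : VanishesOnDouble f)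
    (x : Site b L) (σ τ : Spin) :
    VanishesOnDouble ((create ⟨x, σ⟩ * annihilate ⟨x, τ⟩ : Module.End ℂ (Fock (Mode b L))) f) := by
  intro S hS
  simp only [Module.End.mul_apply, create, annihilate, LinearMap.coe_mk, AddHom.coe_mk]
  split_ifs with h1 h2
  · simp
  · rw [hf, mul_zero, mul_zero]
    intro h3
    refine hS fun y => ?_
    refine le_trans (le_of_eq ?_) (h3 y)
    unfold occupation
    by_cases hy : x = y
    · rw [Finset.filter_insert, if_pos hy, Finset.filter_erase,
        Finset.card_insert_of_notMem (fun h => h2 ?_), Finset.card_erase_add_one]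
      · exact Finset.mem_filter.2 ⟨h1, hy⟩
      · rw [← Finset.filter_erase] at h
        exact (Finset.mem_filter.1 h).1
    · rw [Finset.filter_insert, if_neg hy, Finset.filter_erase, Finset.erase_eq_of_notMem]
      exact fun h => hy (Finset.mem_filter.1 h).2
  · rfl

theorem spinLower_vanishesOnDouble {f : Fock (Mode b L)} (hf : VanishesOnDouble f) :
    VanishesOnDouble (spinLower b L f) := by
  rw [spinLower, LinearMap.sum_apply]
  exact .sum fun x _ => create_annihilate_vanishesOnDouble hf x _ _

theorem spinRaise_vanishesOnDouble {f : Fock (Mode b L)} (hf : VanishesOnDouble f) :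
    VanishesOnDouble (spinRaise b L f) := by
  rw [spinRaise, LinearMap.sum_apply]
  exact .sum fun x _ => create_annihilate_vanishesOnDouble hf x _ _

theorem spinLower_modes (f : Fock (Mode b L)) (c : Cfg b L) :
    spinLower b L f (modes c) =
      ∑ x, if c x = some .down then f (modes (Function.update c x (some .up))) else 0 := by
  rw [spinLower, LinearMap.sum_apply, Finset.sum_apply]
  simp only [create_annihilate_modes]

theorem spinRaise_modes (f : Fock (Mode b L)) (c : Cfg b L) :
    spinRaise b L f (modes c) =
      ∑ x, if c x = some .up then f (modes (Function.update c x (some .down))) else 0 := by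
  rw [spinRaise, LinearMap.sum_apply, Finset.sum_apply]
  simp only [create_annihilate_modes]

/-- The number of up spins. -/
def ups (c : Cfg b L) : ℕ := (Finset.univ.filter (fun x => c x = some .up)).card

theorem spinZOp_modes (f : Fock (Mode b L)) (c : Cfg b L) :
    spinZOp b L f (modes c) = ((ups c : ℂ) - downs c) / 2 * f (modes c) := by
  have key : ∀ σ : Spin, ∀ x, (if c x = some σ then f (modes (Function.update c x (some σ))) else 0) =
      if c x = some σ then f (modes c) else 0 := by
    intro σ x
    refine ite_congr rfl (fun h => ?_) (fun _ => rfl)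
    rw [← h, Function.update_eq_self]
  rw [spinZOp, LinearMap.smul_apply, LinearMap.sum_apply, Pi.smul_apply, Finset.sum_apply]
  simp only [LinearMap.sub_apply, Pi.sub_apply, create_annihilate_modes, key]
  rw [Finset.sum_sub_distrib, ← Finset.sum_filter, ← Finset.sum_filter, Finset.sum_const,
    Finset.sum_const, ups, downs, smul_eq_mul, nsmul_eq_mul, nsmul_eq_mul]
  ring

theorem spinZOp_vanishesOnDouble {f : Fock (Mode b L)} (hf : VanishesOnDouble f) :
    VanishesOnDouble (spinZOp b L f) := by
  rw [spinZOp, LinearMap.smul_apply, LinearMap.sum_apply]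
  refine .smul (.sum fun x _ S hS => ?_) _
  rw [LinearMap.sub_apply, Pi.sub_apply, create_annihilate_vanishesOnDouble hf x _ _ S hS,
    create_annihilate_vanishesOnDouble hf x _ _ S hS, sub_zero]

/-- The amplitude does not depend on the spins. -/
def SpinInvariant (a : Cfg b L → ℂ) : Prop := ∀ c c', pat c = pat c' → a c = a c'

theorem pat_update {c : Cfg b L} {x : Site b L} (h : c x ≠ none) (σ : Spin) :
    pat (Function.update c x (some σ)) = pat c := by
  funext y
  by_cases hy : y = x
  · subst hy
    rw [pat_eq_true.2 h]
    simp [pat]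
  · simp [pat, hy]

theorem downs_update_up {c : Cfg b L} {x : Site b L} (h : c x = some .down) :
    downs (Function.update c x (some .up)) + 1 = downs c := by
  have : Finset.univ.filter (fun y => Function.update c x (some .up) y = some .down) =
      (Finset.univ.filter (fun y => c y = some .down)).erase x := by
    ext y
    by_cases hy : y = x <;> simp [hy]
  rw [downs, this, Finset.card_erase_add_one (by simpa using h), downs]

theorem downs_update_down {c : Cfg b L} {x : Site b L} (h : c x = some .up) :
    downs (Function.update c x (some .down)) = downs c + 1 := by
  have h1 : Function.update c x (some .down) x = some .down := by simp
  rw [← downs_update_up h1, Function.update_idem, ← h, Function.update_eq_self]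

/-- The state with amplitudes `a` restricted to the configurations with `s` down spins. -/
def symState (a : Cfg b L → ℂ) (s : ℕ) : Fock (Mode b L) :=
  ofAmp fun c => if downs c = s then a c else 0

theorem symState_modes (a : Cfg b L → ℂ) (s : ℕ) (c : Cfg b L) :
    symState a s (modes c) = if downs c = s then a c else 0 := ofAmp_modes _ _

theorem symState_vanishesOnDouble (a : Cfg b L → ℂ) (s : ℕ) : VanishesOnDouble (symState a s) :=
  ofAmp_vanishesOnDouble _

theorem spinLower_symState {a : Cfg b L → ℂ} (ha : SpinInvariant a) (s : ℕ) :
    spinLower b L (symState a s) = ((s : ℂ) + 1) • symState a (s + 1) := by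
  refine fock_ext (spinLower_vanishesOnDouble (symState_vanishesOnDouble _ _))
    ((symState_vanishesOnDouble _ _).smul _) fun c => ?_
  rw [spinLower_modes, Pi.smul_apply, symState_modes]
  have key : ∀ x, (if c x = some .down then symState a s (modes (Function.update c x (some .up))) else 0)
      = if c x = some .down then (if downs c = s + 1 then a c else 0) else 0 := by
    intro x
    refine ite_congr rfl (fun h => ?_) (fun _ => rfl)
    rw [symState_modes, ← downs_update_up h, ha _ c (pat_update (by simp [h]) _)]
    simp
  simp only [key]
  rw [← Finset.sum_filter, Finset.sum_const, nsmul_eq_mul, smul_eq_mul, ← downs]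
  split_ifs with h
  · rw [h]
    push_cast
    ring
  · simp

theorem spinRaise_symState_zero (a : Cfg b L → ℂ) : spinRaise b L (symState a 0) = 0 := by
  refine fock_ext (spinRaise_vanishesOnDouble (symState_vanishesOnDouble _ _)) (fun _ _ => rfl)
    fun c => ?_
  rw [spinRaise_modes]
  refine Finset.sum_eq_zero fun x _ => ?_
  split_ifs with h
  · rw [symState_modes, downs_update_down h, if_neg (by omega)]
  · rfl

theorem spinRaise_symState_succ {a : Cfg b L → ℂ} (ha : SpinInvariant a) {N : ℕ}
    (hN : ∀ c, a c ≠ 0 → ups c + downs c = N) (s : ℕ) :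
    spinRaise b L (symState a (s + 1)) = ((N : ℂ) - s) • symState a s := by
  refine fock_ext (spinRaise_vanishesOnDouble (symState_vanishesOnDouble _ _))
    ((symState_vanishesOnDouble _ _).smul _) fun c => ?_
  rw [spinRaise_modes, Pi.smul_apply, symState_modes]
  have key : ∀ x, (if c x = some .up then symState a (s + 1) (modes (Function.update c x (some .down)))
      else 0) = if c x = some .up then (if downs c = s then a c else 0) else 0 := by
    intro x
    refine ite_congr rfl (fun h => ?_) (fun _ => rfl)
    rw [symState_modes, downs_update_down h, ha _ c (pat_update (by simp [h]) _)]
    simp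
  simp only [key]
  rw [← Finset.sum_filter, Finset.sum_const, nsmul_eq_mul, smul_eq_mul, ← ups]
  split_ifs with h
  · by_cases h0 : a c = 0
    · simp [h0]
    · rw [← hN c h0, ← h]
      push_cast
      ring
  · simp

theorem spinZOp_symState {a : Cfg b L → ℂ} {N : ℕ}
    (hN : ∀ c, a c ≠ 0 → ups c + downs c = N) (s : ℕ) :
    spinZOp b L (symState a s) = ((N : ℂ) / 2 - s) • symState a s := by
  refine fock_ext (spinZOp_vanishesOnDouble (symState_vanishesOnDouble _ _))
    ((symState_vanishesOnDouble _ _).smul _) fun c => ?_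
  rw [spinZOp_modes, Pi.smul_apply, symState_modes, smul_eq_mul]
  split_ifs with h
  · by_cases h0 : a c = 0
    · simp [h0]
    · rw [← hN c h0, ← h]
      push_cast
      ring
  · simp

/-- A state symmetric in the spins of its `N` electrons has total spin `N / 2`. -/
theorem spinSq_symState {a : Cfg b L → ℂ} (ha : SpinInvariant a) {N : ℕ}
    (hN : ∀ c, a c ≠ 0 → ups c + downs c = N) (s : ℕ) :
    spinSq b L (symState a s) = ((N : ℂ) / 2 * ((N : ℂ) / 2 + 1)) • symState a s := by
  simp only [spinSq, LinearMap.add_apply, LinearMap.smul_apply, Module.End.mul_apply,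
    spinLower_symState ha, spinZOp_symState hN, map_smul, spinRaise_symState_succ ha hN]
  cases s with
  | zero =>
    rw [spinRaise_symState_zero, map_zero, add_zero, smul_smul, smul_smul, smul_smul, ← add_smul]
    congr 1
    push_cast
    ring
  | succ s =>
    rw [spinRaise_symState_succ ha hN, map_smul, spinLower_symState ha]
    simp only [smul_smul, ← add_smul]
    congr 1
    push_cast
    ring

theorem spinLower_pow_symState {a : Cfg b L → ℂ} (ha : SpinInvariant a) (s : ℕ) :
    (spinLower b L ^ s) (symState a 0) = (s.factorial : ℂ) • symState a s := by
  induction s with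
  | zero => simp
  | succ s ih =>
    rw [pow_succ', Module.End.mul_apply, ih, map_smul, spinLower_symState ha, smul_smul,
      Nat.factorial_succ]
    congr 1
    push_cast
    ring

/-! ### Ground states of the sectors -/

/-- The configuration is physical, with charges `Q` and `s` down spins. -/
def InSector (Q : Charges L) (s : ℕ) (c : Cfg b L) : Prop :=
  VertOcc (pat c) ∧ lineCharges (modes c) = Q ∧ downs c = s

open scoped Classical in
/-- The gauge signs times the positive amplitudes, on the configurations with charges `Q`. -/
def seaWave (Q : Charges L) (c : Cfg b L) : ℂ :=
  if VertOcc (pat c) ∧ lineCharges (modes c) = Q then gauge c * seaAmp c else 0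

/-- The spin-symmetric state with charges `Q` and `s` down spins. -/
def seaState (Q : Charges L) (s : ℕ) : Fock (Mode b L) := symState (seaWave Q) s

open scoped Classical in
theorem seaState_modes (Q : Charges L) (s : ℕ) (c : Cfg b L) :
    seaState Q s (modes c) = if InSector Q s c then gauge c * seaAmp c else 0 := by
  rw [seaState, symState_modes, seaWave, ← ite_and]
  refine if_congr ?_ rfl rfl
  rw [InSector]
  tauto

theorem seaState_vanishesOnDouble (Q : Charges L) (s : ℕ) :
    VanishesOnDouble (seaState Q s : Fock (Mode b L)) := symState_vanishesOnDouble _ _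

theorem wirePat_congr {c c' : Cfg b L} (h : pat c = pat c') (δ : Dir) (ℓ : Fin L) :
    wirePat c δ ℓ = wirePat c' δ ℓ := by
  ext k
  rw [mem_wirePat, mem_wirePat, h]

theorem seaWave_spinInvariant (Q : Charges L) : SpinInvariant (seaWave Q : Cfg b L → ℂ) := by
  classical
  intro c c' h
  rw [seaWave, seaWave]
  refine if_congr (by rw [← bondCount_pat, ← bondCount_pat, h]) ?_ rfl
  simp only [gauge_eq_prod, seaAmp, wirePat_congr h]

theorem card_filter_spin (c : Cfg b L) (σ : Spin) :
    ((modes c).filter (fun a => a.spin = σ)).card =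
      (Finset.univ.filter (fun x => c x = some σ)).card := by
  refine Finset.card_bij (fun a _ => a.site) ?_ ?_ ?_
  · rintro ⟨x, τ⟩ hx
    simp only [Finset.mem_filter, mem_modes, Finset.mem_univ, true_and] at hx ⊢
    rw [hx.1, hx.2]
  · rintro ⟨x, τ⟩ hx ⟨x', τ'⟩ hx' (rfl : x = x')
    rw [Finset.mem_filter] at hx hx'
    rw [Mode.mk.injEq]
    exact ⟨rfl, hx.2.trans hx'.2.symm⟩
  · intro x hx
    exact ⟨⟨x, σ⟩, by simpa using hx, rfl⟩

theorem card_modes (c : Cfg b L) : (modes c).card = ups c + downs c := by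
  rw [ups, downs, ← card_filter_spin, ← card_filter_spin,
    ← Finset.card_filter_add_card_filter_not (fun a : Mode b L => a.spin = .up)]
  congr 2
  refine Finset.filter_congr fun a _ => ?_
  cases a.spin <;> simp

theorem spinZ_modes (c : Cfg b L) : spinZ (modes c) = ((ups c : ℚ) - downs c) / 2 := by
  rw [spinZ, card_filter_spin, card_filter_spin, ups, downs]

theorem physical_modes {c : Cfg b L} : Physical (modes c) ↔ VertOcc (pat c) := by
  rw [Physical, and_iff_right (noDoubleOccupancy_modes c)]
  refine forall_congr' fun i => forall_congr' fun j => ?_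
  rw [occupation_modes, pat_eq_true]
  split_ifs with h <;> simp [h]

theorem ups_add_downs {c : Cfg b L} (h : VertOcc (pat c)) :
    ups c + downs c = (lineCharges (modes c)).electrons := by
  have h1 : ups c + downs c = ∑ x, if pat c x = true then 1 else 0 := by
    rw [ups, downs, Finset.card_filter, Finset.card_filter, ← Finset.sum_add_distrib]
    refine Finset.sum_congr rfl fun x _ => ?_
    unfold pat
    rcases c x with _ | _ | _ <;> simp
  rw [h1, ← (siteEquiv b L).sum_comp, Fintype.sum_sum_type, Fintype.sum_prod_type, Charges.electrons,
    Charges.total, add_comm]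
  congr 1
  · rw [Finset.sum_congr rfl fun q _ => if_pos (h q.1 q.2)]
    simp
  · rw [Fintype.sum_prod_type]
    refine Finset.sum_congr rfl fun δ _ => Finset.sum_congr rfl fun ℓ _ => ?_
    rw [lineCharges_modes, ← Finset.card_filter]
    congr 1
    ext k
    rw [mem_wirePat, Finset.mem_filter, and_iff_right (Finset.mem_univ k)]
    rfl

theorem ups_add_downs_of_seaWave {Q : Charges L} (c : Cfg b L) (h : seaWave Q c ≠ 0) :
    ups c + downs c = Q.electrons := by
  classical
  rw [seaWave, ne_eq, ite_eq_right_iff, Classical.not_imp] at h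
  rw [ups_add_downs h.1.1, h.1.2]

theorem spinSq_seaState (Q : Charges L) (s : ℕ) :
    spinSq b L (seaState Q s) =
      ((Q.electrons : ℂ) / 2 * ((Q.electrons : ℂ) / 2 + 1)) • seaState Q s :=
  spinSq_symState (seaWave_spinInvariant Q) ups_add_downs_of_seaWave s

/-- The states obtained from the Fermi sea by lowering the total spin. -/
theorem exists_spinLower_pow_fermiSea (b : Boundary) (hL : 0 < L) (Q : Charges L) (s : ℕ) :
    ∃ ζ : ℂ, ζ ≠ 0 ∧ (spinLower b L ^ s) (fermiSea b Q) = ζ • seaState Q s := by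
  classical
  obtain ⟨ζ, hζ, h⟩ := exists_fermiSea_eq (b := b) hL Q
  have h1 : fermiSea b Q = ζ • symState (seaWave Q) 0 := by
    refine fock_ext (fermiSea_vanishesOnDouble Q) ((symState_vanishesOnDouble _ _).smul _) fun c => ?_
    rw [h, Pi.smul_apply, ← seaState, seaState_modes, smul_eq_mul, mul_ite, mul_zero]
    exact if_congr Iff.rfl rfl rfl
  refine ⟨ζ * s.factorial, mul_ne_zero hζ (by exact_mod_cast s.factorial_ne_zero), ?_⟩
  rw [h1, map_smul, spinLower_pow_symState (seaWave_spinInvariant Q), smul_smul]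
  rfl

/-- Hops preserve the sector, in both directions. -/
theorem Allowed.inSector_iff {h : Hop L} {c : Cfg b L} (hc : Allowed h c) {Q : Charges L} {s : ℕ} :
    InSector Q s (c ∘ h.perm) ↔ InSector Q s c := by
  rw [InSector, InSector, hc.lineCharges, downs_comp]
  refine and_congr_left fun _ => ⟨fun hv => ?_, hc.vertOcc⟩
  rw [pat_hop hc] at hv
  have := VertOcc.comp_swap hv h.1 h.1 h.2.1 h.2.1 (if h.2.2.2 then b.before h.2.2.1 else b.after h.2.2.1)
    (if h.2.2.2 then b.after h.2.2.1 else b.before h.2.2.1)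
  rw [Function.comp_assoc, ← Equiv.coe_trans] at this
  simpa [Hop.src, Hop.dst] using this

/-- Unlike `gauge_mul_hamiltonian`, this does not need the parity condition. -/
theorem hamiltonian_modes_eq_zero (hL : 2 ≤ L) (t : ℝ) {f : Fock (Mode b L)} (hf : VanishesOnDouble f)
    {c : Cfg b L} (h : ∀ h : Hop L, Allowed h c → f (modes (c ∘ h.perm)) = 0) :
    hamiltonian b L t f (modes c) = 0 := by
  rw [hamiltonian_apply_modes hL t hf, Finset.sum_eq_zero, mul_zero]
  refine fun δ _ => Finset.sum_eq_zero fun ℓ _ => Finset.sum_eq_zero fun k _ => ?_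
  have h1 := h (δ, ℓ, k, true)
  have h2 := h (δ, ℓ, k, false)
  simp only [Allowed, Hop.over, Hop.src, Hop.dst, Hop.perm, if_true, Bool.false_eq_true, if_false]
    at h1 h2
  rw [vertTerm, hopTerm, hopTerm]
  split_ifs with h3 h4 h4
  · rw [h1 h3, h2 h4]; simp
  · rw [h1 h3]; simp
  · rw [h2 h4]; simp
  · simp

/-- The spin-symmetric states are eigenstates with the energy of the Fermi sea. -/
theorem hamiltonian_seaState (hL : 2 ≤ L) (t : ℝ) {Q : Charges L} (hQ : b.ParityOK Q) (s : ℕ) :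
    hamiltonian b L t (seaState Q s) =
      ((∑ δ, ∑ ℓ, wireEnergy b L t (Q δ ℓ) : ℝ) : ℂ) • seaState Q s := by
  classical
  refine fock_ext (hamiltonian_vanishesOnDouble _ _) ((seaState_vanishesOnDouble _ _).smul _)
    fun c => ?_
  rw [Pi.smul_apply, smul_eq_mul]
  by_cases hc : InSector Q s c
  · refine mul_left_cancel₀ (gauge_ne_zero c) ?_
    rw [gauge_mul_hamiltonian hL t (seaState_vanishesOnDouble _ _) (by rw [hc.2.1]; exact hQ)]
    have key : ∀ h : Hop L, (if Allowed h c then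
        gauge (c ∘ h.perm) * seaState Q s (modes (c ∘ h.perm)) else 0) =
        (((if Allowed h c then seaAmp (c ∘ h.perm) else 0) : ℝ) : ℂ) := by
      intro h
      split_ifs with h1
      · rw [seaState_modes, if_pos (h1.inSector_iff.2 hc), ← mul_assoc, gauge_mul_self, one_mul]
      · simp
    simp only [key]
    rw [← Complex.ofReal_sum, sum_seaAmp_hop hL hc.1, hc.2.1, sum_wireEnergy, seaState_modes,
      if_pos hc, mul_left_comm, ← mul_assoc (gauge c), gauge_mul_self]
    push_cast
    ring
  · rw [seaState_modes, if_neg hc, mul_zero]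
    refine hamiltonian_modes_eq_zero hL t (seaState_vanishesOnDouble _ _) fun h h1 => ?_
    rw [seaState_modes, if_neg fun h2 => hc (h1.inSector_iff.1 h2)]

/-- The eigenvalue equation in one sector, in terms of the hops. -/
theorem sum_hop_of_eigenstate (hL : 2 ≤ L) {t : ℝ} (ht : 0 < t) {Q : Charges L} (hQ : b.ParityOK Q)
    {s : ℕ} {f : Fock (Mode b L)} (hf : VanishesOnDouble f) {E : ℝ}
    (hE : hamiltonian b L t f = (E : ℂ) • f) {c : Cfg b L} (hc : InSector Q s c) :
    (∑ h : Hop L, if Allowed h c then gauge (c ∘ h.perm) * f (modes (c ∘ h.perm)) else 0) =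
      ((-(E / t) : ℝ) : ℂ) * (gauge c * f (modes c)) := by
  have h := gauge_mul_hamiltonian hL t hf (c := c) (by rw [hc.2.1]; exact hQ)
  rw [hE, Pi.smul_apply, smul_eq_mul] at h
  have ht' : (t : ℂ) ≠ 0 := by exact_mod_cast ht.ne'
  refine mul_left_cancel₀ (neg_ne_zero.2 ht') ?_
  rw [← h]
  push_cast
  field_simp

theorem sum_hop_of_inSector (hL : 2 ≤ L) {Q : Charges L} {s : ℕ} {c : Cfg b L} (hc : InSector Q s c) :
    (∑ h : Hop L, if Allowed h c then seaAmp (c ∘ h.perm) else 0) = seaEigenvalue b Q * seaAmp c := by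
  rw [sum_seaAmp_hop hL hc.1, hc.2.1]

/-- An eigenstate that does not vanish on a sector has at least the energy of the Fermi sea. -/
theorem wireEnergy_le_of_eigenstate (hL : 2 ≤ L) {t : ℝ} (ht : 0 < t) {Q : Charges L}
    (hQ : b.ParityOK Q) {s : ℕ} {f : Fock (Mode b L)} (hf : VanishesOnDouble f) {E : ℝ}
    (hE : hamiltonian b L t f = (E : ℂ) • f) {c : Cfg b L} (hc : InSector Q s c)
    (hfc : f (modes c) ≠ 0) : ∑ δ, ∑ ℓ, wireEnergy b L t (Q δ ℓ) ≤ E := by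
  have h := le_of_pos_eigenfunction (Ω := {c : Cfg b L | InSector Q s c})
    (fun c _ => seaAmp_pos (by omega) c)
    (fun c (hc : InSector Q s c) (i : Hop L) h1 => (Allowed.inSector_iff h1).2 hc)
    (fun c (hc : InSector Q s c) => sum_hop_of_inSector hL hc)
    (fun c (hc : InSector Q s c) => sum_hop_of_eigenstate hL ht hQ hf hE hc)
    (a := fun c => gauge c * f (modes c)) ⟨c, hc, mul_ne_zero (gauge_ne_zero c) hfc⟩
  rw [sum_wireEnergy]
  rw [neg_le, le_div_iff₀ ht] at h
  nlinarith

/-- An eigenstate with the energy of the Fermi sea is, on an admissible sector, a multiple of the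
spin-symmetric state. -/
theorem eq_const_mul_of_eigenstate (hL : 2 ≤ L) {t : ℝ} (ht : 0 < t) {Q : Charges L}
    (hQ : b.Admissible Q) (s : ℕ) {f : Fock (Mode b L)} (hf : VanishesOnDouble f)
    (hE : hamiltonian b L t f = ((∑ δ, ∑ ℓ, wireEnergy b L t (Q δ ℓ) : ℝ) : ℂ) • f) :
    ∃ z : ℂ, ∀ c, InSector Q s c → f (modes c) = z * (gauge c * seaAmp c) := by
  obtain ⟨z, hz⟩ := eq_const_mul_of_eigenfunction (Ω := {c : Cfg b L | InSector Q s c})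
    (fun c _ => seaAmp_pos (by omega) c)
    (fun c (hc : InSector Q s c) (i : Hop L) h1 => (Allowed.inSector_iff h1).2 hc)
    (fun c (hc : InSector Q s c) => sum_hop_of_inSector hL hc)
    (fun c (hc : InSector Q s c) c' (hc' : InSector Q s c') =>
      reach_of_charges_eq hQ.2 hc.1 hc'.1 (by rw [bondCount_pat, hc.2.1]) (by rw [bondCount_pat, hc'.2.1])
        (hc.2.2.trans hc'.2.2.symm))
    (a := fun c => gauge c * f (modes c))
    (fun c (hc : InSector Q s c) => by
      rw [sum_hop_of_eigenstate hL ht hQ.1 hf hE hc, sum_wireEnergy]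
      congr 2
      field_simp)
  refine ⟨z, fun c hc => ?_⟩
  rw [mul_left_comm, ← hz c hc, ← mul_assoc, gauge_mul_self, one_mul]

/-- The sectors of the theorem are nonempty: some of the electrons of the block pattern get a down spin. -/
theorem exists_inSector {Q : Charges L} (hQ : ∀ δ ℓ, Q δ ℓ < L) {s : ℕ} (hs : s ≤ Q.electrons) :
    ∃ c : Cfg b L, InSector Q s c := by
  classical
  let c₀ : Cfg b L := fun x => if blockPat Q x = true then some .up else none
  have hpat : pat c₀ = blockPat Q := by
    funext x
    rcases h : blockPat Q x with _ | _ <;> simp [pat, c₀, h]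
  have hocc : VertOcc (pat c₀) := by
    rw [hpat]
    exact vertOcc_blockPat Q
  have hch : lineCharges (modes c₀) = Q := by
    rw [← bondCount_pat, hpat, bondCount_blockPat hQ]
  have hdown : downs c₀ = 0 := by
    rw [downs, Finset.card_eq_zero, Finset.filter_eq_empty_iff]
    intro x _
    simp only [c₀]
    split_ifs <;> simp
  have hups : ups c₀ = Q.electrons := by
    rw [← hch, ← ups_add_downs hocc, hdown, add_zero]
  rw [← hups, ups] at hs
  obtain ⟨T, hT, hTs⟩ := Finset.exists_subset_card_eq hs
  have hT' : ∀ x ∈ T, c₀ x = some .up := fun x hx => (Finset.mem_filter.1 (hT hx)).2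
  have hpat' : pat (fun x => if x ∈ T then some .down else c₀ x) = pat c₀ := by
    funext x
    by_cases hx : x ∈ T
    · simp [pat, hx, hT' x hx]
    · simp [pat, hx]
  refine ⟨fun x => if x ∈ T then some .down else c₀ x, ?_, ?_, ?_⟩
  · rw [hpat']
    exact hocc
  · rw [← bondCount_pat, hpat', bondCount_pat, hch]
  · rw [← hTs, downs]
    congr 1
    ext x
    rw [Finset.mem_filter, and_iff_right (Finset.mem_univ x)]
    by_cases hx : x ∈ T
    · simp [hx]
    · simp only [hx, if_false, iff_false, c₀]
      split_ifs <;> simp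

theorem seaState_ne_zero (hL : 0 < L) {Q : Charges L} {s : ℕ} {c : Cfg b L} (hc : InSector Q s c) :
    seaState Q s (modes c) ≠ 0 := by
  rw [seaState_modes, if_pos hc]
  exact mul_ne_zero (gauge_ne_zero c) (by exact_mod_cast (seaAmp_pos hL c).ne')

theorem exists_modes_ne_zero {f : Fock (Mode b L)} (hf : VanishesOnDouble f) (h : f ≠ 0) :
    ∃ c, f (modes c) ≠ 0 := by
  by_contra h1
  push Not at h1
  exact h (fock_ext hf (fun _ _ => rfl) h1)

theorem spinZ_eq_iff {Q : Charges L} {c : Cfg b L} (hv : VertOcc (pat c))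
    (hQ : lineCharges (modes c) = Q) (s : ℕ) :
    spinZ (modes c) = (Q.electrons : ℚ) / 2 - s ↔ downs c = s := by
  have h : ((ups c + downs c : ℕ) : ℚ) = (Q.electrons : ℕ) := by rw [ups_add_downs hv, hQ]
  push_cast at h
  rw [spinZ_modes, ← h]
  constructor
  · intro h1
    have : (downs c : ℚ) = s := by linarith
    exact_mod_cast this
  · rintro rfl
    ring

theorem mem_sector {Q : Charges L} {s : ℕ} {f : Fock (Mode b L)} :
    f ∈ sector b Q ((Q.electrons : ℚ) / 2 - s) ↔
      VanishesOnDouble f ∧ ∀ c, f (modes c) ≠ 0 → InSector Q s c := by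
  constructor
  · intro h
    refine ⟨fun S hS => by_contra fun h1 => hS (h S h1).1.1, fun c hc => ?_⟩
    obtain ⟨h1, h2, h3⟩ := h _ hc
    rw [physical_modes] at h1
    exact ⟨h1, h2, (spinZ_eq_iff h1 h2 s).1 h3⟩
  · rintro ⟨h1, h2⟩ S hS
    have hS' : NoDoubleOccupancy S := by_contra fun h => hS (h1 S h)
    obtain ⟨c, rfl⟩ := exists_modes_eq hS'
    obtain ⟨h3, h4, h5⟩ := h2 c hS
    exact ⟨physical_modes.2 h3, h4, (spinZ_eq_iff h3 h4 s).2 h5⟩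

theorem inSector_of_seaState_ne_zero {Q : Charges L} {s : ℕ} {c : Cfg b L}
    (h : seaState Q s (modes c) ≠ 0) : InSector Q s c := by
  classical
  rw [seaState_modes, ne_eq, ite_eq_right_iff, Classical.not_imp] at h
  exact h.1

theorem Boundary.Admissible.two_le {Q : Charges L} (hQ : b.Admissible Q) (hL : 0 < L) : 2 ≤ L := by
  have := hQ.2 .x ⟨0, hL⟩
  omega

/-- The ground states of a sector. -/
theorem sector_groundSpace (hL : 0 < L) {t : ℝ} (ht : 0 < t) {Q : Charges L} (hQ : b.Admissible Q)
    {s : ℕ} (hs : s ≤ Q.electrons) :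
    HasGroundSpace (hamiltonian b L t) (sector b Q ((Q.electrons : ℚ) / 2 - s))
      (∑ δ, ∑ ℓ, wireEnergy b L t (Q δ ℓ)) (Submodule.span ℂ {seaState Q s}) := by
  have hL2 := hQ.two_le hL
  obtain ⟨c₀, hc₀⟩ := exists_inSector (b := b) (fun δ ℓ => (hQ.2 δ ℓ).2) hs
  have hmem : seaState Q s ∈ sector b Q ((Q.electrons : ℚ) / 2 - s) :=
    mem_sector.2 ⟨seaState_vanishesOnDouble Q s, fun c => inSector_of_seaState_ne_zero⟩
  refine ⟨⟨⟨seaState Q s, hmem, fun h => seaState_ne_zero hL hc₀ (by rw [h]; rfl),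
    hamiltonian_seaState hL2 t hQ.1 s⟩, ?_⟩, le_antisymm ?_ ?_⟩
  · rintro E ⟨ψ, hψ, hne, hE⟩
    rw [mem_sector] at hψ
    obtain ⟨c, hc⟩ := exists_modes_ne_zero hψ.1 hne
    exact wireEnergy_le_of_eigenstate hL2 ht hQ.1 hψ.1 hE (hψ.2 c hc) hc
  · rintro ψ ⟨hψ, hE⟩
    rw [SetLike.mem_coe, mem_sector] at hψ
    rw [SetLike.mem_coe, Module.End.mem_eigenspace_iff] at hE
    obtain ⟨z, hz⟩ := eq_const_mul_of_eigenstate hL2 ht hQ s hψ.1 hE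
    rw [Submodule.mem_span_singleton]
    refine ⟨z, (fock_ext hψ.1 ((seaState_vanishesOnDouble Q s).smul z) fun c => ?_).symm⟩
    rw [Pi.smul_apply, seaState_modes, smul_eq_mul]
    split_ifs with hc
    · exact hz c hc
    · rw [mul_zero]
      exact by_contra fun h => hc (hψ.2 c h)
  · rw [Submodule.span_singleton_le_iff_mem]
    exact ⟨hmem, Module.End.mem_eigenspace_iff.2 (hamiltonian_seaState hL2 t hQ.1 s)⟩

theorem fullyPolarized_span {N : ℕ} {X : Set (Fock (Mode b L))}
    (h : ∀ ψ ∈ X, ∃ (Q : Charges L) (s : ℕ), Q.electrons = N ∧ ψ = seaState Q s) :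
    FullyPolarized b L N (Submodule.span ℂ X) := by
  intro ψ hψ
  have hle : Submodule.span ℂ X ≤
      Module.End.eigenspace (spinSq b L) ((N : ℂ) / 2 * ((N : ℂ) / 2 + 1)) := by
    rw [Submodule.span_le]
    intro ψ hψ
    obtain ⟨Q, s, rfl, rfl⟩ := h ψ hψ
    exact Module.End.mem_eigenspace_iff.2 (spinSq_seaState Q s)
  exact Module.End.mem_eigenspace_iff.1 (hle hψ)

/-! ### The energies of the wires -/

/-- A lower bound by a supporting line for a sequence with increasing increments. -/
theorem supporting_line {F D : ℕ → ℝ} {P : ℕ → Prop} (hF : ∀ k, F (k + 1) = F k + D k)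
    (hD : ∀ i j, i < j → P j → D i < D j) {k₀ : ℕ} (hk₀ : P k₀) {k : ℕ} (hk : ∀ j < k, P j) :
    F k₀ + ((k : ℝ) - k₀) * D k₀ ≤ F k ∧
      (F k ≤ F k₀ + ((k : ℝ) - k₀) * D k₀ → k = k₀ ∨ k = k₀ + 1) := by
  have hup : ∀ n, (∀ j < k₀ + 1 + n, P j) →
      F k₀ + ((n : ℝ) + 1) * D k₀ ≤ F (k₀ + 1 + n) ∧
        (0 < n → F k₀ + ((n : ℝ) + 1) * D k₀ < F (k₀ + 1 + n)) := by
    intro n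
    induction n with
    | zero =>
      intro _
      refine ⟨?_, fun h => absurd h (lt_irrefl 0)⟩
      rw [Nat.add_zero, hF]
      simp
    | succ n ih =>
      intro h
      have h1 := (ih fun j hj => h j (by omega)).1
      have h2 := hD k₀ (k₀ + 1 + n) (by omega) (h _ (by omega))
      have h3 := hF (k₀ + 1 + n)
      rw [← Nat.add_assoc, h3]
      push_cast
      exact ⟨by linarith, fun _ => by linarith⟩
  have hdown : ∀ n, n ≤ k₀ → F k₀ - (n : ℝ) * D k₀ ≤ F (k₀ - n) ∧
      (0 < n → F k₀ - (n : ℝ) * D k₀ < F (k₀ - n)) := by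
    intro n
    induction n with
    | zero =>
      intro _
      exact ⟨by simp, fun h => absurd h (lt_irrefl 0)⟩
    | succ n ih =>
      intro h
      have h1 := (ih (by omega)).1
      have h2 := hD (k₀ - (n + 1)) k₀ (by omega) hk₀
      have h3 := hF (k₀ - (n + 1))
      rw [show k₀ - (n + 1) + 1 = k₀ - n by omega] at h3
      push_cast
      exact ⟨by linarith, fun _ => by linarith⟩
  rcases Nat.lt_or_ge k₀ k with h | h
  · obtain ⟨n, rfl⟩ : ∃ n, k = k₀ + 1 + n := ⟨k - (k₀ + 1), by omega⟩
    obtain ⟨h1, h2⟩ := hup n hk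
    push_cast
    rw [show (k₀ : ℝ) + 1 + n - k₀ = n + 1 by ring]
    refine ⟨h1, fun h3 => ?_⟩
    rcases Nat.eq_zero_or_pos n with rfl | hn
    · exact Or.inr rfl
    · exact absurd (h2 hn) (not_lt.2 h3)
  · obtain ⟨n, hn, rfl⟩ : ∃ n ≤ k₀, k = k₀ - n := ⟨k₀ - k, by omega, by omega⟩
    obtain ⟨h1, h2⟩ := hdown n hn
    rw [Nat.cast_sub hn, show (k₀ : ℝ) - n - k₀ = -n by ring, neg_mul, ← sub_eq_add_neg]
    refine ⟨h1, fun h3 => ?_⟩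
    rcases Nat.eq_zero_or_pos n with rfl | hn
    · exact Or.inl rfl
    · exact absurd (h2 hn) (not_lt.2 h3)

/-- The quantization length: the Fermi level of a wire with `m` electrons is at the momentum
`π (m + 1) / M`. -/
def Boundary.length : Boundary → ℕ → ℕ
  | .obc, L => L + 2
  | .pbc, L => L

/-- The smallest number of electrons on a wire allowed by the parity condition. -/
def Boundary.offset : Boundary → ℕ → ℕ
  | .obc, _ => 0
  | .pbc, L => (L + 1) % 2

theorem wireEnergy_add_shell (b : Boundary) (L : ℕ) (t : ℝ) (m : ℕ) :
    wireEnergy b L t (m + b.shell) =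
      wireEnergy b L t m + b.shell * (-2 * t * Real.cos (Real.pi * (m + 1) / b.length L)) := by
  cases b with
  | obc =>
    simp only [wireEnergy, Boundary.shell, Boundary.length, momentum]
    rw [Finset.sum_Icc_succ_top (by omega)]
    push_cast
    ring
  | pbc =>
    simp only [wireEnergy, Boundary.shell, Boundary.length, momentum]
    rw [Finset.sum_Icc_succ_top (by omega), ← Finset.sum_Ioc_add_eq_sum_Icc (by omega)]
    have h1 : ∑ j ∈ Finset.Ioc 1 (m + 1),
        (-2 * t * Real.cos (Real.pi * (2 * (j : ℝ) - ((m + 2 : ℕ) : ℝ) - 1) / L)) =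
        ∑ j ∈ Finset.Icc 1 m, (-2 * t * Real.cos (Real.pi * (2 * (j : ℝ) - m - 1) / L)) := by
      symm
      refine Finset.sum_bij (fun j _ => j + 1) ?_ (fun _ _ _ _ h => by omega) ?_ ?_
      · intro j hj
        rw [Finset.mem_Icc] at hj
        rw [Finset.mem_Ioc]
        omega
      · intro j hj
        rw [Finset.mem_Ioc] at hj
        exact ⟨j - 1, by rw [Finset.mem_Icc]; omega, by omega⟩
      · intro j _
        congr 3
        push_cast
        ring
    have h2 : Real.cos (Real.pi * (2 * ((1 : ℕ) : ℝ) - ((m + 2 : ℕ) : ℝ) - 1) / L) =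
        Real.cos (Real.pi * (m + 1) / L) := by
      rw [← Real.cos_neg]
      congr 1
      push_cast
      ring
    have h3 : Real.pi * (2 * ((m + 1 + 1 : ℕ) : ℝ) - ((m + 2 : ℕ) : ℝ) - 1) / L =
        Real.pi * (m + 1) / L := by
      push_cast
      ring
    rw [h1, h2, h3]
    push_cast
    ring

theorem cos_fermi_lt {M m m' : ℕ} (h : m < m') (h' : m' + 1 ≤ M) :
    Real.cos (Real.pi * (m' + 1) / M) < Real.cos (Real.pi * (m + 1) / M) := by
  have hM : (0 : ℝ) < M := by
    have : 0 < M := by omega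
    exact_mod_cast this
  have h1 : (m : ℝ) < m' := by exact_mod_cast h
  have h2 : (m' : ℝ) + 1 ≤ M := by exact_mod_cast h'
  refine Real.cos_lt_cos_of_nonneg_of_le_pi (by positivity) ?_ ?_
  · rw [div_le_iff₀ hM]
    exact mul_le_mul_of_nonneg_left h2 Real.pi_pos.le
  · gcongr

theorem shell_pos (b : Boundary) : 0 < b.shell := by cases b <;> simp [Boundary.shell]

theorem parityOK_iff {Q : Charges L} :
    b.ParityOK Q ↔ ∀ δ ℓ, ∃ k, Q δ ℓ = b.offset L + b.shell * k := by
  cases b with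
  | obc => simp [Boundary.ParityOK, Boundary.offset, Boundary.shell]
  | pbc =>
    simp only [Boundary.ParityOK, Boundary.offset, Boundary.shell]
    refine forall_congr' fun δ => forall_congr' fun ℓ => ?_
    rw [Nat.odd_iff]
    constructor
    · intro h
      exact ⟨Q δ ℓ / 2, by omega⟩
    · rintro ⟨k, hk⟩
      omega

/-- The energy of a wire lies above the supporting line through two neighbouring fillings, and
touches it only at these. -/
theorem wireEnergy_supporting_line {t : ℝ} (ht : 0 < t) {k₀ k : ℕ}
    (hk₀ : b.offset L + b.shell * k₀ < L) (hk : b.offset L + b.shell * k ≤ b.bonds L) :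
    wireEnergy b L t (b.offset L + b.shell * k₀) + ((k : ℝ) - k₀) *
        (wireEnergy b L t (b.offset L + b.shell * k₀ + b.shell) -
          wireEnergy b L t (b.offset L + b.shell * k₀)) ≤
        wireEnergy b L t (b.offset L + b.shell * k) ∧
      (wireEnergy b L t (b.offset L + b.shell * k) ≤
        wireEnergy b L t (b.offset L + b.shell * k₀) + ((k : ℝ) - k₀) *
        (wireEnergy b L t (b.offset L + b.shell * k₀ + b.shell) -
          wireEnergy b L t (b.offset L + b.shell * k₀)) → k = k₀ ∨ k = k₀ + 1) := by
  have hlen : b.bonds L ≤ b.length L ∧ L ≤ b.length L := by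
    cases b <;> simp [Boundary.bonds, Boundary.length]
  have hpos := shell_pos b
  have h := supporting_line (F := fun k => wireEnergy b L t (b.offset L + b.shell * k))
    (D := fun k => wireEnergy b L t (b.offset L + b.shell * k + b.shell) -
      wireEnergy b L t (b.offset L + b.shell * k))
    (P := fun k => b.offset L + b.shell * k + 1 ≤ b.length L)
    (fun k => by simp only [mul_add, mul_one, ← add_assoc]; ring)
    (fun i j hij hj => by
      simp only [wireEnergy_add_shell, add_sub_cancel_left]
      have h1 := cos_fermi_lt (m := b.offset L + b.shell * i) (m' := b.offset L + b.shell * j)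
        (by gcongr) hj
      have h2 : (0 : ℝ) < b.shell := by exact_mod_cast hpos
      have h3 := mul_lt_mul_of_pos_left h1 (mul_pos h2 ht)
      linarith)
    (k₀ := k₀) (by omega) (k := k) (fun j hj => by
      have := Nat.mul_lt_mul_of_pos_left hj hpos
      omega)
  exact h

/-! ### Ground states for a fixed number of electrons -/

theorem mem_fixedNumber {Q : Charges L} {f : Fock (Mode b L)} :
    f ∈ fixedNumber b L Q.electrons ↔ VanishesOnDouble f ∧ ∀ c, f (modes c) ≠ 0 →
      VertOcc (pat c) ∧ (lineCharges (modes c)).total = Q.total ∧ b.ParityOK (lineCharges (modes c)) := by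
  constructor
  · intro h
    refine ⟨fun S hS => by_contra fun h1 => hS (h S h1).1.1, fun c hc => ?_⟩
    obtain ⟨h1, h2, h3⟩ := h _ hc
    rw [physical_modes] at h1
    rw [card_modes, ups_add_downs h1, Charges.electrons, Charges.electrons] at h2
    exact ⟨h1, by omega, h3⟩
  · rintro ⟨h1, h2⟩ S hS
    have hS' : NoDoubleOccupancy S := by_contra fun h => hS (h1 S h)
    obtain ⟨c, rfl⟩ := exists_modes_eq hS'
    obtain ⟨h3, h4, h5⟩ := h2 c hS
    exact ⟨physical_modes.2 h3, by rw [card_modes, ups_add_downs h3, Charges.electrons, h4]; rfl, h5⟩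

theorem card_dir : Fintype.card Dir = 2 := rfl

theorem uniformCharges_total (b : Boundary) (d : ℕ) (A : Finset (Dir × Fin L)) :
    (uniformCharges b d A).total = 2 * L * d + b.shell * A.card := by
  have h : ∀ w : Dir × Fin L, uniformCharges b d A w.1 w.2 = d + if w ∈ A then b.shell else 0 := by
    intro w
    simp only [uniformCharges]
    split_ifs <;> simp
  rw [Charges.total, ← Fintype.sum_prod_type (f := fun w : Dir × Fin L => uniformCharges b d A w.1 w.2)]
  simp only [h]
  rw [Finset.sum_add_distrib, Finset.sum_const, Finset.sum_ite_mem, Finset.univ_inter,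
    Finset.sum_const, Finset.card_univ, Fintype.card_prod, Fintype.card_fin,
    card_dir, smul_eq_mul, smul_eq_mul, mul_comm b.shell]

theorem sum_wireEnergy_uniformCharges (t : ℝ) (d : ℕ) (A : Finset (Dir × Fin L)) :
    ∑ δ, ∑ ℓ, wireEnergy b L t (uniformCharges b d A δ ℓ) =
      (2 * (L : ℝ) - A.card) * wireEnergy b L t d + A.card * wireEnergy b L t (d + b.shell) := by
  have h : ∀ w : Dir × Fin L, wireEnergy b L t (uniformCharges b d A w.1 w.2) =
      wireEnergy b L t d + if w ∈ A then wireEnergy b L t (d + b.shell) - wireEnergy b L t d else 0 := by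
    intro w
    simp only [uniformCharges]
    split_ifs <;> simp
  rw [← Fintype.sum_prod_type (f := fun w : Dir × Fin L => wireEnergy b L t (uniformCharges b d A w.1 w.2))]
  simp only [h]
  rw [Finset.sum_add_distrib, Finset.sum_const, Finset.sum_ite_mem, Finset.univ_inter,
    Finset.sum_const, Finset.card_univ, Fintype.card_prod, Fintype.card_fin,
    card_dir, nsmul_eq_mul, nsmul_eq_mul]
  push_cast
  ring

theorem uniformCharges_injective (b : Boundary) (d : ℕ) :
    Function.Injective (uniformCharges b d : Finset (Dir × Fin L) → Charges L) := by
  intro A A' h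
  ext ⟨δ, ℓ⟩
  have h1 := congrFun (congrFun h δ) ℓ
  have h2 := shell_pos b
  simp only [uniformCharges] at h1
  split_ifs at h1 with h3 h4 h4
  · simp [h3, h4]
  · omega
  · omega
  · simp [h3, h4]

theorem sum_wires_const_add (e c : ℕ) (k : Dir → Fin L → ℕ) :
    ∑ δ, ∑ ℓ, (e + c * k δ ℓ) = 2 * L * e + c * ∑ δ, ∑ ℓ, k δ ℓ := by
  simp only [sum_dir, Finset.sum_add_distrib, Finset.sum_const, Finset.card_univ, Fintype.card_fin,
    card_dir, smul_eq_mul, ← Finset.mul_sum]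
  ring

/-- Among all charges with the same total, the energy of the Fermi sea is least for the charges that
differ by at most one shell from wire to wire, and for no others. -/
theorem uniformCharges_minimal {t : ℝ} (ht : 0 < t) {k₀ r : ℕ}
    (hk₀ : b.offset L + b.shell * k₀ < L) {Q : Charges L} (hpar : b.ParityOK Q)
    (hle : ∀ δ ℓ, Q δ ℓ ≤ b.bonds L)
    (htot : Q.total = 2 * L * (b.offset L + b.shell * k₀) + b.shell * r) :
    (2 * (L : ℝ) - r) * wireEnergy b L t (b.offset L + b.shell * k₀) +
        r * wireEnergy b L t (b.offset L + b.shell * k₀ + b.shell) ≤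
        ∑ δ, ∑ ℓ, wireEnergy b L t (Q δ ℓ) ∧
      (∑ δ, ∑ ℓ, wireEnergy b L t (Q δ ℓ) ≤
        (2 * (L : ℝ) - r) * wireEnergy b L t (b.offset L + b.shell * k₀) +
        r * wireEnergy b L t (b.offset L + b.shell * k₀ + b.shell) →
        ∃ A : Finset (Dir × Fin L), A.card = r ∧ Q = uniformCharges b (b.offset L + b.shell * k₀) A) := by
  have hpos := shell_pos b
  choose k hk using parityOK_iff.1 hpar
  have hQ : Q = fun δ ℓ => b.offset L + b.shell * k δ ℓ := funext fun δ => funext fun ℓ => hk δ ℓ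
  have hsum : ∑ δ, ∑ ℓ, k δ ℓ = 2 * L * k₀ + r := by
    have h1 : 2 * L * b.offset L + b.shell * ∑ δ, ∑ ℓ, k δ ℓ =
        2 * L * (b.offset L + b.shell * k₀) + b.shell * r := by
      rw [← sum_wires_const_add, ← htot, hQ]
      rfl
    refine Nat.eq_of_mul_eq_mul_left hpos ?_
    linarith
  set E₀ := wireEnergy b L t (b.offset L + b.shell * k₀) with hE₀
  set E₁ := wireEnergy b L t (b.offset L + b.shell * k₀ + b.shell) with hE₁
  have hline := fun δ ℓ => wireEnergy_supporting_line ht hk₀ (k := k δ ℓ) (by rw [← hk]; exact hle δ ℓ)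
  have hlin : ∑ δ, ∑ ℓ, (E₀ + ((k δ ℓ : ℝ) - k₀) * (E₁ - E₀)) = (2 * (L : ℝ) - r) * E₀ + r * E₁ := by
    have h1 : (∑ δ, ∑ ℓ, (k δ ℓ : ℝ)) = 2 * L * k₀ + r := by exact_mod_cast hsum
    simp only [Finset.sum_add_distrib, ← Finset.sum_mul, Finset.sum_sub_distrib, h1]
    simp only [Finset.sum_const, Finset.card_univ, Fintype.card_fin, card_dir, nsmul_eq_mul]
    push_cast
    ring
  rw [← hlin]
  have hle' : ∀ w : Dir × Fin L, E₀ + ((k w.1 w.2 : ℝ) - k₀) * (E₁ - E₀) ≤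
      wireEnergy b L t (Q w.1 w.2) := fun w => by
    rw [hk]
    exact (hline w.1 w.2).1
  rw [← Fintype.sum_prod_type (f := fun w : Dir × Fin L => wireEnergy b L t (Q w.1 w.2)),
    ← Fintype.sum_prod_type (f := fun w : Dir × Fin L => E₀ + ((k w.1 w.2 : ℝ) - k₀) * (E₁ - E₀))]
  refine ⟨Finset.sum_le_sum fun w _ => hle' w, fun h => ?_⟩
  have heq := (Finset.sum_eq_sum_iff_of_le fun w _ => hle' w).1
    (le_antisymm (Finset.sum_le_sum fun w _ => hle' w) h)
  have hk01 : ∀ δ ℓ, k δ ℓ = k₀ ∨ k δ ℓ = k₀ + 1 := fun δ ℓ => by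
    refine (hline δ ℓ).2 ?_
    rw [← hk]
    exact (heq (δ, ℓ) (Finset.mem_univ _)).ge
  have hA : Q = uniformCharges b (b.offset L + b.shell * k₀)
      (Finset.univ.filter fun w : Dir × Fin L => k w.1 w.2 = k₀ + 1) := by
    funext δ ℓ
    rw [hk, uniformCharges]
    simp only [Finset.mem_filter, Finset.mem_univ, true_and]
    rcases hk01 δ ℓ with h1 | h1
    · rw [h1, if_neg (by omega)]
    · rw [h1, if_pos rfl]
      ring
  refine ⟨_, ?_, hA⟩
  rw [hA, uniformCharges_total] at htot
  exact Nat.eq_of_mul_eq_mul_left hpos (by omega)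

/-- The ground states for a fixed number of electrons: an eigenstate with the lowest energy is supported on
the sectors of least energy, and in each of them it is a multiple of the spin-symmetric state. -/
theorem fixedNumber_groundSpace (hL : 2 ≤ L) {t : ℝ} (ht : 0 < t) {Q : Charges L} {k₀ r : ℕ}
    (hr : r ≤ 2 * L) (hk₀ : b.offset L + b.shell * k₀ < L)
    (htot : Q.total = 2 * L * (b.offset L + b.shell * k₀) + b.shell * r)
    (hadm : ∀ A : Finset (Dir × Fin L), A.card = r →
      b.Admissible (uniformCharges b (b.offset L + b.shell * k₀) A)) :
    HasGroundSpace (hamiltonian b L t) (fixedNumber b L Q.electrons)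
      ((2 * (L : ℝ) - r) * wireEnergy b L t (b.offset L + b.shell * k₀) +
        r * wireEnergy b L t (b.offset L + b.shell * k₀ + b.shell))
      (Submodule.span ℂ {ψ | ∃ s ≤ Q.electrons, ∃ A : Finset (Dir × Fin L), A.card = r ∧
        ψ = seaState (uniformCharges b (b.offset L + b.shell * k₀) A) s}) := by
  classical
  set d := b.offset L + b.shell * k₀ with hd
  have helec : ∀ A : Finset (Dir × Fin L), A.card = r → (uniformCharges b d A).electrons = Q.electrons := by
    intro A hA
    rw [Charges.electrons, Charges.electrons, uniformCharges_total, hA, htot]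
  have hen : ∀ A : Finset (Dir × Fin L), A.card = r →
      ∑ δ, ∑ ℓ, wireEnergy b L t (uniformCharges b d A δ ℓ) =
      (2 * (L : ℝ) - r) * wireEnergy b L t d + r * wireEnergy b L t (d + b.shell) := by
    rintro A rfl
    exact sum_wireEnergy_uniformCharges t d A
  have hmem : ∀ A : Finset (Dir × Fin L), A.card = r → ∀ s,
      seaState (uniformCharges b d A) s ∈ fixedNumber b L Q.electrons := by
    intro A hA s
    refine mem_fixedNumber.2 ⟨seaState_vanishesOnDouble _ _, fun c hc => ?_⟩
    obtain ⟨h1, h2, -⟩ := inSector_of_seaState_ne_zero hc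
    rw [h2, uniformCharges_total, hA, htot]
    exact ⟨h1, rfl, (hadm A hA).1⟩
  have heig : ∀ A : Finset (Dir × Fin L), A.card = r → ∀ s,
      hamiltonian b L t (seaState (uniformCharges b d A) s) =
      (((2 * (L : ℝ) - r) * wireEnergy b L t d + r * wireEnergy b L t (d + b.shell) : ℝ) : ℂ) •
        seaState (uniformCharges b d A) s := by
    intro A hA s
    rw [hamiltonian_seaState hL t (hadm A hA).1, hen A hA]
  have hmin : ∀ c : Cfg b L, (lineCharges (modes c)).total = Q.total →
      b.ParityOK (lineCharges (modes c)) → _ := fun c h1 h2 =>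
    uniformCharges_minimal ht hk₀ (r := r) h2 (fun δ ℓ => by
      rw [lineCharges_modes]
      exact (Finset.card_le_univ _).trans_eq (Fintype.card_fin _)) (h1.trans htot)
  refine ⟨⟨?_, ?_⟩, le_antisymm ?_ ?_⟩
  · obtain ⟨A, -, hA⟩ := Finset.exists_subset_card_eq
      (show r ≤ (Finset.univ : Finset (Dir × Fin L)).card by
        rw [Finset.card_univ, Fintype.card_prod, Fintype.card_fin]
        exact hr)
    obtain ⟨c, hc⟩ := exists_inSector (b := b) (fun δ ℓ => ((hadm A hA).2 δ ℓ).2) (Nat.zero_le _)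
    exact ⟨_, hmem A hA 0, fun h => seaState_ne_zero (by omega) hc (by rw [h]; rfl), heig A hA 0⟩
  · rintro E ⟨ψ, hψ, hne, hE⟩
    rw [mem_fixedNumber] at hψ
    obtain ⟨c, hc⟩ := exists_modes_ne_zero hψ.1 hne
    obtain ⟨h1, h2, h3⟩ := hψ.2 c hc
    exact (hmin c h2 h3).1.trans
      (wireEnergy_le_of_eigenstate hL ht h3 hψ.1 hE (s := downs c) ⟨h1, rfl, rfl⟩ hc)
  · rintro ψ ⟨hψ, hE⟩
    rw [SetLike.mem_coe, mem_fixedNumber] at hψ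
    rw [SetLike.mem_coe, Module.End.mem_eigenspace_iff] at hE
    have hz : ∀ p : ℕ × Finset (Dir × Fin L), ∃ z : ℂ, p.2.card = r →
        ∀ c, InSector (uniformCharges b d p.2) p.1 c → ψ (modes c) = z * (gauge c * seaAmp c) := by
      intro p
      by_cases hp : p.2.card = r
      · obtain ⟨z, hz⟩ := eq_const_mul_of_eigenstate hL ht (hadm p.2 hp) p.1 hψ.1
          (by rw [hen p.2 hp]; exact hE)
        exact ⟨z, fun _ => hz⟩
      · exact ⟨0, fun h => absurd h hp⟩
    choose z hz using hz
    have hψ_eq : ψ = ∑ p ∈ Finset.range (Q.electrons + 1) ×ˢ Finset.powersetCard r Finset.univ,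
        z p • seaState (uniformCharges b d p.2) p.1 := by
      refine fock_ext hψ.1 (.sum fun p _ => (seaState_vanishesOnDouble _ _).smul _) fun c => ?_
      rw [Finset.sum_apply]
      by_cases hc : ψ (modes c) = 0
      · rw [hc, eq_comm]
        refine Finset.sum_eq_zero fun p hp => ?_
        rw [Finset.mem_product, Finset.mem_powersetCard] at hp
        rw [Pi.smul_apply, seaState_modes, smul_eq_mul]
        split_ifs with h1
        · rw [← hz p hp.2.2 c h1, hc]
        · rw [mul_zero]
      · obtain ⟨h1, h2, h3⟩ := hψ.2 c hc
        obtain ⟨A, hA, hQA⟩ := (hmin c h2 h3).2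
          (wireEnergy_le_of_eigenstate hL ht h3 hψ.1 hE (s := downs c) ⟨h1, rfl, rfl⟩ hc)
        have hsec : InSector (uniformCharges b d A) (downs c) c := ⟨h1, hQA, rfl⟩
        rw [Finset.sum_eq_single (downs c, A)]
        · rw [Pi.smul_apply, seaState_modes, if_pos hsec, smul_eq_mul]
          exact hz (downs c, A) hA c hsec
        · intro p _ hp
          rw [Pi.smul_apply, seaState_modes, if_neg, smul_zero]
          rintro ⟨-, h5, h6⟩
          exact hp (Prod.ext h6.symm (uniformCharges_injective b d (h5.symm.trans hQA)))
        · intro hp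
          refine absurd ?_ hp
          rw [Finset.mem_product, Finset.mem_range, Finset.mem_powersetCard]
          have h4 := ups_add_downs h1
          rw [hQA, helec A hA] at h4
          exact ⟨by simp only; omega, Finset.subset_univ _, hA⟩
    rw [hψ_eq]
    refine Submodule.sum_mem _ fun p hp => Submodule.smul_mem _ _ (Submodule.subset_span ?_)
    rw [Finset.mem_product, Finset.mem_range, Finset.mem_powersetCard] at hp
    exact ⟨p.1, by omega, p.2, hp.2.2, rfl⟩
  · rw [Submodule.span_le]
    rintro ψ ⟨s, -, A, hA, rfl⟩
    exact ⟨hmem A hA s, Module.End.mem_eigenspace_iff.2 (heig A hA s)⟩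

/-- The spin-symmetric states of different sectors are linearly independent. -/
theorem finrank_span_seaState (hL : 0 < L) {d r N : ℕ}
    (hadm : ∀ A : Finset (Dir × Fin L), A.card = r → b.Admissible (uniformCharges b d A))
    (hN : ∀ A : Finset (Dir × Fin L), A.card = r → (uniformCharges b d A).electrons = N) :
    Module.finrank ℂ (Submodule.span ℂ {ψ : Fock (Mode b L) | ∃ s ≤ N, ∃ A : Finset (Dir × Fin L),
      A.card = r ∧ ψ = seaState (uniformCharges b d A) s}) = (N + 1) * (2 * L).choose r := by
  classical
  let I : Finset (ℕ × Finset (Dir × Fin L)) :=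
    Finset.range (N + 1) ×ˢ Finset.powersetCard r Finset.univ
  have hI : ∀ p : I, p.1.1 ≤ N ∧ p.1.2.card = r := fun p => by
    have := p.2
    rw [Finset.mem_product, Finset.mem_range, Finset.mem_powersetCard] at this
    exact ⟨by omega, this.2.2⟩
  let φ : I → Fock (Mode b L) := fun p => seaState (uniformCharges b d p.1.2) p.1.1
  have hrange : {ψ : Fock (Mode b L) | ∃ s ≤ N, ∃ A : Finset (Dir × Fin L),
      A.card = r ∧ ψ = seaState (uniformCharges b d A) s} = Set.range φ := by
    ext ψ
    constructor
    · rintro ⟨s, hs, A, hA, rfl⟩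
      refine ⟨⟨(s, A), ?_⟩, rfl⟩
      rw [Finset.mem_product, Finset.mem_range, Finset.mem_powersetCard]
      exact ⟨by simp only; omega, Finset.subset_univ _, hA⟩
    · rintro ⟨p, rfl⟩
      exact ⟨p.1.1, (hI p).1, p.1.2, (hI p).2, rfl⟩
  have hlin : LinearIndependent ℂ φ := by
    rw [Fintype.linearIndependent_iff]
    intro g hg p
    obtain ⟨c, hc⟩ := exists_inSector (b := b) (fun δ ℓ => ((hadm p.1.2 (hI p).2).2 δ ℓ).2)
      (s := p.1.1) (by rw [hN _ (hI p).2]; exact (hI p).1)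
    have h1 := congrFun hg (modes c)
    rw [Finset.sum_apply, Finset.sum_eq_single p] at h1
    · exact (mul_eq_zero.1 h1).resolve_right (seaState_ne_zero hL hc)
    · intro p' _ hp'
      simp only [φ]
      rw [Pi.smul_apply, seaState_modes, if_neg, smul_zero]
      rintro ⟨-, h5, h6⟩
      exact hp' (Subtype.ext (Prod.ext (h6.symm.trans hc.2.2)
        (uniformCharges_injective b d (h5.symm.trans hc.2.1))))
    · simp
  rw [hrange, finrank_span_eq_card hlin, Fintype.card_coe, Finset.card_product, Finset.card_range,
    Finset.card_powersetCard, Finset.card_univ, Fintype.card_prod, Fintype.card_fin]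
  rfl

/-- The number of electrons determines the filling of the wires. -/
theorem exists_filling (hL : 0 < L) {Q : Charges L} (hQ : b.Admissible Q) :
    ∃ k₀ r : ℕ, Q.total = 2 * L * (b.offset L + b.shell * k₀) + b.shell * r ∧ r < 2 * L ∧
      b.offset L + b.shell * k₀ < L ∧ ∀ A : Finset (Dir × Fin L), A.card = r →
        b.Admissible (uniformCharges b (b.offset L + b.shell * k₀) A) := by
  have hpos := shell_pos b
  choose k hk using parityOK_iff.1 hQ.1
  set K := ∑ δ, ∑ ℓ, k δ ℓ with hK
  have hsum : Q.total = 2 * L * b.offset L + b.shell * K := by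
    rw [hK, ← sum_wires_const_add]
    exact Finset.sum_congr rfl fun δ _ => Finset.sum_congr rfl fun ℓ _ => hk δ ℓ
  have hcount : ∀ n : ℕ, ∑ _δ : Dir, ∑ _ℓ : Fin L, n = 2 * L * n := fun n => by
    simp only [Finset.sum_const, Finset.card_univ, Fintype.card_fin, card_dir, smul_eq_mul]
    ring
  have hdiv := Nat.div_add_mod K (2 * L)
  have hmod := Nat.mod_lt K (show 0 < 2 * L by omega)
  set k₀ := K / (2 * L) with hk₀
  set r := K % (2 * L) with hr
  -- the extreme numbers of shells compatible with the conditions on the charges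
  have hlow : ∀ m, (∀ δ ℓ, m ≤ k δ ℓ) → m ≤ k₀ := fun m hm => by
    rw [hk₀, Nat.le_div_iff_mul_le (by omega), mul_comm, ← hcount, hK]
    exact Finset.sum_le_sum fun δ _ => Finset.sum_le_sum fun ℓ _ => hm δ ℓ
  have hhigh : ∀ m, (∀ δ ℓ, k δ ℓ ≤ m) → k₀ ≤ m ∧ (k₀ = m → r = 0) := fun m hm => by
    have h1 : K ≤ 2 * L * m := by
      rw [← hcount, hK]
      exact Finset.sum_le_sum fun δ _ => Finset.sum_le_sum fun ℓ _ => hm δ ℓ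
    refine ⟨?_, fun h => ?_⟩
    · rw [hk₀]
      exact Nat.div_le_of_le_mul h1
    · rw [← h] at h1
      omega
  have hd : 0 < b.offset L + b.shell * k₀ := by
    rcases Nat.eq_zero_or_pos (b.offset L) with h0 | h0
    · have := hlow 1 fun δ ℓ => by
        have h1 := (hQ.2 δ ℓ).1
        rw [hk, h0, zero_add] at h1
        exact Nat.pos_of_mul_pos_left h1
      rw [h0, zero_add]
      exact Nat.mul_pos hpos this
    · omega
  have hm : ∀ δ ℓ, k δ ℓ ≤ (L - 1 - b.offset L) / b.shell := fun δ ℓ => by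
    rw [Nat.le_div_iff_mul_le hpos, mul_comm]
    have h1 := (hQ.2 δ ℓ).2
    rw [hk] at h1
    omega
  obtain ⟨h1, h2⟩ := hhigh _ hm
  have hoff : b.offset L < L := by
    have h3 := (hQ.2 .x ⟨0, hL⟩).2
    rw [hk] at h3
    omega
  have hup : ∀ j, j ≤ (L - 1 - b.offset L) / b.shell → b.offset L + b.shell * j < L := fun j hj => by
    rw [Nat.le_div_iff_mul_le hpos, mul_comm] at hj
    omega
  refine ⟨k₀, r, ?_, hmod, hup k₀ h1, fun A hA => ⟨?_, fun δ ℓ => ?_⟩⟩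
  · rw [hsum, ← hdiv]
    ring
  · rw [parityOK_iff]
    intro δ ℓ
    rw [uniformCharges]
    split_ifs
    · exact ⟨k₀ + 1, by ring⟩
    · exact ⟨k₀, rfl⟩
  · rw [uniformCharges]
    split_ifs with hmemA
    · have h3 : r ≠ 0 := by
        rw [← hA]
        exact (Finset.card_pos.2 ⟨_, hmemA⟩).ne'
      have h4 := hup (k₀ + 1) (lt_of_le_of_ne h1 fun e => h3 (h2 e))
      rw [mul_add, mul_one, ← add_assoc] at h4
      exact ⟨by omega, h4⟩
    · exact ⟨hd, hup k₀ h1⟩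

end LiebLattice

end

open LiebLattice
theorem mainTheorem1 (b : Boundary) (L : ℕ) (hL : 0 < L) (t : ℝ) (ht : 0 < t)
    (Q : Charges L) (hQ : b.Admissible Q) :
    -- one ground state, fully polarized, for given row and column charges and `S^z_tot = N / 2 - s`
    (∀ s : ℕ, s ≤ Q.electrons →
      ∃ G : Submodule ℂ (Fock (Mode b L)),
        HasGroundSpace (hamiltonian b L t) (sector b Q ((Q.electrons : ℚ) / 2 - s))
          (∑ δ, ∑ ℓ, wireEnergy b L t (Q δ ℓ)) G ∧
        G = Submodule.span ℂ {(spinLower b L ^ s) (fermiSea b Q)} ∧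
        Module.finrank ℂ G = 1 ∧
        FullyPolarized b L Q.electrons G) ∧
    -- the ground states among all states with the same number of electrons
    (∃ d r : ℕ, Q.total = 2 * L * d + b.shell * r ∧ r < 2 * L ∧
      b.ParityOK (fun _ _ => d : Charges L) ∧
      ∃ G : Submodule ℂ (Fock (Mode b L)),
        HasGroundSpace (hamiltonian b L t) (fixedNumber b L Q.electrons)
          ((2 * (L : ℝ) - r) * wireEnergy b L t d + r * wireEnergy b L t (d + b.shell)) G ∧
        G = Submodule.span ℂ {ψ | ∃ s ≤ Q.electrons, ∃ A : Finset (Dir × Fin L), A.card = r ∧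
          ψ = (spinLower b L ^ s) (fermiSea b (uniformCharges b d A))} ∧
        Module.finrank ℂ G = (Q.electrons + 1) * (2 * L).choose r ∧
        FullyPolarized b L Q.electrons G) := by
  constructor
  · intro s hs
    obtain ⟨ζ, hζ, h⟩ := exists_spinLower_pow_fermiSea b hL Q s
    obtain ⟨c, hc⟩ := exists_inSector (b := b) (fun δ ℓ => (hQ.2 δ ℓ).2) hs
    refine ⟨_, sector_groundSpace hL ht hQ hs, ?_, finrank_span_singleton fun e => ?_, ?_⟩
    · rw [h, Submodule.span_singleton_smul_eq (isUnit_iff_ne_zero.2 hζ)]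
    · exact seaState_ne_zero hL hc (by rw [e]; rfl)
    · exact fullyPolarized_span fun ψ hψ => ⟨Q, s, rfl, hψ⟩
  · obtain ⟨k₀, r, htot, hr, hk₀, hadm⟩ := exists_filling hL hQ
    have hN : ∀ A : Finset (Dir × Fin L), A.card = r →
        (uniformCharges b (b.offset L + b.shell * k₀) A).electrons = Q.electrons := by
      intro A hA
      rw [Charges.electrons, Charges.electrons, uniformCharges_total, hA, htot]
    refine ⟨b.offset L + b.shell * k₀, r, htot, hr, parityOK_iff.2 fun _ _ => ⟨k₀, rfl⟩, _,
      fixedNumber_groundSpace (hQ.two_le hL) ht hr.le hk₀ htot hadm, ?_,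
      finrank_span_seaState hL hadm hN, ?_⟩
    · apply le_antisymm <;> rw [Submodule.span_le]
      · rintro ψ ⟨s, hs, A, hA, rfl⟩
        obtain ⟨ζ, hζ, h⟩ := exists_spinLower_pow_fermiSea b hL
          (uniformCharges b (b.offset L + b.shell * k₀) A) s
        rw [← inv_smul_smul₀ hζ (seaState _ s), ← h]
        exact Submodule.smul_mem _ _ (Submodule.subset_span ⟨s, hs, A, hA, rfl⟩)
      · rintro ψ ⟨s, hs, A, hA, rfl⟩
        obtain ⟨ζ, hζ, h⟩ := exists_spinLower_pow_fermiSea b hL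
          (uniformCharges b (b.offset L + b.shell * k₀) A) s
        rw [h]
        exact Submodule.smul_mem _ _ (Submodule.subset_span ⟨s, hs, A, hA, rfl⟩)
    · exact fullyPolarized_span fun ψ ⟨s, _, A, hA, e⟩ => ⟨_, s, hN A hA, e⟩
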